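/- **Notation.** $\mathbb N=\{1,2,\dots\}$, $\mathbb N_0=\mathbb N\cup\{0\}$, $\langle j\rangle=\max(1,|j|)$. Fix $\eta>0$. $\mathbb Z^\infty_*$ is the set of finitely supported $\ell\in\mathbb Z^{\mathbb N}$, $|\ell|_\eta=\sum_j j^\eta|\ell_j|$, $\mathtt d(\ell)=\prod_{n}(1+|\ell_n|^4\langle n\rangle^4)$. Frequencies $\omega\in[1,2]^{\mathbb N}$ carry the $\ell^\infty$ distance, and $\mathtt D_\gamma$ is the set of $\omega\in[1,2]^{\mathbb N}$ with $|\omega\cdot\ell|>\gamma\prod_j(1+|\ell_j|^2\langle j\rangle^2)^{-1}$ for all $\ell\in\mathbb Z^\infty_*\setminus\{0\}$. $\mathbf E_j=\mathrm{span}\{e^{ijx},e^{-ijx}\}\subset L^2(\mathbb T)$, $\mathbb T=\mathbb R/2\pi\mathbb Z$, $\Pi_j$ is the orthogonal projection on $\mathbf E_j$, $\mathcal S(\mathbf E_j)$ the self-adjoint operators on $\mathbf E_j$, $\|\cdot\|_{\mathtt{HS}}$ the Hilbert–Schmidt norm on $\mathcal B(\mathbf E_{j'},\mathbf E_j)$ and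 $\|\cdot\|_{\rm Op}$ the operator norm it induces for operators on $\mathcal B(\mathbf E_{j'},\mathbf E_j)$. For an operator $R$ put $$\|R\|_{\mathcal B^{\sigma,m}}=\sup_{j'\in\mathbb N_0}\sum_{j\in\mathbb N_0}e^{\sigma|j-j'|}\|\Pi_jR\Pi_{j'}\|_{\mathtt{HS}}\langle j'\rangle^{-m},\qquad \mathcal B^\sigma=\mathcal B^{\sigma,0}.$$ $\mathbb T^\infty_\sigma$ is the set of $\varphi=(\varphi_j)_{j\in\mathbb N}$ with $\mathrm{Re}\,\varphi_j\in\mathbb T$, $|\mathrm{Im}\,\varphi_j|\le\sigma j^\eta$, and $\mathbb T^\infty$ the set of real $\varphi$. $\mathcal H(\mathbb T^\infty_\sigma,\mathcal B^{\sigma,m})$ is the space of $R(\varphi)=\sum_{\ell\in\mathbb Z^\infty_*}\widehat R(\ell)e^{i\ell\cdot\varphi}$ with $|R|_{\sigma,m}=\sum_\ell e^{\sigma|\ell|_\eta}\|\widehat R(\ell)\|_{\mathcal B^{\sigma,m}}<\infty$; $R$ is skew self-adjoint if $R(\varphi)^*=-R(\varphi)$ for all $\varphi\in\mathbb T^\infty$;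 $\omega\cdot\partial_\varphi R=\sum_\ell i(\omega\cdot\ell)\widehat R(\ell)e^{i\ell\cdot\varphi}$. If $R$ depends on $\omega\in\Omega$, $$|R|^{\mathrm{Lip}(\gamma,\Omega)}_{\sigma,m}=\sup_{\omega\in\Omega}|R(\omega)|_{\sigma,m}+\gamma\sup_{\omega_1\ne\omega_2\in\Omega}\frac{|R(\omega_1)-R(\omega_2)|_{\sigma,m+2}}{\|\omega_1-\omega_2\|_\infty},$$ while for a function $f$ on $\Omega$ with values in a finite-dimensional normed space $\|f\|^{\rm lip}$ is its Lipschitz seminorm on $\Omega$ and $\|f\|^{\mathrm{Lip}(\gamma,\Omega)}=\sup_\Omega\|f\|+\gamma\|f\|^{\rm lip}$. For $\Phi(\varphi)$ invertible, $(\Phi_{\omega*}\mathcal L)(\varphi)=\Phi(\varphi)^{-1}\mathcal L(\varphi)\Phi(\varphi)-\Phi(\varphi)^{-1}\,\omega\cdot\partial_\varphi\Phi(\varphi)$. A block diagonal operator $\mathrm{diag}_jD(j)$, $D(j)\in\mathcal B(\mathbf E_j)$, is considered on its maximal domain in $L^2(\mathbb T)$. **Initial operator.** Let $\sigma_0>0$,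 $\chi\in(1,2)$, $K>0$, and for $N_0>0$, $n\ge0$ set $\sigma_n=\sigma_0\big(1-\frac1{4\pi}\sum_{j=1}^n\frac1{j^2}\big)$, $N_n=\langle n\rangle^3\chi^nN_0$. For $\gamma\in(0,1)$, $\varepsilon>0$, $\omega\in\mathtt D_\gamma$ let $\mathcal L_0(\varphi)=i\mathcal D_0+\mathcal P_0(\varphi)$, where $\mathcal P_0\in\mathcal H(\mathbb T^\infty_{\sigma_0},\mathcal B^{\sigma_0,-2})$ is skew self-adjoint and $\mathcal D_0=\mathrm{diag}_j\mathcal D_0(j)$ acts by $e^{ikx}\mapsto\mu_ke^{ikx}$ with $\mu_k=-\lambda_2k^2+\lambda_1k+\lambda_0-\lambda_{-1}k^{-1}$ for $k\ne0$ and $\mu_0=\lambda_0$; here $\lambda_2,\lambda_1\in\mathbb R$ do not depend on $\omega$, $\lambda_0,\lambda_{-1}:\mathtt D_\gamma\to\mathbb R$, and $$|\lambda_2-1|,\ |\lambda_1|,\ |\lambda_0|^{\mathrm{Lip}(\gamma,\mathtt D_\gamma)},\ |\lambda_{-1}|^{\mathrm{Lip}(\gamma,\mathtt D_\gamma)},\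 |\mathcal P_0|_{\sigma_0,-2}^{\mathrm{Lip}(\gamma,\mathtt D_\gamma)}\le K\varepsilon .$$ **Theorem (Reducibility).** There are $\bar N>0$, $\delta\in(0,1)$, $C_*>0$, $C>0$, depending only on $\eta,\sigma_0,\chi,K$, such that for all $N_0\ge\bar N$, $\gamma\in(0,1)$, $\varepsilon>0$ with $\varepsilon\gamma^{-1}\le\delta$ and every $\mathcal L_0$ as above, there are sequences $\mathcal D_n,\mathcal P_n$ ($n\ge0$, starting from the given $\mathcal D_0,\mathcal P_0$), $\mathcal F_n$ ($n\ge1$) for which the following holds for every $n\ge0$. $\mathbf{(S1)_n}$ Let $\Omega_0(\gamma)=\mathtt D_\gamma$ and, for $n\ge1$, let $\Omega_n(\gamma)$ be the set of $\omega\in\Omega_{n-1}(\gamma)$ such that, for all $\ell\in\mathbb Z^\infty_*$ with $|\ell|_\eta\le N_{n-1}$, the operators $\mathcal O_{n-1}(\ell,j,j')X=(\omega\cdot\ell)X+\mathcal D_{n-1}(j)X-X\mathcal D_{n-1}(j')$ on $\mathcal B(\mathbf E_{j'},\mathbf E_j)$ are invertible with $$\|\mathcal O_{n-1}(\ell,j,j')^{-1}\|_{\rm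 Op}\le\frac{\mathtt d(\ell)}\gamma\ \ (j\ne j'\in\mathbb N_0),\qquad \|\mathcal O_{n-1}(\ell,j,j)^{-1}\|_{\rm Op}\le\frac{\mathtt d(\ell)\langle j\rangle^2}\gamma\ \ (\ell\ne0,\ j\in\mathbb N_0).$$ For $\omega\in\Omega_n(\gamma)$ the vector field $\mathcal L_n(\varphi)=i\mathcal D_n+\mathcal P_n(\varphi)$ is skew self-adjoint for $\varphi\in\mathbb T^\infty$, $\mathcal D_n=\mathrm{diag}_j\mathcal D_n(j)$ with $\mathcal D_n(j)\in\mathcal S(\mathbf E_j)$, $\mathcal P_n\in\mathcal H(\mathbb T^\infty_{\sigma_n},\mathcal B^{\sigma_n,-2})$ is skew self-adjoint, and $$\|\mathcal D_n(j)-\mathcal D_0(j)\|_{\mathtt{HS}}^{\mathrm{Lip}(\gamma,\Omega_n(\gamma))}\le C\varepsilon\quad(j\in\mathbb N_0),\qquad |\mathcal P_n|_{\sigma_n,-2}^{\mathrm{Lip}(\gamma,\Omega_n(\gamma))}\le C_*\varepsilon e^{-\chi^n}.$$ If $n\ge1$, put $s_n=\frac{\sigma_{n-1}+\sigma_n}2$.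 For $\omega\in\Omega_n(\gamma)$, $\mathcal F_n\in\mathcal H(\mathbb T^\infty_{s_n},\mathcal B^{s_n})$ is skew self-adjoint, $\Phi_n(\varphi)=\exp(\mathcal F_n(\varphi))$ belongs to $\mathcal H(\mathbb T^\infty_{s_n},\mathcal B^{s_n})$, $\mathcal L_n(\varphi)=(\Phi_n)_{\omega*}\mathcal L_{n-1}(\varphi)$ for all $\varphi\in\mathbb T^\infty_{\sigma_n}$ (as unbounded operators, domains included), and $$|\mathcal F_n|_{s_n,0}^{\mathrm{Lip}(\gamma,\Omega_n(\gamma))}\le C\varepsilon\gamma^{-1}e^{-\chi^{n-1}/2}.$$ $\mathbf{(S2)_n}$ For every $j\in\mathbb N_0$ the function $\mathcal D_n(j;\cdot):\Omega_n(\gamma)\to\mathcal S(\mathbf E_j)$ has a Lipschitz extension $\widetilde{\mathcal D}_n(j;\cdot):\mathtt D_\gamma\to\mathcal S(\mathbf E_j)$, and these satisfy, for $n\ge1$, $$\sup_{\omega\in\mathtt D_\gamma}\|\widetilde{\mathcal D}_n(j;\omega)-\widetilde{\mathcal D}_{n-1}(j;\omega)\|_{\mathtt{HS}}\le C\langle j\rangle^{-2}\varepsilon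 e^{-\chi^{n-1}},\qquad \|\widetilde{\mathcal D}_n(j)-\widetilde{\mathcal D}_{n-1}(j)\|_{\mathtt{HS}}^{\rm lip}\le C\varepsilon\gamma^{-1}e^{-\chi^{n-1}},$$ the last seminorm being taken on $\mathtt D_\gamma$. -/

import Mathlib

open scoped ENNReal

noncomputable section

namespace AlmostPeriodicKAM

/-! ### Frequencies and Fourier indices -/

/-- The space `ℓ^∞(ℕ, ℝ)`, `ℕ = {1, 2, …}`, with its sup norm. -/
abbrev Freq : Type := lp (fun _ : ℕ+ => ℝ) ∞

/-- The finitely supported integer vectors `ℤ^∞_*`. -/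
abbrev Idx : Type := ℕ+ →₀ ℤ

/-- `⟨j⟩ = max (1, |j|)` on natural numbers. -/
def jap (j : ℕ) : ℝ := max 1 (j : ℝ)

/-- `|ℓ|_η = ∑ j^η |ℓ_j|`. -/
def Idx.wt (η : ℝ) (l : Idx) : ℝ := l.sum fun j z => ((j : ℕ) : ℝ) ^ η * |(z : ℝ)|

/-- `ω · ℓ`. -/
def freqDot (ω : Freq) (l : Idx) : ℝ := l.sum fun j z => ω j * (z : ℝ)

/-- The cube `[1, 2]^ℕ`. -/
def R0 : Set Freq := {ω | ∀ j : ℕ+, ω j ∈ Set.Icc (1 : ℝ) 2}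

/-- The Diophantine frequencies `D_γ` (exponent `μ = 2`). -/
def diophSet (γ : ℝ) : Set Freq :=
  {ω | ω ∈ R0 ∧ ∀ l : Idx, l ≠ 0 →
    γ * (l.prod fun j z => (1 + |(z : ℝ)| ^ 2 * ((j : ℕ) : ℝ) ^ 2)⁻¹) < |freqDot ω l|}

/-- The divisor `d(ℓ) = ∏ (1 + |ℓ_n|⁴ ⟨n⟩⁴)`. -/
def smallDiv (l : Idx) : ℝ := l.prod fun j z => 1 + |(z : ℝ)| ^ 4 * ((j : ℕ) : ℝ) ^ 4

/-! ### Operators on `L²(𝕋)`, `𝕋 = ℝ / 2πℤ`, and their blocks -/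

instance two_pi_pos_fact : Fact (0 < 2 * Real.pi) := ⟨Real.two_pi_pos⟩

/-- `L²(𝕋, ℂ)` with the normalized measure, so that `e^{ikx}`, `k ∈ ℤ`, is an orthonormal basis. -/
abbrev L2 : Type :=
  MeasureTheory.Lp ℂ 2 (AddCircle.haarAddCircle : MeasureTheory.Measure (AddCircle (2 * Real.pi)))

/-- Bounded operators on `L²(𝕋)`. -/
abbrev Op : Type := L2 →L[ℂ] L2

/-- The `k`-th Fourier coefficient of `u`. -/
def coef (u : L2) (k : ℤ) : ℂ := fourierBasis.repr u k

/-- The matrix element `R_k^{k'}` in the exponential basis. -/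
def matElt (R : Op) (k k' : ℤ) : ℂ := coef (R (fourierLp 2 k')) k

/-- The indices `k` with `|k| = j`: one for `j = 0`, two for `j ≥ 1`. They label the exponentials
spanning `E_j`. -/
def blockIdx (j : ℕ) : Finset ℤ := {(j : ℤ), -(j : ℤ)}

/-- `B(E_{j'}, E_j)`, in the exponential bases. -/
abbrev Block (j j' : ℕ) : Type := Matrix (blockIdx j) (blockIdx j') ℂ

/-- `Π_j R Π_{j'}`. -/
def blockOf (R : Op) (j j' : ℕ) : Block j j' := fun k k' => matElt R k k'

/-- The Hilbert–Schmidt norm. -/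
def hsNorm {j j' : ℕ} (X : Block j j') : ℝ := Real.sqrt (∑ k, ∑ k', ‖X k k'‖ ^ 2)

/-- `‖R‖_{B^{σ,m}} = sup_{j'} ∑_j e^{σ|j-j'|} ‖Π_j R Π_{j'}‖_HS ⟨j'⟩^{-m}`. -/
def bNorm (σ m : ℝ) (R : Op) : ℝ≥0∞ :=
  ⨆ j' : ℕ, ∑' j : ℕ, ENNReal.ofReal
    (Real.exp (σ * |(j : ℝ) - (j' : ℝ)|) * hsNorm (blockOf R j j') * jap j' ^ (-m))

/-! ### Analytic families on the infinite dimensional torus -/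

/-- A family `φ ↦ R(φ)`, given by its Fourier coefficients `R̂(ℓ)`. -/
abbrev TimeOp : Type := Idx → Op

/-- The decay norm `|R|_{σ,m} = ∑_ℓ e^{σ|ℓ|_η} ‖R̂(ℓ)‖_{B^{σ,m}}`. -/
def decayNorm (η σ m : ℝ) (R : TimeOp) : ℝ≥0∞ :=
  ∑' l : Idx, ENNReal.ofReal (Real.exp (σ * l.wt η)) * bNorm σ m (R l)

/-- `R ∈ H(𝕋^∞_σ, B^{σ,m})`. -/
def MemH (η σ m : ℝ) (R : TimeOp) : Prop := decayNorm η σ m R < ∞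

/-- The thickened torus `𝕋^∞_σ` (angles are taken in the universal cover). -/
def thickTorus (η σ : ℝ) : Set (ℕ+ → ℂ) :=
  {φ | ∀ j : ℕ+, |(φ j).im| ≤ σ * ((j : ℕ) : ℝ) ^ η}

/-- `e^{i ℓ · φ}`. -/
def expDot (l : Idx) (φ : ℕ+ → ℂ) : ℂ :=
  Complex.exp (Complex.I * l.sum fun j z => (z : ℂ) * φ j)

/-- `R(φ) = ∑_ℓ R̂(ℓ) e^{iℓ·φ}`. -/
def evalAt (R : TimeOp) (φ : ℕ+ → ℂ) : Op := ∑' l : Idx, expDot l φ • R l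

/-- `ω · ∂_φ R`, the family with coefficients `i (ω·ℓ) R̂(ℓ)`. -/
def omegaDeriv (ω : Freq) (R : TimeOp) : TimeOp :=
  fun l => (Complex.I * (freqDot ω l : ℂ)) • R l

/-- `R(φ)` is skew self-adjoint for every real angle. -/
def SkewAdj (R : TimeOp) : Prop :=
  ∀ φ : ℕ+ → ℝ, ContinuousLinearMap.adjoint (evalAt R fun j => (φ j : ℂ)) =
    -evalAt R fun j => (φ j : ℂ)

/-! ### Dependence on the parameter -/

/-- `sup_{ω ∈ Ω} f(ω)`. -/
def supOn (Ω : Set Freq) (f : Freq → ℝ≥0∞) : ℝ≥0∞ := ⨆ ω ∈ Ω, f ω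

/-- `sup_{ω₁ ≠ ω₂ ∈ Ω} g(ω₁, ω₂) / ‖ω₁ - ω₂‖_∞`, where `g(ω₁, ω₂)` is the size of the increment. -/
def lipOn (Ω : Set Freq) (g : Freq → Freq → ℝ≥0∞) : ℝ≥0∞ :=
  ⨆ ω₁ ∈ Ω, ⨆ ω₂ ∈ Ω, ⨆ _ : ω₁ ≠ ω₂, g ω₁ ω₂ / ENNReal.ofReal ‖ω₁ - ω₂‖

/-- `|f|^{Lip(γ,Ω)}` for a real function. -/
def realLip (γ : ℝ) (Ω : Set Freq) (f : Freq → ℝ) : ℝ≥0∞ :=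
  supOn Ω (fun ω => ENNReal.ofReal |f ω|) +
    ENNReal.ofReal γ * lipOn Ω fun ω₁ ω₂ => ENNReal.ofReal |f ω₁ - f ω₂|

/-- The Lipschitz seminorm of a block-valued function, in the Hilbert–Schmidt norm. -/
def blockLipSemi (Ω : Set Freq) {j j' : ℕ} (X : Freq → Block j j') : ℝ≥0∞ :=
  lipOn Ω fun ω₁ ω₂ => ENNReal.ofReal (hsNorm (X ω₁ - X ω₂))

/-- `‖X‖_HS^{Lip(γ,Ω)}` for a block-valued function. -/
def blockLip (γ : ℝ) (Ω : Set Freq) {j j' : ℕ} (X : Freq → Block j j') : ℝ≥0∞ :=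
  supOn Ω (fun ω => ENNReal.ofReal (hsNorm (X ω))) + ENNReal.ofReal γ * blockLipSemi Ω X

/-- `|R|_{σ,m}^{Lip(γ,Ω)}`; the increments are measured with the order `m + 2`. -/
def opLip (η γ : ℝ) (Ω : Set Freq) (σ m : ℝ) (R : Freq → TimeOp) : ℝ≥0∞ :=
  supOn Ω (fun ω => decayNorm η σ m (R ω)) +
    ENNReal.ofReal γ * lipOn Ω fun ω₁ ω₂ => decayNorm η σ (m + 2) (R ω₁ - R ω₂)

/-! ### Block diagonal operators and the vector fields -/

/-- A block diagonal operator `diag_j D(j)`, `D(j) ∈ B(E_j)`. -/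
abbrev Blocks : Type := ∀ j : ℕ, Block j j

/-- The graph of `diag_j D(j)` on its maximal domain in `L²(𝕋)`. -/
def blockDiagGraph (D : Blocks) : Submodule ℂ (L2 × L2) where
  carrier := {p | ∀ (j : ℕ) (k : blockIdx j), coef p.2 k = ∑ k', D j k k' * coef p.1 k'}
  add_mem' := by
    intro a b ha hb j k
    have h1 := ha j k
    have h2 := hb j k
    simp only [coef, Prod.snd_add, Prod.fst_add, map_add, lp.coeFn_add, Pi.add_apply, mul_add,
      Finset.sum_add_distrib] at h1 h2 ⊢
    rw [h1, h2]
  zero_mem' := by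
    intro j k
    simp [coef]
  smul_mem' := by
    intro c a ha j k
    have h1 := ha j k
    simp only [coef, Prod.smul_snd, Prod.smul_fst, map_smul, lp.coeFn_smul, Pi.smul_apply,
      smul_eq_mul] at h1 ⊢
    rw [h1, Finset.mul_sum]
    exact Finset.sum_congr rfl fun _ _ => by ring

theorem blockDiagGraph_functional (D : Blocks) :
    ∀ p ∈ blockDiagGraph D, p.1 = 0 → p.2 = 0 := by
  intro p hp h0
  have h : fourierBasis.repr p.2 = 0 := by
    ext k
    have hk : k ∈ blockIdx k.natAbs := by
      simp only [blockIdx, Finset.mem_insert, Finset.mem_singleton]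
      omega
    have := hp k.natAbs ⟨k, hk⟩
    simpa [coef, h0] using this
  simpa using h

/-- The (unbounded) operator `diag_j D(j)` with its maximal domain. -/
def blockDiagOp (D : Blocks) : L2 →ₗ.[ℂ] L2 := (blockDiagGraph D).toLinearPMap

theorem graph_blockDiagOp (D : Blocks) : (blockDiagOp D).graph = blockDiagGraph D :=
  Submodule.toLinearPMap_graph_eq _ fun p hp h => blockDiagGraph_functional D p hp h

/-- The vector field `i D + P`, with the domain of `D`. -/
def vectorField (D : Blocks) (P : Op) : L2 →ₗ.[ℂ] L2 :=
  (P : L2 →ₗ[ℂ] L2) +ᵥ (Complex.I • blockDiagOp D)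

/-- `Φ⁻¹ L Φ - Φ⁻¹ (dΦ)`, on the domain `{u | Φ u ∈ dom L}`. -/
def conjOp (Φ dΦ : Op) (L : L2 →ₗ.[ℂ] L2) : L2 →ₗ.[ℂ] L2 where
  domain := L.domain.comap (Φ : L2 →ₗ[ℂ] L2)
  toFun :=
    { toFun := fun u => Ring.inverse Φ (L ⟨Φ u.1, u.2⟩) - Ring.inverse Φ (dΦ u.1)
      map_add' := by
        intro u v
        have h : L ⟨Φ (u + v).1, (u + v).2⟩ = L ⟨Φ u.1, u.2⟩ + L ⟨Φ v.1, v.2⟩ := by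
          rw [← LinearPMap.map_add]
          congr 1
          ext1
          simp
        rw [h]
        simp only [Submodule.coe_add, map_add]
        abel
      map_smul' := by
        intro c u
        have h : L ⟨Φ (c • u).1, (c • u).2⟩ = c • L ⟨Φ u.1, u.2⟩ := by
          rw [← LinearPMap.map_smul]
          congr 1
          ext1
          simp
        rw [h]
        simp only [Submodule.coe_smul, map_smul, RingHom.id_apply, smul_sub] }

/-- The push-forward `(Φ_{ω*} L)(φ) = Φ(φ)⁻¹ L(φ) Φ(φ) - Φ(φ)⁻¹ (ω·∂_φ Φ)(φ)`. -/
def pushForward (ω : Freq) (Φ : TimeOp) (L : (ℕ+ → ℂ) → (L2 →ₗ.[ℂ] L2)) (φ : ℕ+ → ℂ) :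
    L2 →ₗ.[ℂ] L2 :=
  conjOp (evalAt Φ φ) (evalAt (omegaDeriv ω Φ) φ) (L φ)

/-- The blocks of `D₀ = λ₂ ∂_xx + (1/i) λ₁ ∂_x + λ₀ + (1/i) λ₋₁ ∂_x⁻¹`: diagonal, with entries
`-λ₂ k² + λ₁ k + λ₀ - λ₋₁ k⁻¹`, the last term being absent for `k = 0`. -/
def initialBlocks (l2 l1 l0 lm1 : ℝ) : Blocks := fun _ =>
  Matrix.diagonal fun k => ((-l2 * (k : ℤ) ^ 2 + l1 * (k : ℤ) + l0 - lm1 * ((k : ℤ) : ℝ)⁻¹ : ℝ) : ℂ)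

/-! ### The iteration parameters and the Melnikov sets -/

/-- `σ_n = σ₀ (1 - (1/4π) ∑_{j=1}^n 1/j²)`. -/
def sigmaSeq (σ₀ : ℝ) (n : ℕ) : ℝ :=
  σ₀ * (1 - 1 / (4 * Real.pi) * ∑ j ∈ Finset.Icc 1 n, 1 / (j : ℝ) ^ 2)

/-- `N_n = ⟨n⟩³ χⁿ N₀`. -/
def cutoff (χ N₀ : ℝ) (n : ℕ) : ℝ := jap n ^ 3 * χ ^ n * N₀

/-- `O(ℓ, j, j') = (ω·ℓ) Id + M_L(D(j)) - M_R(D(j'))` on `B(E_{j'}, E_j)`. -/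
def melnikovOp (ω : Freq) (D : Blocks) (l : Idx) (j j' : ℕ) : Block j j' →ₗ[ℂ] Block j j' where
  toFun X := (freqDot ω l : ℂ) • X + D j * X - X * D j'
  map_add' X Y := by
    simp only [smul_add, Matrix.mul_add, Matrix.add_mul]
    abel
  map_smul' c X := by
    simp only [Matrix.mul_smul, Matrix.smul_mul, RingHom.id_apply, smul_sub, smul_add,
      smul_comm c]

/-- `T` is invertible and `‖T⁻¹‖_Op ≤ c`, the operator norm being induced by the Hilbert–Schmidt
norm. -/
def InvNormLE {j j' : ℕ} (T : Block j j' →ₗ[ℂ] Block j j') (c : ℝ) : Prop :=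
  ∃ S : Block j j' →ₗ[ℂ] Block j j', S ∘ₗ T = LinearMap.id ∧ T ∘ₗ S = LinearMap.id ∧
    ∀ X, hsNorm (S X) ≤ c * hsNorm X

/-- The sets `Ω_n(γ)` attached to a sequence of block diagonal operators `D_n(ω)`. -/
def melnikovSet (η χ N₀ γ : ℝ) (D : ℕ → Freq → Blocks) : ℕ → Set Freq
  | 0 => diophSet γ
  | n + 1 => {ω | ω ∈ melnikovSet η χ N₀ γ D n ∧
      (∀ (l : Idx) (j j' : ℕ), l.wt η ≤ cutoff χ N₀ n → j ≠ j' →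
        InvNormLE (melnikovOp ω (D n ω) l j j') (smallDiv l / γ)) ∧
      (∀ (l : Idx) (j : ℕ), l.wt η ≤ cutoff χ N₀ n → l ≠ 0 →
        InvNormLE (melnikovOp ω (D n ω) l j j) (smallDiv l * jap j ^ 2 / γ))}

end AlmostPeriodicKAM

end

open AlmostPeriodicKAM

/-! The proof is a KAM iteration with Fourier cut-off. Let `i D + P` be the current vector field,
with `P` of size `p`. One looks for `Φ = exp F`, where `F` solves the truncated homological equation
`[i D, F] - ω·∂F = G`, with `G = resonant P - truncate P`. Put `ad X = X F - F X`. Then `Φ⁻¹ X Φ = ∑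
ad^k X / k!` (`exp_mul_tsum_ad`), and the derivative of `exp` at `F` in the direction `Y` is `Φ ∑
ad^k Y / (k+1)!` (`hasSum_powDeriv`). Since `[i D, F] = ω·∂F + G`, the terms with `ω·∂F` cancel and
the push-forward is `i D + ∑ ad^k P / k! + ∑ ad^k G / (k+1)!`. Its part without commutators is `P +
G`: the resonant block diagonal joins `i D`, and what is left is the Fourier tail of `P` together
with commutators that are quadratic in `P`.

Solving for `F` inverts the Melnikov operators, at the price `d(ℓ) ⟨j'⟩² / γ`. The factor `⟨j'⟩²` is
paid by the order `-2` of `P`, so `F` has order `0` and the new perturbation again has order `-2`.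
The factor `d(ℓ)` is paid by analyticity: by `exists_divisor_bound`, the widths given up at step `n`
cost less than a constant times `e^{κ χ^n}`, for any prescribed `κ > 0`. With `p_n = K e ε e^{-χ^n}`
and `1 < χ < 2`, the recursion `(e^{-4 ρ_n N_n} + c_n p_n / γ) p_n ≤ p_{n+1}` then closes for `N₀`
large and `ε / γ` small.

For the dependence on `ω`, two solutions are compared by a resolvent identity. This inverts twice
and loses two more orders: increments of `F` have order `2` and increments of `P` order `0`. The
losses do not accumulate, because an increment of `F` is only ever multiplied by operators of order
`-2`. The comparison needs `‖D_n(ω₁) - D_n(ω₂)‖ ≤ ‖ω₁ - ω₂‖`, which holds because the unbounded part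
of `D₀` does not depend on `ω` and the corrections sum to at most `γ / 2`.

As `D` is unbounded, commutators with it are stated on graphs (`HasComm`), and the conjugation,
domains included, is `vectorField_eq_conjOp`. One step is estimated in
`StepParams.decayNorm_stepP_le` and `StepParams.decayNorm_stepP_sub_le`; `KamData.invariant` runs
the induction, and `KamData.exists_extensions` extends the corrections of the blocks to all
Diophantine frequencies. -/

noncomputable section
namespace AlmostPeriodicKAM

/-! ### The Hilbert–Schmidt norm of blocks -/

section Frobenius

attribute [local instance] Matrix.frobeniusNormedAddCommGroup Matrix.frobeniusNormedSpace

variable {i j j' : ℕ}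

lemma hsNorm_eq_frobenius (X : Block j j') : hsNorm X = ‖X‖ := by
  rw [Matrix.frobenius_norm_def, hsNorm, Real.sqrt_eq_rpow]
  simp

lemma hsNorm_nonneg (X : Block j j') : 0 ≤ hsNorm X := Real.sqrt_nonneg _

lemma hsNorm_zero : hsNorm (0 : Block j j') = 0 := by
  rw [hsNorm_eq_frobenius, norm_zero]

lemma hsNorm_add_le (X Y : Block j j') : hsNorm (X + Y) ≤ hsNorm X + hsNorm Y := by
  simp only [hsNorm_eq_frobenius]; exact norm_add_le X Y

lemma hsNorm_sub_le (X Y : Block j j') : hsNorm (X - Y) ≤ hsNorm X + hsNorm Y := by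
  simp only [hsNorm_eq_frobenius]; exact norm_sub_le X Y

lemma hsNorm_neg (X : Block j j') : hsNorm (-X) = hsNorm X := by
  simp only [hsNorm_eq_frobenius]; exact norm_neg X

lemma hsNorm_smul (c : ℂ) (X : Block j j') : hsNorm (c • X) = ‖c‖ * hsNorm X := by
  simp only [hsNorm_eq_frobenius]; exact norm_smul c X

lemma hsNorm_mul_le (X : Block j i) (Y : Block i j') : hsNorm (X * Y) ≤ hsNorm X * hsNorm Y := by
  simp only [hsNorm_eq_frobenius]; exact Matrix.frobenius_norm_mul X Y

lemma hsNorm_conjTranspose (X : Block j j') : hsNorm X.conjTranspose = hsNorm X := by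
  rw [hsNorm_eq_frobenius, hsNorm_eq_frobenius]; exact Matrix.frobenius_norm_conjTranspose X

lemma hsNorm_sum_le {ι : Type*} (s : Finset ι) (X : ι → Block j j') :
    hsNorm (∑ a ∈ s, X a) ≤ ∑ a ∈ s, hsNorm (X a) := by
  simp only [hsNorm_eq_frobenius]; exact norm_sum_le s X

end Frobenius

variable {i j j' : ℕ}

lemma norm_entry_le_hsNorm (X : Block j j') (k : blockIdx j) (k' : blockIdx j') :
    ‖X k k'‖ ≤ hsNorm X := by
  refine Real.le_sqrt_of_sq_le ?_
  refine le_trans ?_ (Finset.single_le_sum (f := fun k => ∑ k', ‖X k k'‖ ^ 2)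
    (fun a _ => Finset.sum_nonneg fun b _ => by positivity) (Finset.mem_univ k))
  exact Finset.single_le_sum (f := fun k' => ‖X k k'‖ ^ 2) (fun a _ => by positivity)
    (Finset.mem_univ k')

lemma card_blockIdx_le (j : ℕ) : Fintype.card (blockIdx j) ≤ 2 := by
  rw [Fintype.card_coe]; exact Finset.card_le_two

lemma hsNorm_le_of_entry_le (X : Block j j') {a : ℝ} (ha : 0 ≤ a) (h : ∀ k k', ‖X k k'‖ ≤ a) :
    hsNorm X ≤ 2 * a := by
  refine Real.sqrt_le_iff.2 ⟨by positivity, ?_⟩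
  have h1 : ∀ k, ∑ k', ‖X k k'‖ ^ 2 ≤ 2 * a ^ 2 := fun k => by
    refine (Finset.sum_le_card_nsmul _ _ (a ^ 2) fun k' _ =>
      pow_le_pow_left₀ (norm_nonneg _) (h k k') 2).trans ?_
    rw [nsmul_eq_mul]
    gcongr
    exact_mod_cast card_blockIdx_le j'
  refine (Finset.sum_le_card_nsmul _ _ (2 * a ^ 2) fun k _ => h1 k).trans ?_
  rw [nsmul_eq_mul]
  have : (Fintype.card (blockIdx j) : ℝ) ≤ 2 := by exact_mod_cast card_blockIdx_le j
  rw [Finset.card_univ]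
  nlinarith [sq_nonneg a]

lemma continuous_hsNorm : Continuous (hsNorm : Block j j' → ℝ) := by
  unfold hsNorm
  fun_prop

/-- The triangle inequality for partial sums passes to the limit by continuity. In `ℝ≥0∞` the sum of
the norms needs no convergence. -/
lemma ofReal_hsNorm_le_tsum {ι : Type*} {f : ι → Block j j'} {X : Block j j'} (h : HasSum f X) :
    ENNReal.ofReal (hsNorm X) ≤ ∑' a, ENNReal.ofReal (hsNorm (f a)) := by
  have h1 : Filter.Tendsto (fun s : Finset ι => ENNReal.ofReal (hsNorm (∑ a ∈ s, f a))) Filter.atTop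
      (nhds (ENNReal.ofReal (hsNorm X))) :=
    (ENNReal.continuous_ofReal.comp continuous_hsNorm).continuousAt.tendsto.comp h
  refine le_of_tendsto h1 (Filter.Eventually.of_forall fun s => ?_)
  refine (ENNReal.ofReal_le_ofReal (hsNorm_sum_le s f)).trans ?_
  rw [ENNReal.ofReal_sum_of_nonneg fun a _ => hsNorm_nonneg _]
  exact ENNReal.sum_le_tsum s

/-! ### Fourier coefficients and matrix elements -/

/-- The `k`-th Fourier coefficient as a continuous linear functional. -/
def coefL (k : ℤ) : L2 →L[ℂ] ℂ := innerSL ℂ (fourierBasis k)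

lemma coefL_apply (k : ℤ) (u : L2) : coefL k u = coef u k := by
  rw [coef, HilbertBasis.repr_apply_apply]; rfl

lemma coef_add (u v : L2) (k : ℤ) : coef (u + v) k = coef u k + coef v k := by
  simp only [← coefL_apply, map_add]

lemma coef_sub (u v : L2) (k : ℤ) : coef (u - v) k = coef u k - coef v k := by
  simp only [← coefL_apply, map_sub]

lemma coef_smul (c : ℂ) (u : L2) (k : ℤ) : coef (c • u) k = c * coef u k := by
  simp only [← coefL_apply, map_smul, smul_eq_mul]

lemma coef_ext {u v : L2} (h : ∀ k, coef u k = coef v k) : u = v :=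
  fourierBasis.repr.injective (by ext k; exact h k)

lemma coef_fourierLp (k k' : ℤ) : coef (fourierLp 2 k' : L2) k = if k = k' then 1 else 0 := by
  rw [coef, ← coe_fourierBasis, HilbertBasis.repr_self, lp.single_apply, Pi.single_apply]

lemma hasSum_coef (u : L2) : HasSum (fun k => coef u k • (fourierLp 2 k : L2)) u := by
  have := HilbertBasis.hasSum_repr fourierBasis u
  rwa [coe_fourierBasis] at this

lemma hasSum_coef_apply (R : Op) (u : L2) (k : ℤ) :
    HasSum (fun κ => matElt R k κ * coef u κ) (coef (R u) k) := by
  have h := ((coefL k).comp R).hasSum (hasSum_coef u)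
  simp only [ContinuousLinearMap.comp_apply, coefL_apply] at h
  convert h using 2 with κ
  rw [map_smul, coef_smul, mul_comm, matElt]

lemma mem_blockIdx {k : ℤ} {j : ℕ} : k ∈ blockIdx j ↔ k.natAbs = j := by
  simp only [blockIdx, Finset.mem_insert, Finset.mem_singleton]
  omega

/-- The integers, sorted into blocks. -/
def blockEquiv : (Σ j : ℕ, blockIdx j) ≃ ℤ where
  toFun x := x.2
  invFun k := ⟨k.natAbs, k, mem_blockIdx.2 rfl⟩
  left_inv := by
    rintro ⟨j, k, hk⟩
    obtain rfl := mem_blockIdx.1 hk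
    rfl
  right_inv k := rfl

lemma HasSum.blocks {E : Type*} [NormedAddCommGroup E] {f : ℤ → E} {a : E} (h : HasSum f a) :
    HasSum (fun j : ℕ => ∑ k : blockIdx j, f k) a := by
  have h1 : HasSum (f ∘ blockEquiv) a := (Equiv.hasSum_iff blockEquiv).2 h
  exact h1.sigma fun j => hasSum_fintype _

lemma hasSum_block_apply (R : Op) (u : L2) (k : blockIdx j) :
    HasSum (fun i : ℕ => ∑ κ : blockIdx i, blockOf R j i k κ * coef u κ) (coef (R u) k) := by
  have h := HasSum.blocks (hasSum_coef_apply R u k)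
  simpa only [blockOf] using h

lemma hasSum_blockOf_mul (R S : Op) (j j' : ℕ) :
    HasSum (fun i : ℕ => blockOf R j i * blockOf S i j') (blockOf (R * S) j j') := by
  refine Pi.hasSum.2 fun k => Pi.hasSum.2 fun k' => ?_
  exact hasSum_block_apply R (S (fourierLp 2 (k' : ℤ))) k

lemma matElt_ext {R S : Op} (h : ∀ k k', matElt R k k' = matElt S k k') : R = S := by
  ext1 u
  refine coef_ext fun k => (hasSum_coef_apply R u k).unique ?_
  simp only [h]
  exact hasSum_coef_apply S u k

lemma blockOf_ext {R S : Op} (h : ∀ j j', blockOf R j j' = blockOf S j j') : R = S :=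
  matElt_ext fun k k' => congrFun (congrFun (h k.natAbs k'.natAbs) ⟨k, mem_blockIdx.2 rfl⟩)
    ⟨k', mem_blockIdx.2 rfl⟩

/-- `R ↦ Π_j R Π_{j'}` as a linear map. -/
def blockOfL (j j' : ℕ) : Op →ₗ[ℂ] Block j j' where
  toFun R := blockOf R j j'
  map_add' R S := by
    ext k k'
    simp [blockOf, matElt, coef_add]
  map_smul' c R := by
    ext k k'
    simp [blockOf, matElt, coef_smul]

lemma blockOf_add (R S : Op) : blockOf (R + S) j j' = blockOf R j j' + blockOf S j j' :=
  (blockOfL j j').map_add R S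

lemma blockOf_sub (R S : Op) : blockOf (R - S) j j' = blockOf R j j' - blockOf S j j' :=
  (blockOfL j j').map_sub R S

lemma blockOf_neg (R : Op) : blockOf (-R) j j' = -blockOf R j j' := (blockOfL j j').map_neg R

lemma blockOf_zero : blockOf (0 : Op) j j' = 0 := (blockOfL j j').map_zero

lemma blockOf_smul (c : ℂ) (R : Op) : blockOf (c • R) j j' = c • blockOf R j j' :=
  (blockOfL j j').map_smul c R

lemma continuous_blockOf : Continuous fun R : Op => blockOf R j j' := by
  refine continuous_pi fun k => continuous_pi fun k' => ?_
  simp only [blockOf, matElt, ← coefL_apply]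
  fun_prop

lemma hasSum_blockOf {ι : Type*} {R : ι → Op} {S : Op} (h : HasSum R S) :
    HasSum (fun a => blockOf (R a) j j') (blockOf S j j') :=
  h.map (blockOfL j j') continuous_blockOf

lemma matElt_adjoint (R : Op) (k k' : ℤ) :
    matElt (ContinuousLinearMap.adjoint R) k k' = star (matElt R k' k) := by
  simp only [matElt, ← coefL_apply, coefL, innerSL_apply_apply, coe_fourierBasis]
  rw [ContinuousLinearMap.adjoint_inner_right, ← inner_conj_symm]
  rfl

lemma blockOf_adjoint (R : Op) :
    blockOf (ContinuousLinearMap.adjoint R) j j' = (blockOf R j' j).conjTranspose := by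
  ext k k'
  exact matElt_adjoint R k k'

lemma blockOf_one_of_ne (h : j ≠ j') : blockOf (1 : Op) j j' = 0 := by
  ext k k'
  have h1 : (k : ℤ) ≠ k' := fun h2 => h (by
    rw [← mem_blockIdx.1 k.2, ← mem_blockIdx.1 k'.2, h2])
  simp [blockOf, matElt, coef_fourierLp, h1]

lemma hsNorm_blockOf_one_le (j j' : ℕ) : hsNorm (blockOf (1 : Op) j j') ≤ 2 := by
  refine (hsNorm_le_of_entry_le _ zero_le_one fun k k' => ?_).trans (by norm_num)
  simp only [blockOf, matElt, one_apply_eq_self, coef_fourierLp]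
  split_ifs <;> simp


/-! ### A Schur test -/

lemma ENNReal.two_mul_mul_le_sq_add_sq (a b : ℝ≥0∞) : 2 * (a * b) ≤ a ^ 2 + b ^ 2 := by
  have key : ∀ x y : ℝ≥0∞, x ≤ y → 2 * (x * y) ≤ x ^ 2 + y ^ 2 := by
    intro x y h
    obtain ⟨d, rfl⟩ := exists_add_of_le h
    calc 2 * (x * (x + d)) ≤ 2 * (x * (x + d)) + d ^ 2 := le_self_add
      _ = x ^ 2 + (x + d) ^ 2 := by ring
  rcases le_total a b with h | h
  · exact key a b h
  · rw [mul_comm a b, add_comm]; exact key b a h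

/-- Cauchy–Schwarz with weight `A`. Expanding the square as a double sum and using `2 u_x u_y ≤ u_x²
+ u_y²` avoids square roots; the factor `2` is cancelled at the end. -/
lemma ENNReal.tsum_mul_sq_le {ι : Type*} (A u : ι → ℝ≥0∞) :
    (∑' x, A x * u x) ^ 2 ≤ (∑' x, A x) * ∑' x, A x * u x ^ 2 := by
  have h2 : (2 : ℝ≥0∞) * (∑' x, A x * u x) ^ 2 ≤ 2 * ((∑' x, A x) * ∑' x, A x * u x ^ 2) := by
    calc (2 : ℝ≥0∞) * (∑' x, A x * u x) ^ 2
        = ∑' x, ∑' y, A x * A y * (2 * (u x * u y)) := by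
          rw [sq, ← ENNReal.tsum_mul_right, ← ENNReal.tsum_mul_left]
          refine tsum_congr fun x => ?_
          rw [← ENNReal.tsum_mul_left, ← ENNReal.tsum_mul_left]
          exact tsum_congr fun y => by ring
      _ ≤ ∑' x, ∑' y, (A y * (A x * u x ^ 2) + A x * (A y * u y ^ 2)) := by
          refine ENNReal.tsum_le_tsum fun x => ENNReal.tsum_le_tsum fun y => ?_
          calc A x * A y * (2 * (u x * u y)) ≤ A x * A y * (u x ^ 2 + u y ^ 2) := by
                gcongr; exact ENNReal.two_mul_mul_le_sq_add_sq _ _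
            _ = _ := by ring
      _ = 2 * ((∑' x, A x) * ∑' x, A x * u x ^ 2) := by
          simp only [ENNReal.tsum_add, ENNReal.tsum_mul_left, ENNReal.tsum_mul_right]
          ring
  exact (ENNReal.mul_le_mul_iff_right (by simp) (by simp)).1 h2

lemma lp_enorm_sq (f : lp (fun _ : ℤ => ℂ) 2) : ‖f‖ₑ ^ 2 = ∑' k, ‖f k‖ₑ ^ 2 := by
  have h := lp.hasSum_norm (p := 2) (by simp) f
  simp only [ENNReal.toReal_ofNat, Real.rpow_ofNat] at h
  have h1 := ENNReal.ofReal_tsum_of_nonneg (fun k => by positivity) h.summable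
  rw [h.tsum_eq] at h1
  simp only [ENNReal.ofReal_pow (norm_nonneg _), ofReal_norm] at h1
  exact h1

/-- Matrices with summable rows and columns act on `ℓ²`. -/
lemma exists_lp_of_schur (a : ℤ → ℤ → ℂ) {C : ℝ≥0∞} (hC : C ≠ ∞)
    (hrow : ∀ k, ∑' k', ‖a k k'‖ₑ ≤ C) (hcol : ∀ k', ∑' k, ‖a k k'‖ₑ ≤ C) :
    ∃ T : lp (fun _ : ℤ => ℂ) 2 →L[ℂ] lp (fun _ : ℤ => ℂ) 2,
      (∀ u k, T u k = ∑' k', a k k' * u k') ∧ ‖T‖ₑ ≤ C := by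
  -- The row bound enters through the weighted Cauchy–Schwarz inequality, the column bound after the
  -- two sums are exchanged.
  have hsq : ∀ u : lp (fun _ : ℤ => ℂ) 2,
      ∑' k, (∑' k', ‖a k k'‖ₑ * ‖u k'‖ₑ) ^ 2 ≤ (C * ‖u‖ₑ) ^ 2 := by
    intro u
    calc ∑' k, (∑' k', ‖a k k'‖ₑ * ‖u k'‖ₑ) ^ 2
        ≤ ∑' k, C * ∑' k', ‖a k k'‖ₑ * ‖u k'‖ₑ ^ 2 := by
          refine ENNReal.tsum_le_tsum fun k => (ENNReal.tsum_mul_sq_le _ _).trans ?_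
          gcongr; exact hrow k
      _ = C * ∑' k', (∑' k, ‖a k k'‖ₑ) * ‖u k'‖ₑ ^ 2 := by
          rw [ENNReal.tsum_mul_left, ENNReal.tsum_comm]
          simp only [ENNReal.tsum_mul_right]
      _ ≤ C * ∑' k', C * ‖u k'‖ₑ ^ 2 := by
          gcongr with k'; exact hcol k'
      _ = (C * ‖u‖ₑ) ^ 2 := by
          rw [ENNReal.tsum_mul_left, ← lp_enorm_sq]; ring
  have hlt : ∀ u : lp (fun _ : ℤ => ℂ) 2, (C * ‖u‖ₑ) ^ 2 < ∞ := fun u =>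
    ENNReal.pow_lt_top (ENNReal.mul_lt_top hC.lt_top enorm_lt_top)
  have hsum : ∀ (u : lp (fun _ : ℤ => ℂ) 2) k, Summable fun k' => a k k' * u k' := by
    intro u k
    have h1 : (∑' k', ‖a k k'‖ₑ * ‖u k'‖ₑ) ^ 2 < ∞ :=
      ((ENNReal.le_tsum k).trans (hsq u)).trans_lt (hlt u)
    have h2 : ∑' k', ‖a k k' * u k'‖ₑ ≠ ∞ := by
      simp only [enorm_mul]
      intro h3
      rw [h3] at h1
      simp at h1
    exact Summable.of_enorm h2
  have hle : ∀ (u : lp (fun _ : ℤ => ℂ) 2),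
      ∑' k, ‖∑' k', a k k' * u k'‖ₑ ^ 2 ≤ (C * ‖u‖ₑ) ^ 2 := by
    intro u
    refine le_trans (ENNReal.tsum_le_tsum fun k => ?_) (hsq u)
    gcongr
    refine (enorm_tsum_le_tsum_enorm).trans_eq ?_
    simp only [enorm_mul]
  have hmem : ∀ u : lp (fun _ : ℤ => ℂ) 2, Memℓp (fun k => ∑' k', a k k' * u k') 2 := by
    intro u
    refine memℓp_gen ?_
    simp only [ENNReal.toReal_ofNat, Real.rpow_ofNat]
    have h1 := ((hle u).trans_lt (hlt u)).ne
    have h2 := ENNReal.summable_toReal h1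
    simpa using h2
  let T : lp (fun _ : ℤ => ℂ) 2 →ₗ[ℂ] lp (fun _ : ℤ => ℂ) 2 :=
    { toFun := fun u => ⟨_, hmem u⟩
      map_add' := by
        intro u v
        ext k
        simp only [lp.coeFn_add, Pi.add_apply, mul_add]
        exact (hsum u k).tsum_add (hsum v k)
      map_smul' := by
        intro c u
        ext k
        simp only [lp.coeFn_smul, Pi.smul_apply, smul_eq_mul, RingHom.id_apply]
        rw [← tsum_mul_left]
        exact tsum_congr fun k' => by ring }
  have hT : ∀ u, ‖T u‖ ≤ C.toReal * ‖u‖ := by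
    intro u
    have h1 : ‖T u‖ₑ ^ 2 ≤ (C * ‖u‖ₑ) ^ 2 := by
      rw [lp_enorm_sq]; exact hle u
    have h2 : ‖T u‖ₑ ≤ C * ‖u‖ₑ := (ENNReal.pow_le_pow_left_iff two_ne_zero).1 h1
    have h3 := ENNReal.toReal_mono (ENNReal.mul_ne_top hC enorm_ne_top) h2
    simpa [ENNReal.toReal_mul] using h3
  refine ⟨T.mkContinuous C.toReal hT, fun u k => rfl, ?_⟩
  have h := T.mkContinuous_norm_le ENNReal.toReal_nonneg hT
  rw [← ofReal_norm]
  exact (ENNReal.ofReal_le_ofReal h).trans_eq (ENNReal.ofReal_toReal hC)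

lemma exists_op_of_schur (a : ℤ → ℤ → ℂ) {C : ℝ≥0∞} (hC : C ≠ ∞)
    (hrow : ∀ k, ∑' k', ‖a k k'‖ₑ ≤ C) (hcol : ∀ k', ∑' k, ‖a k k'‖ₑ ≤ C) :
    ∃ R : Op, (∀ k k', matElt R k k' = a k k') ∧ ‖R‖ₑ ≤ C := by
  obtain ⟨T, hT, hTC⟩ := exists_lp_of_schur a hC hrow hcol
  let b : L2 ≃ₗᵢ[ℂ] lp (fun _ : ℤ => ℂ) 2 := fourierBasis.repr
  let R : Op := (b.symm.toContinuousLinearEquiv : _ →L[ℂ] L2).comp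
    (T.comp (b.toContinuousLinearEquiv : L2 →L[ℂ] _))
  have hR : ∀ u, R u = b.symm (T (b u)) := fun u => rfl
  refine ⟨R, fun k k' => ?_, ?_⟩
  · have h1 : coef (R (fourierLp 2 k')) k = T (b (fourierLp 2 k')) k := by
      rw [coef, hR]
      change (b (b.symm _)) k = _
      rw [b.apply_symm_apply]
    rw [matElt, h1, hT, tsum_eq_single k']
    · have : (b (fourierLp 2 k')) k' = 1 := by
        have := coef_fourierLp k' k'
        rw [if_pos rfl] at this
        exact this
      rw [this, mul_one]
    · intro κ hκ
      have : (b (fourierLp 2 k')) κ = 0 := by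
        have := coef_fourierLp κ k'
        rw [if_neg hκ] at this
        exact this
      rw [this, mul_zero]
  · refine le_trans ?_ hTC
    rw [← ofReal_norm, ← ofReal_norm]
    refine ENNReal.ofReal_le_ofReal (ContinuousLinearMap.opNorm_le_bound _ (norm_nonneg _) ?_)
    intro u
    rw [hR, b.symm.norm_map]
    exact (T.le_opNorm _).trans_eq (by rw [b.norm_map])

/-- `2 ∑_k e^{-σ|k|}`, an upper bound for `∑_k e^{-σ ||k| - |k'||}`. -/
def schurConst (σ : ℝ) : ℝ≥0∞ := 2 * ∑' k : ℤ, ENNReal.ofReal (Real.exp (-σ * |(k : ℝ)|))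

lemma schurConst_ne_top {σ : ℝ} (hσ : 0 < σ) : schurConst σ ≠ ∞ := by
  refine ENNReal.mul_ne_top (by simp) ?_
  have h1 : Summable fun n : ℕ => Real.exp (-σ * n) := by
    have := Real.summable_exp_nat_mul_iff (a := -σ)
    simpa [mul_comm] using this.2 (by linarith)
  have h : Summable fun k : ℤ => Real.exp (-σ * |(k : ℝ)|) := by
    refine summable_int_iff_summable_nat_and_neg.2 ⟨?_, ?_⟩ <;> simpa using h1
  exact h.tsum_ofReal_ne_top

lemma schurConst_ne_zero (σ : ℝ) : schurConst σ ≠ 0 := by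
  refine mul_ne_zero (by simp) fun h => ?_
  have := ENNReal.tsum_eq_zero.1 h 0
  simp at this

/-- The number `||k| - |k'||` is either `|k - k'|` or `|k + k'|`, so each term is at most the sum of
two translated or reflected copies of `e^{-σ|·|}`. This is the factor `2` in `schurConst`. -/
lemma tsum_exp_abs_sub_abs_le (σ : ℝ) (k : ℤ) :
    ∑' k' : ℤ, ENNReal.ofReal (Real.exp (-σ * |((k.natAbs : ℝ)) - k'.natAbs|)) ≤ schurConst σ := by
  have h1 : ∑' k' : ℤ, ENNReal.ofReal (Real.exp (-σ * |((k + k' : ℤ) : ℝ)|)) =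
      ∑' k' : ℤ, ENNReal.ofReal (Real.exp (-σ * |(k' : ℝ)|)) :=
    (Equiv.addLeft k).tsum_eq fun k' : ℤ => ENNReal.ofReal (Real.exp (-σ * |(k' : ℝ)|))
  have h2 : ∑' k' : ℤ, ENNReal.ofReal (Real.exp (-σ * |((k - k' : ℤ) : ℝ)|)) =
      ∑' k' : ℤ, ENNReal.ofReal (Real.exp (-σ * |(k' : ℝ)|)) :=
    (Equiv.subLeft k).tsum_eq fun k' : ℤ => ENNReal.ofReal (Real.exp (-σ * |(k' : ℝ)|))
  rw [schurConst, two_mul]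
  nth_rewrite 1 [← h1]
  rw [← h2, ← ENNReal.tsum_add]
  refine ENNReal.tsum_le_tsum fun k' => ?_
  have e1 : (k.natAbs : ℝ) = |(k : ℝ)| := by rw [Nat.cast_natAbs, Int.cast_abs]
  have e2 : (k'.natAbs : ℝ) = |(k' : ℝ)| := by rw [Nat.cast_natAbs, Int.cast_abs]
  rw [e1, e2]
  push_cast
  rcases le_total 0 (k : ℝ) with hk | hk <;> rcases le_total 0 (k' : ℝ) with hk' | hk'
  · rw [abs_of_nonneg hk, abs_of_nonneg hk']; exact le_add_self
  · rw [abs_of_nonneg hk, abs_of_nonpos hk', sub_neg_eq_add]; exact le_self_add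
  · rw [abs_of_nonpos hk, abs_of_nonneg hk', ← abs_neg, neg_sub, sub_neg_eq_add, add_comm (k' : ℝ)]
    exact le_self_add
  · rw [abs_of_nonpos hk, abs_of_nonpos hk', ← abs_neg, neg_sub, sub_neg_eq_add, neg_add_eq_sub]
    exact le_add_self

/-- Off-diagonal exponential decay makes rows and columns summable, so the Schur test turns a
prescribed array of blocks into a bounded operator. Generators and diagonal parts are produced this
way. -/
lemma exists_op_of_blocks {σ B : ℝ} (hσ : 0 < σ) (M : ∀ j j', Block j j')
    (hM : ∀ j j' : ℕ, hsNorm (M j j') ≤ B * Real.exp (-σ * |(j : ℝ) - j'|)) :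
    ∃ R : Op, (∀ j j', blockOf R j j' = M j j') ∧ ‖R‖ₑ ≤ ENNReal.ofReal B * schurConst σ := by
  let a : ℤ → ℤ → ℂ := fun k k' =>
    M k.natAbs k'.natAbs ⟨k, mem_blockIdx.2 rfl⟩ ⟨k', mem_blockIdx.2 rfl⟩
  have hB : 0 ≤ B := by
    have := (hsNorm_nonneg _).trans (hM 0 0)
    simpa using this
  have ha : ∀ k k', ‖a k k'‖ₑ ≤ ENNReal.ofReal B *
      ENNReal.ofReal (Real.exp (-σ * |(k.natAbs : ℝ) - k'.natAbs|)) := fun k k' => by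
    rw [← ofReal_norm, ← ENNReal.ofReal_mul hB]
    exact ENNReal.ofReal_le_ofReal ((norm_entry_le_hsNorm _ _ _).trans (hM _ _))
  have hrow : ∀ k, ∑' k', ‖a k k'‖ₑ ≤ ENNReal.ofReal B * schurConst σ := fun k => by
    refine (ENNReal.tsum_le_tsum fun k' => ha k k').trans ?_
    rw [ENNReal.tsum_mul_left]
    gcongr
    exact tsum_exp_abs_sub_abs_le σ k
  have hcol : ∀ k', ∑' k, ‖a k k'‖ₑ ≤ ENNReal.ofReal B * schurConst σ := fun k' => by
    refine (ENNReal.tsum_le_tsum fun k => ha k k').trans ?_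
    rw [ENNReal.tsum_mul_left]
    gcongr
    simp only [abs_sub_comm _ (k'.natAbs : ℝ)]
    exact tsum_exp_abs_sub_abs_le σ k'
  obtain ⟨R, hR, hR'⟩ := exists_op_of_schur a
    (ENNReal.mul_ne_top (by simp) (schurConst_ne_top hσ)) hrow hcol
  refine ⟨R, fun j j' => ?_, hR'⟩
  ext ⟨k, hk⟩ ⟨k', hk'⟩
  obtain rfl := mem_blockIdx.1 hk
  obtain rfl := mem_blockIdx.1 hk'
  exact hR k k'

/-! ### The norms `‖·‖_{B^{σ,m}}` -/

lemma one_le_jap (j : ℕ) : 1 ≤ jap j := le_max_left _ _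

lemma jap_pos (j : ℕ) : 0 < jap j := zero_lt_one.trans_le (one_le_jap j)

/-- The contribution of a block of Hilbert–Schmidt norm `x` to `‖·‖_{B^{σ,m}}`. -/
def bTerm (σ m : ℝ) (j j' : ℕ) (x : ℝ) : ℝ≥0∞ :=
  ENNReal.ofReal (Real.exp (σ * |(j : ℝ) - (j' : ℝ)|) * x * jap j' ^ (-m))

lemma bNorm_eq (σ m : ℝ) (R : Op) :
    bNorm σ m R = ⨆ j' : ℕ, ∑' j : ℕ, bTerm σ m j j' (hsNorm (blockOf R j j')) := rfl

lemma bTerm_mono {σ m : ℝ} {j j' : ℕ} {x y : ℝ} (h : x ≤ y) : bTerm σ m j j' x ≤ bTerm σ m j j' y := by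
  refine ENNReal.ofReal_le_ofReal ?_
  have := (jap_pos j').le
  gcongr

lemma bTerm_mul {σ m : ℝ} {j j' : ℕ} {x : ℝ} {c : ℝ} (hc : 0 ≤ c) :
    bTerm σ m j j' (c * x) = ENNReal.ofReal c * bTerm σ m j j' x := by
  rw [bTerm, bTerm, ← ENNReal.ofReal_mul hc]
  ring_nf

lemma bTerm_eq_mul {σ m : ℝ} {j j' : ℕ} {x : ℝ} :
    bTerm σ m j j' x = ENNReal.ofReal (Real.exp (σ * |(j : ℝ) - (j' : ℝ)|) * jap j' ^ (-m)) *
      ENNReal.ofReal x := by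
  have := (jap_pos j').le
  rw [bTerm, ← ENNReal.ofReal_mul (by positivity)]
  ring_nf

lemma bTerm_add_le {σ m : ℝ} {j j' : ℕ} {x y : ℝ} :
    bTerm σ m j j' (x + y) ≤ bTerm σ m j j' x + bTerm σ m j j' y := by
  simp only [bTerm_eq_mul, ← mul_add]
  gcongr
  exact ENNReal.ofReal_add_le

lemma bTerm_le_bNorm (σ m : ℝ) (R : Op) (j j' : ℕ) :
    bTerm σ m j j' (hsNorm (blockOf R j j')) ≤ bNorm σ m R :=
  (ENNReal.le_tsum (f := fun j => bTerm σ m j j' (hsNorm (blockOf R j j'))) j).trans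
    (le_iSup (fun j' : ℕ => ∑' j : ℕ, bTerm σ m j j' (hsNorm (blockOf R j j'))) j')

lemma bNorm_le_of_bTerm_le {σ m σ' m' : ℝ} {R S : Op} {c : ℝ≥0∞}
    (h : ∀ j j', bTerm σ m j j' (hsNorm (blockOf R j j')) ≤
      c * bTerm σ' m' j j' (hsNorm (blockOf S j j'))) : bNorm σ m R ≤ c * bNorm σ' m' S := by
  rw [bNorm_eq, bNorm_eq]
  refine iSup_le fun j' => ?_
  refine (ENNReal.tsum_le_tsum fun j => h j j').trans ?_
  rw [ENNReal.tsum_mul_left]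
  gcongr
  exact le_iSup (fun j' : ℕ => ∑' j : ℕ, bTerm σ' m' j j' (hsNorm (blockOf S j j'))) j'

lemma bNorm_mono {σ m σ' m' : ℝ} (hσ : σ ≤ σ') (hm : m' ≤ m) (R : Op) :
    bNorm σ m R ≤ bNorm σ' m' R := by
  rw [← one_mul (bNorm σ' m' R)]
  refine bNorm_le_of_bTerm_le fun j j' => ?_
  rw [one_mul]
  refine ENNReal.ofReal_le_ofReal ?_
  have h1 := one_le_jap j'
  have h2 := hsNorm_nonneg (blockOf R j j')
  have h3 := (jap_pos j').le
  gcongr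

lemma bNorm_zero (σ m : ℝ) : bNorm σ m 0 = 0 := by
  simp [bNorm_eq, blockOf_zero, hsNorm_zero, bTerm]

lemma bNorm_smul_le (σ m : ℝ) (c : ℂ) (R : Op) : bNorm σ m (c • R) ≤ ‖c‖ₑ * bNorm σ m R := by
  refine bNorm_le_of_bTerm_le fun j j' => ?_
  rw [blockOf_smul, hsNorm_smul, bTerm_mul (norm_nonneg _), ofReal_norm]

lemma bNorm_neg (σ m : ℝ) (R : Op) : bNorm σ m (-R) = bNorm σ m R := by
  simp only [bNorm_eq, blockOf_neg, hsNorm_neg]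

lemma bNorm_add_le (σ m : ℝ) (R S : Op) : bNorm σ m (R + S) ≤ bNorm σ m R + bNorm σ m S := by
  rw [bNorm_eq]
  refine iSup_le fun j' => ?_
  calc ∑' j, bTerm σ m j j' (hsNorm (blockOf (R + S) j j'))
      ≤ ∑' j, (bTerm σ m j j' (hsNorm (blockOf R j j')) +
          bTerm σ m j j' (hsNorm (blockOf S j j'))) := by
        refine ENNReal.tsum_le_tsum fun j => le_trans (bTerm_mono ?_) bTerm_add_le
        rw [blockOf_add]; exact hsNorm_add_le _ _
    _ ≤ _ := by
        rw [ENNReal.tsum_add]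
        exact add_le_add
          (le_iSup (fun j' : ℕ => ∑' j : ℕ, bTerm σ m j j' (hsNorm (blockOf R j j'))) j')
          (le_iSup (fun j' : ℕ => ∑' j : ℕ, bTerm σ m j j' (hsNorm (blockOf S j j'))) j')

lemma bNorm_tsum_le {ι : Type*} (σ m : ℝ) (R : ι → Op) :
    bNorm σ m (∑' a, R a) ≤ ∑' a, bNorm σ m (R a) := by
  by_cases h : Summable R
  · rw [bNorm_eq]
    refine iSup_le fun j' => ?_
    calc ∑' j, bTerm σ m j j' (hsNorm (blockOf (∑' a, R a) j j'))
        ≤ ∑' j, ∑' a, bTerm σ m j j' (hsNorm (blockOf (R a) j j')) := by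
          refine ENNReal.tsum_le_tsum fun j => ?_
          simp only [bTerm_eq_mul]
          rw [ENNReal.tsum_mul_left]
          gcongr
          exact ofReal_hsNorm_le_tsum (hasSum_blockOf h.hasSum)
      _ = ∑' a, ∑' j, bTerm σ m j j' (hsNorm (blockOf (R a) j j')) := ENNReal.tsum_comm
      _ ≤ _ := ENNReal.tsum_le_tsum fun a =>
          le_iSup (fun j' : ℕ => ∑' j : ℕ, bTerm σ m j j' (hsNorm (blockOf (R a) j j'))) j'
  -- A series that does not converge has sum zero by convention, and the bound is then trivial.
  · rw [tsum_eq_zero_of_not_summable h, bNorm_zero]; exact zero_le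

/-- Composition of operators; the order `m` of the left factor is moved across the right factor,
which costs `ρ` of its decay. -/
lemma bNorm_mul_le {σ ρ m m' c : ℝ} (hσ : 0 ≤ σ)
    (hc : ∀ i j' : ℕ, jap i ^ m * jap j' ^ (-m) ≤ c * Real.exp (ρ * |(i : ℝ) - j'|)) (R S : Op) :
    bNorm σ (m + m') (R * S) ≤ ENNReal.ofReal c * bNorm σ m R * bNorm (σ + ρ) m' S := by
  have key : ∀ j i j' : ℕ, bTerm σ (m + m') j j' (hsNorm (blockOf R j i * blockOf S i j')) ≤
      ENNReal.ofReal c * bTerm (σ + ρ) m' i j' (hsNorm (blockOf S i j')) *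
        bTerm σ m j i (hsNorm (blockOf R j i)) := by
    intro j i j'
    have hc0 : 0 ≤ c := by
      have h := hc 0 0
      have h1 := jap_pos 0
      have h2 : 0 ≤ jap 0 ^ m * jap 0 ^ (-m) := by positivity
      simpa using h2.trans h
    have hi := jap_pos i
    have hj' := jap_pos j'
    have hS := hsNorm_nonneg (blockOf S i j')
    have hR := hsNorm_nonneg (blockOf R j i)
    rw [bTerm, bTerm, bTerm, ← ENNReal.ofReal_mul hc0, ← ENNReal.ofReal_mul (by positivity)]
    refine ENNReal.ofReal_le_ofReal ?_
    have e1 : Real.exp (σ * |(j : ℝ) - j'|) ≤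
        Real.exp (σ * |(j : ℝ) - i|) * Real.exp (σ * |(i : ℝ) - j'|) := by
      rw [← Real.exp_add, ← mul_add]
      gcongr
      exact abs_sub_le _ _ _
    -- The weight at the column `j'` is rewritten through the intermediate index `i`, so that the
    -- left factor is measured with the weight of its own column; the quotient left over is what
    -- `hc` controls.
    have e2 : jap j' ^ (-(m + m')) = jap i ^ (-m) * jap j' ^ (-m') * (jap i ^ m * jap j' ^ (-m)) := by
      have h0 : jap i ^ (-m) * jap i ^ m = 1 := by
        rw [← Real.rpow_add hi, neg_add_cancel, Real.rpow_zero]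
      have h1 : jap j' ^ (-m') * jap j' ^ (-m) = jap j' ^ (-(m + m')) := by
        rw [← Real.rpow_add hj']
        ring_nf
      rw [← h1]
      linear_combination (-(jap j' ^ (-m') * jap j' ^ (-m))) * h0
    have e3 : Real.exp ((σ + ρ) * |(i : ℝ) - j'|) =
        Real.exp (σ * |(i : ℝ) - j'|) * Real.exp (ρ * |(i : ℝ) - j'|) := by
      rw [← Real.exp_add, add_mul]
    calc Real.exp (σ * |(j : ℝ) - j'|) * hsNorm (blockOf R j i * blockOf S i j') *
          jap j' ^ (-(m + m'))
        ≤ (Real.exp (σ * |(j : ℝ) - i|) * Real.exp (σ * |(i : ℝ) - j'|)) *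
            (hsNorm (blockOf R j i) * hsNorm (blockOf S i j')) *
            (jap i ^ (-m) * jap j' ^ (-m') * (c * Real.exp (ρ * |(i : ℝ) - j'|))) := by
          rw [e2]
          refine mul_le_mul (mul_le_mul e1 (hsNorm_mul_le _ _) (hsNorm_nonneg _) (by positivity))
            (mul_le_mul_of_nonneg_left (hc i j') (by positivity)) (by positivity) (by positivity)
      _ = _ := by rw [e3]; ring
  rw [bNorm_eq]
  refine iSup_le fun j' => ?_
  calc ∑' j, bTerm σ (m + m') j j' (hsNorm (blockOf (R * S) j j'))
      ≤ ∑' j, ∑' i, bTerm σ (m + m') j j' (hsNorm (blockOf R j i * blockOf S i j')) := by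
        refine ENNReal.tsum_le_tsum fun j => ?_
        simp only [bTerm_eq_mul]
        rw [ENNReal.tsum_mul_left]
        gcongr
        exact ofReal_hsNorm_le_tsum (hasSum_blockOf_mul R S j j')
    _ ≤ ∑' j, ∑' i, ENNReal.ofReal c * bTerm (σ + ρ) m' i j' (hsNorm (blockOf S i j')) *
          bTerm σ m j i (hsNorm (blockOf R j i)) :=
        ENNReal.tsum_le_tsum fun j => ENNReal.tsum_le_tsum fun i => key j i j'
    _ = ∑' i, ENNReal.ofReal c * bTerm (σ + ρ) m' i j' (hsNorm (blockOf S i j')) *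
          ∑' j, bTerm σ m j i (hsNorm (blockOf R j i)) := by
        rw [ENNReal.tsum_comm]
        simp only [ENNReal.tsum_mul_left]
    _ ≤ ∑' i, ENNReal.ofReal c * bTerm (σ + ρ) m' i j' (hsNorm (blockOf S i j')) *
          bNorm σ m R := by
        gcongr with i
        exact le_iSup (fun j' : ℕ => ∑' j : ℕ, bTerm σ m j j' (hsNorm (blockOf R j j'))) i
    _ = ENNReal.ofReal c * bNorm σ m R *
          ∑' i, bTerm (σ + ρ) m' i j' (hsNorm (blockOf S i j')) := by
        rw [ENNReal.tsum_mul_right, ENNReal.tsum_mul_left]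
        ring
    _ ≤ _ := by
        gcongr
        exact le_iSup (fun j' : ℕ => ∑' i : ℕ, bTerm (σ + ρ) m' i j' (hsNorm (blockOf S i j'))) j'

lemma hsNorm_le_of_bNorm {σ : ℝ} {R : Op} (h : bNorm σ 0 R ≠ ∞) (j j' : ℕ) :
    hsNorm (blockOf R j j') ≤ (bNorm σ 0 R).toReal * Real.exp (-σ * |(j : ℝ) - j'|) := by
  have h1 := ENNReal.toReal_mono h (bTerm_le_bNorm σ 0 R j j')
  rw [bTerm, neg_zero, Real.rpow_zero, mul_one,
    ENNReal.toReal_ofReal (mul_nonneg (Real.exp_pos _).le (hsNorm_nonneg _))] at h1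
  rw [neg_mul, Real.exp_neg, ← div_eq_mul_inv, le_div_iff₀ (Real.exp_pos _), mul_comm]
  exact h1

/-- The Schur test produces an operator with the blocks of `R` and the required norm, and an
operator is determined by its blocks. -/
lemma enorm_le_bNorm {σ : ℝ} (hσ : 0 < σ) (R : Op) :
    ‖R‖ₑ ≤ schurConst σ * bNorm σ 0 R := by
  by_cases h : bNorm σ 0 R = ∞
  · rw [h, ENNReal.mul_top (schurConst_ne_zero σ)]; exact le_top
  obtain ⟨S, hS, hS'⟩ := exists_op_of_blocks hσ (fun j j' => blockOf R j j')
    (hsNorm_le_of_bNorm h)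
  obtain rfl : S = R := blockOf_ext hS
  rw [ENNReal.ofReal_toReal h] at hS'
  exact hS'.trans_eq (mul_comm _ _)

lemma bNorm_one_le (σ : ℝ) : bNorm σ 0 1 ≤ 2 := by
  rw [bNorm_eq]
  refine iSup_le fun j' => ?_
  rw [tsum_eq_single j']
  · have := hsNorm_blockOf_one_le j' j'
    rw [bTerm]
    simp only [sub_self, abs_zero, mul_zero, Real.exp_zero, one_mul, neg_zero, Real.rpow_zero,
      mul_one]
    simpa using ENNReal.ofReal_le_ofReal this
  · intro j hj
    rw [blockOf_one_of_ne hj, hsNorm_zero]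
    simp [bTerm]

lemma jap_le_mul (i j : ℕ) : jap i ≤ jap j * (1 + |(i : ℝ) - j|) := by
  have h1 := one_le_jap j
  have h2 : (j : ℝ) ≤ jap j := le_max_right _ _
  have h3 := abs_nonneg ((i : ℝ) - j)
  have h4 := le_abs_self ((i : ℝ) - j)
  refine max_le ?_ ?_ <;> nlinarith

/-- The constant `4 ρ⁻² e^ρ` in the comparison of weights of order two. -/
def shiftConst (ρ : ℝ) : ℝ := 4 / ρ ^ 2 * Real.exp ρ

/-- This is the square of `y ≤ e^y` at `y = ρ (1 + x) / 2`, whence the constant `4 ρ⁻² e^ρ`. -/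
lemma one_add_sq_le_shiftConst {ρ x : ℝ} (hρ : 0 < ρ) (hx : 0 ≤ x) :
    (1 + x) ^ 2 ≤ shiftConst ρ * Real.exp (ρ * x) := by
  have h1 : ρ * (1 + x) / 2 ≤ Real.exp (ρ * (1 + x) / 2) :=
    (Real.add_one_le_exp _).trans' (by linarith)
  have h2 : (ρ * (1 + x) / 2) ^ 2 ≤ Real.exp (ρ * (1 + x) / 2) ^ 2 :=
    pow_le_pow_left₀ (by positivity) h1 2
  rw [← Real.exp_nat_mul] at h2
  have h3 : Real.exp (((2 : ℕ) : ℝ) * (ρ * (1 + x) / 2)) = Real.exp ρ * Real.exp (ρ * x) := by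
    rw [← Real.exp_add]; congr 1; push_cast; ring
  rw [h3] at h2
  rw [shiftConst, mul_assoc, ← h3, h3, div_mul_eq_mul_div, le_div_iff₀ (by positivity)]
  nlinarith

lemma jap_two_le {ρ : ℝ} (hρ : 0 < ρ) (i j' : ℕ) :
    jap i ^ (2 : ℝ) * jap j' ^ (-(2 : ℝ)) ≤ shiftConst ρ * Real.exp (ρ * |(i : ℝ) - j'|) := by
  have h := jap_le_mul i j'
  have h1 := jap_pos j'
  have h0 := jap_pos i
  rw [Real.rpow_neg h1.le, ← div_eq_mul_inv, Real.rpow_two, Real.rpow_two, ← div_pow]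
  refine le_trans ?_ (one_add_sq_le_shiftConst hρ (abs_nonneg _))
  refine pow_le_pow_left₀ (by positivity) ?_ 2
  rw [div_le_iff₀ h1]; linarith

lemma jap_neg_two_le {ρ : ℝ} (hρ : 0 < ρ) (i j' : ℕ) :
    jap i ^ (-2 : ℝ) * jap j' ^ (-(-2 : ℝ)) ≤ shiftConst ρ * Real.exp (ρ * |(i : ℝ) - j'|) := by
  have := jap_two_le hρ j' i
  rw [abs_sub_comm, mul_comm] at this
  simpa using this

/-- At order zero there is no weight to move, so composition costs neither a constant nor decay. -/
lemma jap_zero_le (i j' : ℕ) :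
    jap i ^ (0 : ℝ) * jap j' ^ (-(0 : ℝ)) ≤ 1 * Real.exp (0 * |(i : ℝ) - j'|) := by simp


/-! ### Fourier indices -/

lemma Idx.wt_nonneg (η : ℝ) (l : Idx) : 0 ≤ l.wt η :=
  Finset.sum_nonneg fun j _ => by positivity

lemma Idx.wt_zero (η : ℝ) : (0 : Idx).wt η = 0 := by simp [Idx.wt]

lemma Idx.wt_neg (η : ℝ) (l : Idx) : (-l).wt η = l.wt η := by
  rw [Idx.wt, Finsupp.sum_neg_index (by simp)]
  simp [Idx.wt]

lemma Idx.wt_add_le (η : ℝ) (l l' : Idx) : (l + l').wt η ≤ l.wt η + l'.wt η := by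
  classical
  have hs : ∀ x : Idx, x.support ⊆ (l.support ∪ l'.support ∪ (l + l').support) → x.wt η =
      ∑ j ∈ (l.support ∪ l'.support ∪ (l + l').support), ((j : ℕ) : ℝ) ^ η * |(x j : ℝ)| := by
    intro x hx
    exact Finsupp.sum_of_support_subset _ hx _ (by simp)
  rw [hs (l + l') (by intro; simp +contextual), hs l (by intro; simp +contextual),
    hs l' (by intro; simp +contextual), ← Finset.sum_add_distrib]
  refine Finset.sum_le_sum fun j _ => ?_
  rw [← mul_add]
  gcongr
  simp only [Finsupp.coe_add, Pi.add_apply, Int.cast_add]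
  exact abs_add_le _ _

lemma freqDot_zero (ω : Freq) : freqDot ω 0 = 0 := by simp [freqDot]

lemma freqDot_add (ω : Freq) (l l' : Idx) : freqDot ω (l + l') = freqDot ω l + freqDot ω l' := by
  classical
  exact Finsupp.sum_add_index (by simp) (by intros; push_cast; ring)

lemma freqDot_neg (ω : Freq) (l : Idx) : freqDot ω (-l) = -freqDot ω l := by
  rw [freqDot, Finsupp.sum_neg_index (by simp)]
  simp [freqDot, Finsupp.sum]

lemma one_le_natCast_rpow {η : ℝ} (hη : 0 < η) (j : ℕ+) : 1 ≤ ((j : ℕ) : ℝ) ^ η :=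
  Real.one_le_rpow (by exact_mod_cast (one_le : 1 ≤ j)) hη.le

lemma abs_freqDot_sub_le {η : ℝ} (hη : 0 < η) (ω₁ ω₂ : Freq) (l : Idx) :
    |freqDot ω₁ l - freqDot ω₂ l| ≤ ‖ω₁ - ω₂‖ * l.wt η := by
  rw [freqDot, freqDot, Idx.wt, Finsupp.sum, Finsupp.sum, Finsupp.sum, ← Finset.sum_sub_distrib,
    Finset.mul_sum]
  refine (Finset.abs_sum_le_sum_abs _ _).trans (Finset.sum_le_sum fun j _ => ?_)
  rw [← sub_mul, abs_mul]
  have h1 : |ω₁ j - ω₂ j| ≤ ‖ω₁ - ω₂‖ := by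
    have := lp.norm_apply_le_norm (p := ∞) (by simp) (ω₁ - ω₂) j
    simpa using this
  have h2 := one_le_natCast_rpow hη j
  calc |ω₁ j - ω₂ j| * |(l j : ℝ)| ≤ ‖ω₁ - ω₂‖ * (1 * |(l j : ℝ)|) := by
        rw [one_mul]; gcongr
    _ ≤ _ := by gcongr

lemma abs_freqDot_le {η : ℝ} (hη : 0 < η) (ω : Freq) (l : Idx) :
    |freqDot ω l| ≤ ‖ω‖ * l.wt η := by
  have h := abs_freqDot_sub_le hη ω 0 l
  have h0 : freqDot 0 l = 0 := by simp [freqDot, Finsupp.sum]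
  simpa [h0] using h

lemma expDot_zero (φ : ℕ+ → ℂ) : expDot 0 φ = 1 := by simp [expDot]

lemma expDot_add (l l' : Idx) (φ : ℕ+ → ℂ) : expDot (l + l') φ = expDot l φ * expDot l' φ := by
  classical
  rw [expDot, Finsupp.sum_add_index (by simp) (by intros; push_cast; ring), mul_add, Complex.exp_add]
  rfl

lemma expDot_ne_zero (l : Idx) (φ : ℕ+ → ℂ) : expDot l φ ≠ 0 := Complex.exp_ne_zero _

lemma expDot_angle_zero (l : Idx) : expDot l 0 = 1 := by simp [expDot, Finsupp.sum]

lemma norm_expDot_le {η σ : ℝ} {φ : ℕ+ → ℂ} (hφ : φ ∈ thickTorus η σ) (l : Idx) :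
    ‖expDot l φ‖ ≤ Real.exp (σ * l.wt η) := by
  rw [expDot, Complex.norm_exp]
  refine Real.exp_le_exp.2 ?_
  have h : (Complex.I * l.sum fun j z => (z : ℂ) * φ j).re =
      ∑ j ∈ l.support, -((l j : ℝ) * (φ j).im) := by
    simp [Finsupp.sum]
  rw [h, Idx.wt, Finsupp.sum, Finset.mul_sum]
  refine Finset.sum_le_sum fun j _ => ?_
  have h1 := hφ j
  calc -((l j : ℝ) * (φ j).im) ≤ |(l j : ℝ) * (φ j).im| := neg_le_abs _
    _ = |(l j : ℝ)| * |(φ j).im| := abs_mul _ _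
    _ ≤ |(l j : ℝ)| * (σ * ((j : ℕ) : ℝ) ^ η) := by gcongr
    _ = _ := by ring

lemma thickTorus_mono {η σ σ' : ℝ} (h : σ ≤ σ') : thickTorus η σ ⊆ thickTorus η σ' :=
  fun φ hφ j => (hφ j).trans (by gcongr)

lemma real_mem_thickTorus {η σ : ℝ} (hσ : 0 ≤ σ) (φ : ℕ+ → ℝ) :
    (fun j => (φ j : ℂ)) ∈ thickTorus η σ := fun j => by
  simp only [Complex.ofReal_im, abs_zero]
  positivity

/-! ### The decay norm -/

variable {η σ m : ℝ}

lemma decayNorm_zero (η σ m : ℝ) : decayNorm η σ m 0 = 0 := by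
  simp [decayNorm, bNorm_zero]

lemma decayNorm_neg (R : TimeOp) : decayNorm η σ m (-R) = decayNorm η σ m R := by
  simp [decayNorm, bNorm_neg]

lemma decayNorm_add_le (R S : TimeOp) :
    decayNorm η σ m (R + S) ≤ decayNorm η σ m R + decayNorm η σ m S := by
  rw [decayNorm, decayNorm, decayNorm, ← ENNReal.tsum_add]
  refine ENNReal.tsum_le_tsum fun l => ?_
  rw [← mul_add]
  gcongr
  exact bNorm_add_le _ _ _ _

lemma decayNorm_sub_le (R S : TimeOp) :
    decayNorm η σ m (R - S) ≤ decayNorm η σ m R + decayNorm η σ m S := by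
  rw [sub_eq_add_neg, ← decayNorm_neg S]
  exact decayNorm_add_le _ _

lemma decayNorm_smul_le (c : ℂ) (R : TimeOp) :
    decayNorm η σ m (c • R) ≤ ‖c‖ₑ * decayNorm η σ m R := by
  rw [decayNorm, decayNorm, ← ENNReal.tsum_mul_left]
  refine ENNReal.tsum_le_tsum fun l => ?_
  rw [mul_left_comm]
  gcongr
  exact bNorm_smul_le _ _ _ _

lemma decayNorm_mono {σ' m' : ℝ} (hσ : σ ≤ σ') (hm : m' ≤ m) (R : TimeOp) :
    decayNorm η σ m R ≤ decayNorm η σ' m' R := by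
  refine ENNReal.tsum_le_tsum fun l => ?_
  have := Idx.wt_nonneg η l
  gcongr
  exact bNorm_mono hσ hm _

/-- Coefficientwise sum of a series of families. -/
def timeSum (R : ℕ → TimeOp) : TimeOp := fun l => ∑' k, R k l

lemma decayNorm_timeSum_le (R : ℕ → TimeOp) :
    decayNorm η σ m (timeSum R) ≤ ∑' k, decayNorm η σ m (R k) := by
  simp only [decayNorm]
  rw [ENNReal.tsum_comm]
  refine ENNReal.tsum_le_tsum fun l => ?_
  rw [ENNReal.tsum_mul_left]
  gcongr
  exact bNorm_tsum_le _ _ _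

lemma bNorm_coeff_le_decayNorm (hσ : 0 ≤ σ) (R : TimeOp) (l : Idx) :
    bNorm σ m (R l) ≤ decayNorm η σ m R := by
  refine le_trans ?_ (ENNReal.le_tsum l)
  refine le_mul_of_one_le_left zero_le ?_
  rw [ENNReal.one_le_ofReal]
  exact Real.one_le_exp (mul_nonneg hσ (Idx.wt_nonneg η l))

/-- Convolution of Fourier coefficients, the coefficients of the product family. -/
def conv (R S : TimeOp) : TimeOp := fun l => ∑' a, R a * S (l - a)

/-- The weight `e^{σ|ℓ|_η}` is submultiplicative along `ℓ = a + (ℓ - a)`; Tonelli and translation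
invariance of the sum over `ℓ` then factor the double sum. -/
lemma decayNorm_conv_le {ρ m' c : ℝ} (hσ : 0 ≤ σ) (hρ : 0 ≤ ρ)
    (hc : ∀ i j' : ℕ, jap i ^ m * jap j' ^ (-m) ≤ c * Real.exp (ρ * |(i : ℝ) - j'|))
    (R S : TimeOp) : decayNorm η σ (m + m') (conv R S) ≤
      ENNReal.ofReal c * decayNorm η σ m R * decayNorm η (σ + ρ) m' S := by
  have key : ∀ l a : Idx, ENNReal.ofReal (Real.exp (σ * l.wt η)) * bNorm σ (m + m') (R a * S (l - a)) ≤
      ENNReal.ofReal c * (ENNReal.ofReal (Real.exp (σ * a.wt η)) * bNorm σ m (R a)) *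
      (ENNReal.ofReal (Real.exp ((σ + ρ) * (l - a).wt η)) * bNorm (σ + ρ) m' (S (l - a))) := by
    intro l a
    calc _ ≤ ENNReal.ofReal (Real.exp (σ * a.wt η) * Real.exp ((σ + ρ) * (l - a).wt η)) *
          (ENNReal.ofReal c * bNorm σ m (R a) * bNorm (σ + ρ) m' (S (l - a))) := by
          gcongr
          · rw [← Real.exp_add]
            refine Real.exp_le_exp.2 ?_
            have h1 := Idx.wt_add_le η a (l - a)
            rw [add_sub_cancel] at h1
            have h2 := Idx.wt_nonneg η (l - a)
            nlinarith
          · exact bNorm_mul_le hσ hc _ _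
      _ = _ := by
          rw [ENNReal.ofReal_mul (Real.exp_pos _).le]; ring
  calc decayNorm η σ (m + m') (conv R S)
      ≤ ∑' l : Idx, ∑' a : Idx, ENNReal.ofReal (Real.exp (σ * l.wt η)) *
          bNorm σ (m + m') (R a * S (l - a)) := by
        refine ENNReal.tsum_le_tsum fun l => ?_
        rw [ENNReal.tsum_mul_left]
        gcongr
        exact bNorm_tsum_le _ _ _
    _ ≤ ∑' l : Idx, ∑' a : Idx,
          ENNReal.ofReal c * (ENNReal.ofReal (Real.exp (σ * a.wt η)) * bNorm σ m (R a)) *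
          (ENNReal.ofReal (Real.exp ((σ + ρ) * (l - a).wt η)) * bNorm (σ + ρ) m' (S (l - a))) :=
        ENNReal.tsum_le_tsum fun l => ENNReal.tsum_le_tsum fun a => key l a
    _ = ∑' a : Idx, ENNReal.ofReal c * (ENNReal.ofReal (Real.exp (σ * a.wt η)) * bNorm σ m (R a)) *
          decayNorm η (σ + ρ) m' S := by
        rw [ENNReal.tsum_comm]
        refine tsum_congr fun a => ?_
        rw [ENNReal.tsum_mul_left]
        congr 1
        exact (Equiv.subRight a).tsum_eq fun b : Idx =>
          ENNReal.ofReal (Real.exp ((σ + ρ) * b.wt η)) * bNorm (σ + ρ) m' (S b)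
    _ = _ := by
        rw [ENNReal.tsum_mul_right, ENNReal.tsum_mul_left]; rfl

/-! ### Evaluation at an angle -/

/-- The Fourier series of `R` converges absolutely at the angle `φ`. -/
def EvSum (φ : ℕ+ → ℂ) (R : TimeOp) : Prop := Summable fun l => ‖expDot l φ • R l‖

lemma tsum_enorm_le_decayNorm (hσ : 0 < σ) (hm : m ≤ 0) {φ : ℕ+ → ℂ} (hφ : φ ∈ thickTorus η σ)
    (R : TimeOp) : ∑' l, ‖expDot l φ • R l‖ₑ ≤ schurConst σ * decayNorm η σ m R := by
  rw [decayNorm, ← ENNReal.tsum_mul_left]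
  refine ENNReal.tsum_le_tsum fun l => ?_
  rw [enorm_smul, mul_left_comm]
  refine mul_le_mul' ?_ ((enorm_le_bNorm hσ _).trans ?_)
  · rw [← ofReal_norm]
    exact ENNReal.ofReal_le_ofReal (norm_expDot_le hφ l)
  · gcongr
    exact bNorm_mono le_rfl hm _

lemma evSum_of_decayNorm (hσ : 0 < σ) (hm : m ≤ 0) {R : TimeOp} (hR : decayNorm η σ m R ≠ ∞)
    {φ : ℕ+ → ℂ} (hφ : φ ∈ thickTorus η σ) : EvSum φ R := by
  have h := ne_top_of_le_ne_top (ENNReal.mul_ne_top (schurConst_ne_top hσ) hR)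
    (tsum_enorm_le_decayNorm hσ hm hφ R)
  have := ENNReal.summable_toReal h
  simpa [EvSum] using this

variable {φ : ℕ+ → ℂ} {R S : TimeOp}

lemma EvSum.summable (h : EvSum φ R) : Summable fun l => expDot l φ • R l := Summable.of_norm h

lemma EvSum.hasSum (h : EvSum φ R) : HasSum (fun l => expDot l φ • R l) (evalAt R φ) :=
  h.summable.hasSum

lemma EvSum.add (h : EvSum φ R) (h' : EvSum φ S) : EvSum φ (R + S) := by
  refine Summable.of_nonneg_of_le (fun _ => norm_nonneg _) (fun l => ?_) (Summable.add h h')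
  rw [Pi.add_apply, smul_add]; exact norm_add_le _ _

lemma EvSum.neg (h : EvSum φ R) : EvSum φ (-R) := by
  simpa [EvSum] using h

lemma EvSum.sub (h : EvSum φ R) (h' : EvSum φ S) : EvSum φ (R - S) := by
  rw [sub_eq_add_neg]; exact h.add h'.neg

lemma evalAt_add (h : EvSum φ R) (h' : EvSum φ S) :
    evalAt (R + S) φ = evalAt R φ + evalAt S φ := by
  refine ((h.hasSum.add h'.hasSum).congr_fun ?_).tsum_eq
  intro l; simp

lemma evalAt_neg : evalAt (-R) φ = -evalAt R φ := by
  simp only [evalAt, Pi.neg_apply, smul_neg, tsum_neg]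

lemma evalAt_sub (h : EvSum φ R) (h' : EvSum φ S) :
    evalAt (R - S) φ = evalAt R φ - evalAt S φ := by
  rw [sub_eq_add_neg, evalAt_add h h'.neg, evalAt_neg, sub_eq_add_neg]

lemma evalAt_smul (c : ℂ) : evalAt (c • R) φ = c • evalAt R φ := by
  simp only [evalAt, Pi.smul_apply, smul_comm _ c]
  exact tsum_const_smul'' c

/-- `(l, a) ↦ (a, l - a)`. -/
def shearEquiv : Idx × Idx ≃ Idx × Idx where
  toFun x := (x.2, x.1 - x.2)
  invFun x := (x.1 + x.2, x.1)
  left_inv x := by simp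
  right_inv x := by simp

lemma EvSum.pairs (h : EvSum φ R) (h' : EvSum φ S) :
    Summable fun x : Idx × Idx => ‖expDot x.1 φ • (R x.2 * S (x.1 - x.2))‖ := by
  have h1 := (shearEquiv.summable_iff).2 (Summable.mul_norm h h')
  refine h1.congr fun x => ?_
  simp only [Function.comp_apply, shearEquiv, Equiv.coe_fn_mk]
  rw [smul_mul_smul_comm, ← expDot_add, add_sub_cancel]

/-- Absolute convergence at a single angle suffices, because `e^{iℓ·φ}` never vanishes and can be
divided out. The identities between convolutions below therefore ask only for some `φ`. -/
lemma EvSum.summable_conv (h : EvSum φ R) (h' : EvSum φ S) (l : Idx) :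
    Summable fun a => R a * S (l - a) := by
  have h1 := (h.pairs h').prod_factor l
  simp only [norm_smul] at h1
  exact Summable.of_norm ((summable_mul_left_iff (norm_ne_zero_iff.2 (expDot_ne_zero l φ))).1 h1)

lemma EvSum.conv (h : EvSum φ R) (h' : EvSum φ S) : EvSum φ (conv R S) := by
  have h1 := h.pairs h'
  refine Summable.of_nonneg_of_le (fun _ => norm_nonneg _) (fun l => ?_) h1.prod
  rw [AlmostPeriodicKAM.conv, ← tsum_const_smul'']
  exact norm_tsum_le_tsum_norm (h1.prod_factor l)

lemma evalAt_conv (h : EvSum φ R) (h' : EvSum φ S) :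
    evalAt (conv R S) φ = evalAt R φ * evalAt S φ := by
  have h1 := (h.pairs h').of_norm
  rw [evalAt, evalAt, evalAt, tsum_mul_tsum_of_summable_norm h h', ← shearEquiv.tsum_eq]
  have h2 : ∀ x : Idx × Idx, (expDot (shearEquiv x).1 φ • R (shearEquiv x).1) *
      (expDot (shearEquiv x).2 φ • S (shearEquiv x).2) =
      expDot x.1 φ • (R x.2 * S (x.1 - x.2)) := fun x => by
    simp only [shearEquiv, Equiv.coe_fn_mk]
    rw [smul_mul_smul_comm, ← expDot_add, add_sub_cancel]
  simp only [h2]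
  rw [h1.tsum_prod]
  refine tsum_congr fun l => ?_
  rw [conv, ← tsum_const_smul'']

lemma conv_sub_left {R' : TimeOp} (h : EvSum φ R) (h1 : EvSum φ R') (h' : EvSum φ S) :
    conv (R - R') S = conv R S - conv R' S := by
  funext l
  simp only [conv, Pi.sub_apply, sub_mul]
  exact (h.summable_conv h' l).tsum_sub (h1.summable_conv h' l)

lemma conv_sub_right {S' : TimeOp} (h : EvSum φ R) (h1 : EvSum φ S) (h' : EvSum φ S') :
    conv R (S - S') = conv R S - conv R S' := by
  funext l
  simp only [conv, Pi.sub_apply, mul_sub]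
  exact (h.summable_conv h1 l).tsum_sub (h.summable_conv h' l)

lemma omegaDeriv_conv (ω : Freq) (h : EvSum φ R) (h' : EvSum φ S) (hd : EvSum φ (omegaDeriv ω R))
    (hd' : EvSum φ (omegaDeriv ω S)) :
    omegaDeriv ω (conv R S) = conv (omegaDeriv ω R) S + conv R (omegaDeriv ω S) := by
  funext l
  simp only [omegaDeriv, conv, Pi.add_apply]
  rw [← tsum_const_smul'']
  refine Eq.trans (tsum_congr fun a => ?_)
    ((hd.summable_conv h' l).tsum_add (h.summable_conv hd' l))
  simp only [omegaDeriv]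
  rw [smul_mul_assoc, mul_smul_comm, ← add_smul, ← mul_add, ← Complex.ofReal_add, ← freqDot_add,
    add_sub_cancel]

/-- A Cauchy estimate: `ρ |ℓ|_η ≤ e^{ρ|ℓ|_η}` trades the derivative for `ρ` of width. -/
lemma decayNorm_omegaDeriv_le (hη : 0 < η) {ρ : ℝ} (hρ : 0 < ρ) (ω : Freq) (R : TimeOp) :
    decayNorm η σ m (omegaDeriv ω R) ≤ ENNReal.ofReal (‖ω‖ / ρ) * decayNorm η (σ + ρ) m R := by
  rw [decayNorm, decayNorm, ← ENNReal.tsum_mul_left]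
  refine ENNReal.tsum_le_tsum fun l => ?_
  refine (mul_le_mul' le_rfl (bNorm_smul_le _ _ _ _)).trans ?_
  rw [← mul_assoc, ← mul_assoc]
  refine mul_le_mul' ?_ (bNorm_mono (by linarith) le_rfl _)
  rw [← ofReal_norm, ← ENNReal.ofReal_mul (Real.exp_pos _).le, ← ENNReal.ofReal_mul (by positivity)]
  refine ENNReal.ofReal_le_ofReal ?_
  have h1 : ‖Complex.I * (freqDot ω l : ℂ)‖ ≤ ‖ω‖ * l.wt η := by
    simpa using abs_freqDot_le hη ω l
  have h2 : ρ * l.wt η ≤ Real.exp (ρ * l.wt η) :=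
    (Real.add_one_le_exp _).trans' (by linarith)
  have h3 : l.wt η ≤ Real.exp (ρ * l.wt η) / ρ := by
    rw [le_div_iff₀ hρ]; linarith
  calc Real.exp (σ * l.wt η) * ‖Complex.I * (freqDot ω l : ℂ)‖
      ≤ Real.exp (σ * l.wt η) * (‖ω‖ * (Real.exp (ρ * l.wt η) / ρ)) := by
        gcongr; exact h1.trans (by gcongr)
    _ = _ := by rw [add_mul, Real.exp_add]; ring


/-! ### Conjugation by an exponential in a Banach algebra -/

section BanachAlgebra

open scoped Nat

variable {A : Type*} [NormedRing A]

/-- `X F - F X`. -/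
def rightAd (F X : A) : A := X * F - F * X

/-- `∑_{a + b = n - 1} F^a X F^b`, the derivative of `F^n` in the direction `X`. -/
def powDeriv (F X : A) : ℕ → A
  | 0 => 0
  | n + 1 => powDeriv F X n * F + F ^ n * X

lemma norm_iterate_rightAd_le (F X : A) (k : ℕ) :
    ‖(rightAd F)^[k] X‖ ≤ (2 * ‖F‖) ^ k * ‖X‖ := by
  induction k with
  | zero => simp
  | succ k ih =>
    rw [Function.iterate_succ_apply', rightAd]
    refine (norm_sub_le _ _).trans ?_
    have h1 := norm_mul_le ((rightAd F)^[k] X) F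
    have h2 := norm_mul_le F ((rightAd F)^[k] X)
    have h3 := norm_nonneg F
    rw [pow_succ]
    nlinarith

lemma iterate_rightAd_mul (F X : A) (k : ℕ) :
    (rightAd F)^[k] X * F = (rightAd F)^[k + 1] X + F * (rightAd F)^[k] X := by
  rw [Function.iterate_succ_apply', rightAd]; abel

variable [NormedAlgebra ℂ A]

lemma summable_norm_adSeries (F X : A) (c : ℕ → ℂ) (hc : ∀ k, ‖c k‖ ≤ (k ! : ℝ)⁻¹) :
    Summable fun k => ‖c k • (rightAd F)^[k] X‖ := by
  have h := (Real.summable_pow_div_factorial (2 * ‖F‖)).mul_right ‖X‖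
  refine Summable.of_nonneg_of_le (fun _ => norm_nonneg _) (fun k => ?_) h
  rw [norm_smul]
  calc ‖c k‖ * ‖(rightAd F)^[k] X‖ ≤ (k ! : ℝ)⁻¹ * ((2 * ‖F‖) ^ k * ‖X‖) := by
        gcongr
        · exact hc k
        · exact norm_iterate_rightAd_le F X k
    _ = _ := by ring

lemma inv_factorial_succ (n : ℕ) : ((n + 1) ! : ℂ)⁻¹ * ((n : ℂ) + 1) = (n ! : ℂ)⁻¹ := by
  have h : (n ! : ℂ) ≠ 0 := by exact_mod_cast n.factorial_ne_zero
  have h2 : (n : ℂ) + 1 ≠ 0 := by exact_mod_cast n.succ_ne_zero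
  rw [Nat.factorial_succ]
  push_cast
  field_simp

lemma norm_inv_factorial (n : ℕ) : ‖(n ! : ℂ)⁻¹‖ = (n ! : ℝ)⁻¹ := by simp

lemma norm_inv_factorial_succ_le (n : ℕ) : ‖((n + 1) ! : ℂ)⁻¹‖ ≤ (n ! : ℝ)⁻¹ := by
  rw [norm_inv_factorial]
  have : (0 : ℝ) < n ! := by exact_mod_cast n.factorial_pos
  gcongr
  exact n.le_succ

/-- The `a`-part of the recursion for Cauchy products with the exponential series. -/
lemma sum_antidiagonal_smul_left (F : A) (Y : ℕ → A) (n : ℕ) :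
    ∑ p ∈ Finset.HasAntidiagonal.antidiagonal (n + 1), (p.1 : ℂ) • (((p.1 ! : ℂ)⁻¹ • F ^ p.1) * Y p.2) =
      ∑ p ∈ Finset.HasAntidiagonal.antidiagonal n, ((p.1 ! : ℂ)⁻¹ • F ^ p.1) * (F * Y p.2) := by
  rw [Finset.Nat.sum_antidiagonal_succ]
  simp only [Nat.cast_zero, zero_smul, zero_add]
  refine Finset.sum_congr rfl fun p _ => ?_
  rw [← mul_assoc, smul_mul_assoc, smul_mul_assoc, smul_mul_assoc, smul_smul, ← pow_succ,
    ← inv_factorial_succ p.1, mul_comm]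
  push_cast
  rfl

/-- The part of degree `n` in `F` of the identity `e^F ∑ ad^k X / k! = X e^F`. In the induction the
sum is multiplied by `n + 1 = a + b`; the `a`-part and the `b`-part recombine through `(ad^b X) F =
ad^{b+1} X + F ad^b X`. -/
lemma sum_antidiagonal_exp_ad (F X : A) (n : ℕ) :
    ∑ p ∈ Finset.HasAntidiagonal.antidiagonal n, ((p.1 ! : ℂ)⁻¹ • F ^ p.1) * ((p.2 ! : ℂ)⁻¹ • (rightAd F)^[p.2] X) =
      (n ! : ℂ)⁻¹ • (X * F ^ n) := by
  induction n with
  | zero => simp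
  | succ n ih =>
    have hn : ((n : ℂ) + 1) ≠ 0 := by exact_mod_cast n.succ_ne_zero
    refine smul_right_injective A hn ?_
    simp only
    have h1 : ((n : ℂ) + 1) • ∑ p ∈ Finset.HasAntidiagonal.antidiagonal (n + 1),
        ((p.1 ! : ℂ)⁻¹ • F ^ p.1) * ((p.2 ! : ℂ)⁻¹ • (rightAd F)^[p.2] X) =
        (∑ p ∈ Finset.HasAntidiagonal.antidiagonal (n + 1),
          (p.1 : ℂ) • (((p.1 ! : ℂ)⁻¹ • F ^ p.1) * ((p.2 ! : ℂ)⁻¹ • (rightAd F)^[p.2] X))) +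
        ∑ p ∈ Finset.HasAntidiagonal.antidiagonal (n + 1),
          (p.2 : ℂ) • (((p.1 ! : ℂ)⁻¹ • F ^ p.1) * ((p.2 ! : ℂ)⁻¹ • (rightAd F)^[p.2] X)) := by
      rw [Finset.smul_sum, ← Finset.sum_add_distrib]
      refine Finset.sum_congr rfl fun p hp => ?_
      rw [← add_smul]
      congr 1
      rw [Finset.HasAntidiagonal.mem_antidiagonal] at hp
      exact_mod_cast hp.symm
    rw [h1, sum_antidiagonal_smul_left F (fun b => (b ! : ℂ)⁻¹ • (rightAd F)^[b] X),
      Finset.Nat.sum_antidiagonal_succ']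
    simp only [Nat.cast_zero, zero_smul, zero_add]
    rw [← Finset.sum_add_distrib, smul_smul, mul_comm, inv_factorial_succ, pow_succ, ← mul_assoc,
      ← smul_mul_assoc _ (X * F ^ n) F, ← ih, Finset.sum_mul]
    refine Finset.sum_congr rfl fun p _ => ?_
    rw [mul_assoc, smul_mul_assoc (_ : ℂ) ((rightAd F)^[p.2] X), iterate_rightAd_mul, smul_add,
      mul_add, mul_smul_comm _ F, add_comm]
    congr 1
    rw [← mul_smul_comm, smul_smul, mul_comm (_ : ℂ) ((_ : ℂ)⁻¹)]
    push_cast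
    rw [inv_factorial_succ]

/-- The same induction for the derivative of the exponential. The multiplier is now `n + 2 = a + (b
+ 1)`, and the boundary term `a = n + 1` supplies the summand `F^{n+1} X` of `powDeriv`. -/
lemma sum_antidiagonal_exp_ad_succ (F X : A) (n : ℕ) :
    ∑ p ∈ Finset.HasAntidiagonal.antidiagonal n,
        ((p.1 ! : ℂ)⁻¹ • F ^ p.1) * (((p.2 + 1) ! : ℂ)⁻¹ • (rightAd F)^[p.2] X) =
      ((n + 1) ! : ℂ)⁻¹ • powDeriv F X (n + 1) := by
  induction n with
  | zero => simp [powDeriv]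
  | succ n ih =>
    have hn : ((n : ℂ) + 1 + 1) ≠ 0 := by exact_mod_cast (n + 1).succ_ne_zero
    refine smul_right_injective A hn ?_
    simp only
    have h1 : ((n : ℂ) + 1 + 1) • ∑ p ∈ Finset.HasAntidiagonal.antidiagonal (n + 1),
        ((p.1 ! : ℂ)⁻¹ • F ^ p.1) * (((p.2 + 1) ! : ℂ)⁻¹ • (rightAd F)^[p.2] X) =
        (∑ p ∈ Finset.HasAntidiagonal.antidiagonal (n + 1),
          (p.1 : ℂ) • (((p.1 ! : ℂ)⁻¹ • F ^ p.1) * (((p.2 + 1) ! : ℂ)⁻¹ • (rightAd F)^[p.2] X))) +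
        ∑ p ∈ Finset.HasAntidiagonal.antidiagonal (n + 1), ((p.2 : ℂ) + 1) •
          (((p.1 ! : ℂ)⁻¹ • F ^ p.1) * (((p.2 + 1) ! : ℂ)⁻¹ • (rightAd F)^[p.2] X)) := by
      rw [Finset.smul_sum, ← Finset.sum_add_distrib]
      refine Finset.sum_congr rfl fun p hp => ?_
      rw [← add_smul]
      congr 1
      rw [Finset.HasAntidiagonal.mem_antidiagonal] at hp
      rw [← add_assoc]
      exact_mod_cast congrArg (fun x : ℕ => (x : ℂ) + 1) hp.symm
    have h2 := inv_factorial_succ (n + 1)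
    push_cast at h2
    rw [h1, sum_antidiagonal_smul_left F (fun b => ((b + 1) ! : ℂ)⁻¹ • (rightAd F)^[b] X),
      Finset.Nat.sum_antidiagonal_succ', smul_smul, mul_comm ((n : ℂ) + 1 + 1), h2, powDeriv,
      smul_add, ← smul_mul_assoc _ (powDeriv F X (n + 1)) F, ← ih, Finset.sum_mul]
    rw [add_comm (_ • (_ * _)) (Finset.sum _ _), ← add_assoc, ← Finset.sum_add_distrib]
    congr 1
    · refine Finset.sum_congr rfl fun p _ => ?_
      rw [mul_assoc, smul_mul_assoc (_ : ℂ) ((rightAd F)^[p.2] X), iterate_rightAd_mul, smul_add,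
        mul_add, mul_smul_comm _ F, add_comm]
      congr 1
      rw [← mul_smul_comm, smul_smul, mul_comm (_ : ℂ) ((_ : ℂ)⁻¹), inv_factorial_succ]
    · simp

variable [CompleteSpace A]

lemma exp_mul_tsum_ad (F X : A) :
    NormedSpace.exp F * ∑' k, (k ! : ℂ)⁻¹ • (rightAd F)^[k] X = X * NormedSpace.exp F := by
  rw [NormedSpace.exp_eq_tsum ℂ]
  simp only
  rw [tsum_mul_tsum_eq_tsum_sum_antidiagonal_of_summable_norm
    (NormedSpace.norm_expSeries_summable' F)
    (summable_norm_adSeries F X _ fun k => (norm_inv_factorial k).le),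
    ← (NormedSpace.expSeries_summable' (𝕂 := ℂ) F).tsum_mul_left]
  refine tsum_congr fun n => ?_
  rw [sum_antidiagonal_exp_ad, mul_smul_comm]

/-- Duhamel's formula for the differential of `exp` at `F`, with the exponential factored out on the
left so that multiplication by `Φ⁻¹` removes it. -/
lemma hasSum_powDeriv (F X : A) :
    HasSum (fun n => (n ! : ℂ)⁻¹ • powDeriv F X n)
      (NormedSpace.exp F * ∑' k, ((k + 1) ! : ℂ)⁻¹ • (rightAd F)^[k] X) := by
  have h1 := NormedSpace.norm_expSeries_summable' (𝕂 := ℂ) F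
  have h2 := summable_norm_adSeries F X _ fun k => norm_inv_factorial_succ_le k
  have h3 := (summable_norm_sum_mul_antidiagonal_of_summable_norm h1 h2).of_norm.hasSum
  rw [← tsum_mul_tsum_eq_tsum_sum_antidiagonal_of_summable_norm h1 h2] at h3
  simp only [sum_antidiagonal_exp_ad_succ] at h3
  rw [← hasSum_nat_add_iff' 1, NormedSpace.exp_eq_tsum ℂ]
  simpa [powDeriv] using h3

end BanachAlgebra


/-! ### Series of families -/


variable {η σ m : ℝ} {φ : ℕ+ → ℂ}

lemma summable_pairs_of_decayNorm (hσ : 0 < σ) (hm : m ≤ 0) {R : ℕ → TimeOp}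
    (hR : ∑' k, decayNorm η σ m (R k) ≠ ∞) (hφ : φ ∈ thickTorus η σ) :
    Summable fun x : ℕ × Idx => expDot x.2 φ • R x.1 x.2 := by
  have h : ∑' x : ℕ × Idx, ‖expDot x.2 φ • R x.1 x.2‖ₑ ≠ ∞ := by
    rw [ENNReal.tsum_prod (f := fun k l => ‖expDot l φ • R k l‖ₑ)]
    refine ne_top_of_le_ne_top (ENNReal.mul_ne_top (schurConst_ne_top hσ) hR) ?_
    rw [← ENNReal.tsum_mul_left]
    exact ENNReal.tsum_le_tsum fun k => tsum_enorm_le_decayNorm hσ hm hφ (R k)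
  have := ENNReal.summable_toReal h
  exact Summable.of_norm (by simpa using this)

lemma summable_coeff_of_decayNorm (hσ : 0 < σ) (hm : m ≤ 0) {R : ℕ → TimeOp}
    (hR : ∑' k, decayNorm η σ m (R k) ≠ ∞) (l : Idx) : Summable fun k => R k l := by
  have h := summable_pairs_of_decayNorm hσ hm hR
    (φ := 0) (fun j => by simp only [Pi.zero_apply, Complex.zero_im, abs_zero]; positivity)
  simp only [expDot_angle_zero, one_smul] at h
  exact h.comp_injective (i := fun k => (k, l)) fun a b hab => (Prod.ext_iff.1 hab).1

/-- Fubini for the absolutely convergent double series over `k` and `ℓ`. -/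
lemma hasSum_evalAt_timeSum (hσ : 0 < σ) (hm : m ≤ 0) {R : ℕ → TimeOp}
    (hR : ∑' k, decayNorm η σ m (R k) ≠ ∞) (hφ : φ ∈ thickTorus η σ) :
    HasSum (fun k => evalAt (R k) φ) (evalAt (timeSum R) φ) := by
  have h := summable_pairs_of_decayNorm hσ hm hR hφ
  have h1 : ∀ k, EvSum φ (R k) := fun k =>
    evSum_of_decayNorm hσ hm (ENNReal.ne_top_of_tsum_ne_top hR k) hφ
  have h2 := h.hasSum.prod_fiberwise fun k => (h1 k).hasSum
  convert h2 using 1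
  have h3 : Summable (Function.uncurry fun (k : ℕ) (l : Idx) => expDot l φ • R k l) := h
  rw [h.tsum_prod, ← h3.tsum_comm, evalAt]
  refine tsum_congr fun l => ?_
  rw [timeSum, tsum_const_smul'']

lemma timeSum_sub (hσ : 0 < σ) (hm : m ≤ 0) {R S : ℕ → TimeOp}
    (hR : ∑' k, decayNorm η σ m (R k) ≠ ∞) (hS : ∑' k, decayNorm η σ m (S k) ≠ ∞) :
    timeSum R - timeSum S = timeSum fun k => R k - S k := by
  funext l
  exact ((summable_coeff_of_decayNorm hσ hm hR l).tsum_sub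
    (summable_coeff_of_decayNorm hσ hm hS l)).symm

lemma omegaDeriv_timeSum (ω : Freq) (R : ℕ → TimeOp) :
    omegaDeriv ω (timeSum R) = timeSum fun k => omegaDeriv ω (R k) := by
  funext l
  simp only [omegaDeriv, timeSum, tsum_const_smul'']

lemma omegaDeriv_smul (ω : Freq) (c : ℂ) (R : TimeOp) :
    omegaDeriv ω (c • R) = c • omegaDeriv ω R := by
  funext l
  simp only [omegaDeriv, Pi.smul_apply, smul_comm c]

/-! ### The exponential of a family -/

/-- The constant family `1`. -/
def timeOne : TimeOp := fun l => if l = 0 then 1 else 0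

lemma decayNorm_ite_zero (R : Op) :
    decayNorm η σ m (fun l => if l = 0 then R else 0) = bNorm σ m R := by
  rw [decayNorm, tsum_eq_single 0]
  · simp [Idx.wt_zero]
  · intro l hl
    simp [hl, bNorm_zero]

lemma hasSum_ite_zero (R : Op) :
    HasSum (fun l : Idx => expDot l φ • (if l = 0 then R else 0)) R := by
  convert hasSum_single (f := fun l : Idx => expDot l φ • (if l = 0 then R else 0)) 0 ?_ using 1
  · simp [expDot_zero]
  · intro l hl
    simp [hl]

lemma evalAt_ite_zero (R : Op) : evalAt (fun l => if l = 0 then R else 0) φ = R :=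
  (hasSum_ite_zero R).tsum_eq

lemma evSum_ite_zero (R : Op) : EvSum φ (fun l => if l = 0 then R else 0) := by
  refine summable_of_ne_finset_zero (s := {0}) fun l hl => ?_
  simp [Finset.mem_singleton.not.1 hl]

/-- Powers with respect to convolution. -/
def timePow (F : TimeOp) : ℕ → TimeOp
  | 0 => timeOne
  | k + 1 => conv (timePow F k) F

/-- The Fourier coefficients of `exp (F(φ))`. -/
def timeExp (F : TimeOp) : TimeOp := timeSum fun k => (k.factorial : ℂ)⁻¹ • timePow F k

lemma decayNorm_conv_left_le (hσ : 0 ≤ σ) (R S : TimeOp) :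
    decayNorm η σ m (conv R S) ≤ decayNorm η σ 0 R * decayNorm η σ m S := by
  have h := decayNorm_conv_le (η := η) (m' := m) hσ le_rfl jap_zero_le R S
  simpa using h

/-- The factor `2` bounds the Hilbert–Schmidt norms of the identity blocks; it appears once and does
not grow with `k`. -/
lemma decayNorm_timePow_le (hσ : 0 ≤ σ) (F : TimeOp) (k : ℕ) :
    decayNorm η σ 0 (timePow F k) ≤ 2 * decayNorm η σ 0 F ^ k := by
  induction k with
  | zero =>
    rw [pow_zero, mul_one]
    exact (decayNorm_ite_zero 1).trans_le (bNorm_one_le σ)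
  | succ k ih =>
    rw [pow_succ, ← mul_assoc]
    exact (decayNorm_conv_left_le hσ _ _).trans (by gcongr)

lemma tsum_decayNorm_timeExp_ne_top (hσ : 0 ≤ σ) {F : TimeOp} (hF : decayNorm η σ 0 F ≠ ∞) :
    ∑' k, decayNorm η σ 0 ((k.factorial : ℂ)⁻¹ • timePow F k) ≠ ∞ := by
  have h := ((Real.summable_pow_div_factorial (decayNorm η σ 0 F).toReal).mul_left
    2).tsum_ofReal_ne_top
  refine ne_top_of_le_ne_top h (ENNReal.tsum_le_tsum fun k => ?_)
  refine (decayNorm_smul_le _ _).trans ?_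
  have h1 : ‖(k.factorial : ℂ)⁻¹‖ₑ = ENNReal.ofReal (k.factorial : ℝ)⁻¹ := by
    rw [← ofReal_norm, norm_inv_factorial]
  have h2 : decayNorm η σ 0 F = ENNReal.ofReal (decayNorm η σ 0 F).toReal :=
    (ENNReal.ofReal_toReal hF).symm
  calc _ ≤ ‖(k.factorial : ℂ)⁻¹‖ₑ * (2 * decayNorm η σ 0 F ^ k) := by
        gcongr; exact decayNorm_timePow_le hσ F k
    _ = ENNReal.ofReal (2 * ((decayNorm η σ 0 F).toReal ^ k / k.factorial)) := by
        rw [h1, ENNReal.ofReal_mul (by norm_num), div_eq_mul_inv, ENNReal.ofReal_mul (by positivity),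
          ENNReal.ofReal_pow ENNReal.toReal_nonneg, ← h2, ENNReal.ofReal_ofNat]
        ring

lemma memH_timeExp (hσ : 0 ≤ σ) {F : TimeOp} (hF : MemH η σ 0 F) : MemH η σ 0 (timeExp F) :=
  (decayNorm_timeSum_le _).trans_lt (tsum_decayNorm_timeExp_ne_top hσ hF.ne).lt_top

lemma evSum_timePow {F : TimeOp} (hF : EvSum φ F) (k : ℕ) : EvSum φ (timePow F k) := by
  induction k with
  | zero => exact evSum_ite_zero 1
  | succ k ih => exact ih.conv hF

lemma evalAt_timePow {F : TimeOp} (hF : EvSum φ F) (k : ℕ) :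
    evalAt (timePow F k) φ = evalAt F φ ^ k := by
  induction k with
  | zero => exact evalAt_ite_zero 1
  | succ k ih => rw [timePow, evalAt_conv (evSum_timePow hF k) hF, ih, pow_succ]

lemma evalAt_timeExp (hσ : 0 < σ) {F : TimeOp} (hF : decayNorm η σ 0 F ≠ ∞)
    (hφ : φ ∈ thickTorus η σ) : evalAt (timeExp F) φ = NormedSpace.exp (evalAt F φ) := by
  have h := hasSum_evalAt_timeSum hσ le_rfl (tsum_decayNorm_timeExp_ne_top hσ.le hF) hφ
  simp only [evalAt_smul, evalAt_timePow (evSum_of_decayNorm hσ le_rfl hF hφ)] at h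
  exact h.unique (NormedSpace.exp_series_hasSum_exp' (𝕂 := ℂ) (evalAt F φ))

lemma omegaDeriv_timeOne (ω : Freq) : omegaDeriv ω timeOne = 0 := by
  funext l
  by_cases h : l = 0
  · simp [omegaDeriv, h, freqDot_zero]
  · simp [omegaDeriv, timeOne, h]

lemma evalAt_zero : evalAt 0 φ = 0 := by simp [evalAt]

lemma evSum_zero : EvSum φ 0 := by simp [EvSum, summable_zero]

lemma evSum_omegaDeriv_timePow (ω : Freq) {F : TimeOp} (hF : EvSum φ F)
    (hd : EvSum φ (omegaDeriv ω F)) (k : ℕ) : EvSum φ (omegaDeriv ω (timePow F k)) := by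
  induction k with
  | zero => rw [timePow, omegaDeriv_timeOne]; exact evSum_zero
  | succ k ih =>
    rw [timePow, omegaDeriv_conv ω (evSum_timePow hF k) hF ih hd]
    exact (ih.conv hF).add ((evSum_timePow hF k).conv hd)

lemma evalAt_omegaDeriv_timePow (ω : Freq) {F : TimeOp} (hF : EvSum φ F)
    (hd : EvSum φ (omegaDeriv ω F)) (k : ℕ) :
    evalAt (omegaDeriv ω (timePow F k)) φ =
      powDeriv (evalAt F φ) (evalAt (omegaDeriv ω F) φ) k := by
  induction k with
  | zero => rw [timePow, omegaDeriv_timeOne, evalAt_zero]; rfl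
  | succ k ih =>
    have h1 := evSum_timePow hF k
    have h2 := evSum_omegaDeriv_timePow ω hF hd k
    rw [timePow, omegaDeriv_conv ω h1 hF h2 hd, evalAt_add (h2.conv hF) (h1.conv hd),
      evalAt_conv h2 hF, evalAt_conv h1 hd, ih, evalAt_timePow hF, powDeriv]

/-- The series is differentiated termwise, the extra width `ρ` paying for the derivative. Since `F`
need not commute with `ω·∂F`, the terms are `powDeriv` and not `F^{k-1} ω·∂F / (k-1)!`. -/
lemma hasSum_omegaDeriv_timeExp (hη : 0 < η) (hσ : 0 < σ) {ρ : ℝ} (hρ : 0 < ρ) (ω : Freq)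
    {F : TimeOp} (hF : decayNorm η (σ + ρ) 0 F ≠ ∞) (hφ : φ ∈ thickTorus η σ) :
    HasSum (fun k => (k.factorial : ℂ)⁻¹ • powDeriv (evalAt F φ) (evalAt (omegaDeriv ω F) φ) k)
      (evalAt (omegaDeriv ω (timeExp F)) φ) := by
  have h0 : decayNorm η σ 0 F ≠ ∞ :=
    ne_top_of_le_ne_top hF (decayNorm_mono (by linarith) le_rfl F)
  have hF1 : EvSum φ F := evSum_of_decayNorm hσ le_rfl h0 hφ
  have hd : EvSum φ (omegaDeriv ω F) := evSum_of_decayNorm hσ le_rfl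
    (ne_top_of_le_ne_top (ENNReal.mul_ne_top ENNReal.ofReal_ne_top hF)
      (decayNorm_omegaDeriv_le hη hρ ω F)) hφ
  have hs : ∑' k, decayNorm η σ 0 (omegaDeriv ω ((k.factorial : ℂ)⁻¹ • timePow F k)) ≠ ∞ := by
    refine ne_top_of_le_ne_top (ENNReal.mul_ne_top (ENNReal.ofReal_ne_top (r := ‖ω‖ / ρ))
      (tsum_decayNorm_timeExp_ne_top (by linarith) hF)) ?_
    rw [← ENNReal.tsum_mul_left]
    exact ENNReal.tsum_le_tsum fun k => decayNorm_omegaDeriv_le hη hρ ω _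
  have h := hasSum_evalAt_timeSum hσ le_rfl hs hφ
  simpa only [omegaDeriv_smul, evalAt_smul, evalAt_omegaDeriv_timePow ω hF1 hd, timeExp,
    omegaDeriv_timeSum] using h

/-! ### Iterated commutators -/

/-- Iterated commutators `X ↦ X F - F X`. -/
def timeAd (F X : TimeOp) : ℕ → TimeOp
  | 0 => X
  | k + 1 => conv (timeAd F X k) F - conv F (timeAd F X k)

/-- `∑_k c_k ad_F^{k+1} X`. -/
def adSum (c : ℕ → ℂ) (F X : TimeOp) : TimeOp := timeSum fun k => c k • timeAd F X (k + 1)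

lemma evSum_timeAd {F X : TimeOp} (hF : EvSum φ F) (hX : EvSum φ X) (k : ℕ) :
    EvSum φ (timeAd F X k) := by
  induction k with
  | zero => exact hX
  | succ k ih => exact (ih.conv hF).sub (hF.conv ih)

lemma evalAt_timeAd {F X : TimeOp} (hF : EvSum φ F) (hX : EvSum φ X) (k : ℕ) :
    evalAt (timeAd F X k) φ = (rightAd (evalAt F φ))^[k] (evalAt X φ) := by
  induction k with
  | zero => rfl
  | succ k ih =>
    have h := evSum_timeAd hF hX k
    rw [Function.iterate_succ_apply', timeAd, evalAt_sub (h.conv hF) (hF.conv h), evalAt_conv h hF,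
      evalAt_conv hF h, ih, rightAd]

lemma one_le_shiftConst {ρ : ℝ} (hρ : 0 < ρ) : 1 ≤ shiftConst ρ := by
  simpa using one_add_sq_le_shiftConst hρ le_rfl

/-- Only in `X F` does the order of `X` have to cross `F`, and it is `F` that gives up the decay
`ρ`. The width of `X` is unchanged, so the commutator can be iterated without loss. -/
lemma decayNorm_ad_le {ρ c : ℝ} (hσ : 0 ≤ σ) (hρ : 0 ≤ ρ) (hc1 : 1 ≤ c)
    (hc : ∀ i j' : ℕ, jap i ^ m * jap j' ^ (-m) ≤ c * Real.exp (ρ * |(i : ℝ) - j'|))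
    (F X : TimeOp) : decayNorm η σ m (conv X F - conv F X) ≤
      ENNReal.ofReal (2 * c) * decayNorm η (σ + ρ) 0 F * decayNorm η σ m X := by
  have h1 := decayNorm_conv_le (η := η) (m' := 0) hσ hρ hc X F
  rw [add_zero] at h1
  have h2 := decayNorm_conv_left_le (η := η) (m := m) hσ F X
  have h3 : decayNorm η σ 0 F ≤ decayNorm η (σ + ρ) 0 F :=
    decayNorm_mono (by linarith) le_rfl F
  have h4 : (1 : ℝ≥0∞) ≤ ENNReal.ofReal c := ENNReal.one_le_ofReal.2 hc1
  calc decayNorm η σ m (conv X F - conv F X)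
      ≤ ENNReal.ofReal c * decayNorm η σ m X * decayNorm η (σ + ρ) 0 F +
          ENNReal.ofReal c * (decayNorm η (σ + ρ) 0 F * decayNorm η σ m X) := by
        refine (decayNorm_sub_le _ _).trans (add_le_add h1 (h2.trans ?_))
        rw [← one_mul (decayNorm η σ 0 F * _)]
        gcongr
    _ = _ := by
        rw [ENNReal.ofReal_mul (by norm_num), ENNReal.ofReal_ofNat]; ring

lemma decayNorm_timeAd_le {ρ c : ℝ} (hσ : 0 ≤ σ) (hρ : 0 ≤ ρ) (hc1 : 1 ≤ c)
    (hc : ∀ i j' : ℕ, jap i ^ m * jap j' ^ (-m) ≤ c * Real.exp (ρ * |(i : ℝ) - j'|))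
    {F : TimeOp} {q : ℝ≥0∞} (hq : ENNReal.ofReal (2 * c) * decayNorm η (σ + ρ) 0 F ≤ q)
    (X : TimeOp) (k : ℕ) :
    decayNorm η σ m (timeAd F X k) ≤ q ^ k * decayNorm η σ m X := by
  induction k with
  | zero => simp [timeAd]
  | succ k ih =>
    refine (decayNorm_ad_le hσ hρ hc1 hc F _).trans ?_
    rw [pow_succ', mul_assoc q]
    exact mul_le_mul' hq ih

/-- Dependence of iterated commutators on `F` and `X`. Increments of `F` have order `2`, those of `X`
order `0`, while `X` itself has order `-2`. -/
lemma decayNorm_timeAd_sub_le {ρ : ℝ} (hσ : 0 ≤ σ) (hρ : 0 < ρ) {F₁ F₂ X₁ X₂ : TimeOp}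
    {q x v : ℝ≥0∞}
    (hF₁ : ENNReal.ofReal (2 * shiftConst ρ) * decayNorm η (σ + ρ + ρ) 0 F₁ ≤ q)
    (hF₂ : ENNReal.ofReal (2 * shiftConst ρ) * decayNorm η (σ + ρ + ρ) 0 F₂ ≤ q)
    (hF : ENNReal.ofReal (2 * shiftConst ρ) * decayNorm η (σ + ρ + ρ) 2 (F₁ - F₂) ≤ q * v)
    (hX₂ : decayNorm η (σ + ρ) (-2) X₂ ≤ x) (hX : decayNorm η σ 0 (X₁ - X₂) ≤ x * v)
    (eF₁ : EvSum φ F₁) (eF₂ : EvSum φ F₂) (eX₁ : EvSum φ X₁) (eX₂ : EvSum φ X₂) (k : ℕ) :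
    decayNorm η σ 0 (timeAd F₁ X₁ k - timeAd F₂ X₂ k) ≤ (k + 1) * q ^ k * (x * v) := by
  have hc1 := one_le_shiftConst hρ
  induction k with
  | zero => simpa [timeAd] using hX
  | succ k ih =>
    have e₁ := evSum_timeAd eF₁ eX₁ k
    have e₂ := evSum_timeAd eF₂ eX₂ k
    set Y₁ := timeAd F₁ X₁ k
    set Y₂ := timeAd F₂ X₂ k with hY₂
    -- The telescoping is arranged so that the increment of the commutators, of order `0`, meets
    -- `F₁` of order `0`, while the increment of `F`, of order `2`, meets `Y₂` of order `-2`.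
    have hsplit : timeAd F₁ X₁ (k + 1) - timeAd F₂ X₂ (k + 1) =
        (conv (Y₁ - Y₂) F₁ - conv F₁ (Y₁ - Y₂)) + (conv Y₂ (F₁ - F₂) - conv (F₁ - F₂) Y₂) := by
      rw [conv_sub_left e₁ e₂ eF₁, conv_sub_right eF₁ e₁ e₂, conv_sub_right e₂ eF₁ eF₂,
        conv_sub_left eF₁ eF₂ e₂]
      simp only [timeAd]
      abel
    have h1 : decayNorm η σ 0 (conv (Y₁ - Y₂) F₁ - conv F₁ (Y₁ - Y₂)) ≤
        q * decayNorm η σ 0 (Y₁ - Y₂) := by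
      refine (decayNorm_ad_le hσ hρ.le hc1 (fun i j' => ?_) F₁ _).trans (mul_le_mul' (hF₁.trans' ?_)
        le_rfl)
      · refine (jap_zero_le i j').trans (mul_le_mul hc1 ?_ (Real.exp_pos _).le (by linarith))
        exact Real.exp_le_exp.2 (mul_le_mul_of_nonneg_right hρ.le (abs_nonneg _))
      · exact mul_le_mul' le_rfl (decayNorm_mono (by linarith) le_rfl F₁)
    -- `Y₂` is controlled on the wider strip because one of its two products with `F₁ - F₂` gives up
    -- another `ρ`. This is why `F` is measured at `σ + ρ + ρ`.
    have hY : decayNorm η (σ + ρ) (-2) Y₂ ≤ q ^ k * x :=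
      (decayNorm_timeAd_le (by linarith) hρ.le hc1 (jap_neg_two_le hρ) hF₂ X₂ k).trans
        (mul_le_mul' le_rfl hX₂)
    have h2 : decayNorm η σ 0 (conv Y₂ (F₁ - F₂) - conv (F₁ - F₂) Y₂) ≤ q * v * (q ^ k * x) := by
      have a1 := decayNorm_conv_le (η := η) (m := -2) (m' := 2) hσ hρ.le (jap_neg_two_le hρ)
        Y₂ (F₁ - F₂)
      have a2 := decayNorm_conv_le (η := η) (m := 2) (m' := -2) hσ hρ.le (jap_two_le hρ)
        (F₁ - F₂) Y₂
      rw [neg_add_cancel] at a1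
      rw [add_neg_cancel] at a2
      have b1 : decayNorm η σ (-2) Y₂ ≤ decayNorm η (σ + ρ) (-2) Y₂ :=
        decayNorm_mono (by linarith) le_rfl _
      have b2 : decayNorm η σ 2 (F₁ - F₂) ≤ decayNorm η (σ + ρ + ρ) 2 (F₁ - F₂) :=
        decayNorm_mono (by linarith) le_rfl _
      have b3 : decayNorm η (σ + ρ) 2 (F₁ - F₂) ≤ decayNorm η (σ + ρ + ρ) 2 (F₁ - F₂) :=
        decayNorm_mono (by linarith) le_rfl _
      calc _ ≤ ENNReal.ofReal (shiftConst ρ) * decayNorm η (σ + ρ) (-2) Y₂ *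
              decayNorm η (σ + ρ + ρ) 2 (F₁ - F₂) + ENNReal.ofReal (shiftConst ρ) *
              decayNorm η (σ + ρ + ρ) 2 (F₁ - F₂) * decayNorm η (σ + ρ) (-2) Y₂ := by
            refine (decayNorm_sub_le _ _).trans (add_le_add (a1.trans ?_) (a2.trans ?_)) <;> gcongr
        _ = ENNReal.ofReal (2 * shiftConst ρ) * decayNorm η (σ + ρ + ρ) 2 (F₁ - F₂) *
              decayNorm η (σ + ρ) (-2) Y₂ := by
            rw [ENNReal.ofReal_mul (by norm_num), ENNReal.ofReal_ofNat]; ring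
        _ ≤ _ := mul_le_mul' hF hY
    rw [hsplit]
    calc _ ≤ q * ((k + 1) * q ^ k * (x * v)) + q * v * (q ^ k * x) :=
          (decayNorm_add_le _ _).trans (add_le_add (h1.trans (mul_le_mul' le_rfl ih)) h2)
      _ = _ := by push_cast; ring

lemma pow_succ_le_of_le_half {q : ℝ≥0∞} (hq : q ≤ 2⁻¹) (k : ℕ) : q ^ (k + 1) ≤ q * 2⁻¹ ^ k := by
  rw [pow_succ']; gcongr

/-- For `q ≤ 1/2` the series is dominated by a geometric one whose first term is proportional to
`q`. Of the hypothesis on `a` only `|a_k| ≤ 1` is needed here; the increments below use all of it,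
to absorb the factor `k + 2` of the Leibniz rule. -/
lemma tsum_decayNorm_adSum_le {ρ c : ℝ} (hσ : 0 ≤ σ) (hρ : 0 ≤ ρ) (hc1 : 1 ≤ c)
    (hc : ∀ i j' : ℕ, jap i ^ m * jap j' ^ (-m) ≤ c * Real.exp (ρ * |(i : ℝ) - j'|))
    {F : TimeOp} {q : ℝ≥0∞} (hq : ENNReal.ofReal (2 * c) * decayNorm η (σ + ρ) 0 F ≤ q)
    (hq2 : q ≤ 2⁻¹) {a : ℕ → ℂ} (ha : ∀ k, ‖a k‖ₑ * (k + 2) ≤ 2) (X : TimeOp) :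
    ∑' k, decayNorm η σ m (a k • timeAd F X (k + 1)) ≤ 2 * q * decayNorm η σ m X := by
  have ha' : ∀ k, ‖a k‖ₑ ≤ 1 := fun k => by
    have h := ha k
    have h2 : ‖a k‖ₑ * 2 ≤ 1 * 2 := by
      rw [one_mul]
      exact le_trans (mul_le_mul' le_rfl le_add_self) h
    exact (ENNReal.mul_le_mul_iff_left (by simp) (by simp)).1 h2
  calc _ ≤ ∑' k : ℕ, q * decayNorm η σ m X * 2⁻¹ ^ k := by
        refine ENNReal.tsum_le_tsum fun k => (decayNorm_smul_le _ _).trans ?_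
        refine (mul_le_mul' (ha' k) (decayNorm_timeAd_le hσ hρ hc1 hc hq X (k + 1))).trans ?_
        rw [one_mul, mul_right_comm]
        gcongr
        exact pow_succ_le_of_le_half hq2 k
    _ = _ := by
        rw [ENNReal.tsum_mul_left, ENNReal.tsum_geometric_two]; ring

lemma decayNorm_adSum_sub_le {ρ : ℝ} (hσ : 0 < σ) (hρ : 0 < ρ) {F₁ F₂ X₁ X₂ : TimeOp}
    {q x v : ℝ≥0∞} (hq2 : q ≤ 2⁻¹) (hx : x ≠ ∞)
    (hF₁ : ENNReal.ofReal (2 * shiftConst ρ) * decayNorm η (σ + ρ + ρ) 0 F₁ ≤ q)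
    (hF₂ : ENNReal.ofReal (2 * shiftConst ρ) * decayNorm η (σ + ρ + ρ) 0 F₂ ≤ q)
    (hF : ENNReal.ofReal (2 * shiftConst ρ) * decayNorm η (σ + ρ + ρ) 2 (F₁ - F₂) ≤ q * v)
    (hX₁ : decayNorm η (σ + ρ) (-2) X₁ ≤ x)
    (hX₂ : decayNorm η (σ + ρ) (-2) X₂ ≤ x) (hX : decayNorm η σ 0 (X₁ - X₂) ≤ x * v)
    (eF₁ : EvSum φ F₁) (eF₂ : EvSum φ F₂) (eX₁ : EvSum φ X₁) (eX₂ : EvSum φ X₂)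
    {a : ℕ → ℂ} (ha : ∀ k, ‖a k‖ₑ * (k + 2) ≤ 2) :
    decayNorm η σ 0 (adSum a F₁ X₁ - adSum a F₂ X₂) ≤ 4 * q * (x * v) := by
  have hc1 := one_le_shiftConst hρ
  have hqt : q ≠ ∞ := ne_top_of_le_ne_top (by simp) hq2
  have hfin : ∀ {F X : TimeOp},
      ENNReal.ofReal (2 * shiftConst ρ) * decayNorm η (σ + ρ + ρ) 0 F ≤ q →
      decayNorm η (σ + ρ) (-2) X ≤ x →
      ∑' k, decayNorm η (σ + ρ) (-2) (a k • timeAd F X (k + 1)) ≠ ∞ := by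
    intro F X hF hX
    refine ne_top_of_le_ne_top ?_ (tsum_decayNorm_adSum_le (by linarith) hρ.le hc1
      (jap_neg_two_le hρ) hF hq2 ha X)
    exact ENNReal.mul_ne_top (ENNReal.mul_ne_top (by simp) hqt) (ne_top_of_le_ne_top hx hX)
  rw [adSum, adSum, timeSum_sub (by linarith) (by norm_num) (hfin hF₁ hX₁) (hfin hF₂ hX₂)]
  refine (decayNorm_timeSum_le _).trans ?_
  calc _ ≤ ∑' k : ℕ, 2 * q * (x * v) * 2⁻¹ ^ k := by
        refine ENNReal.tsum_le_tsum fun k => ?_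
        rw [← smul_sub]
        refine (decayNorm_smul_le _ _).trans ?_
        refine (mul_le_mul' le_rfl (decayNorm_timeAd_sub_le hσ.le hρ hF₁ hF₂ hF hX₂ hX eF₁ eF₂ eX₁
          eX₂ (k + 1))).trans ?_
        calc _ = (‖a k‖ₑ * (k + 2)) * q ^ (k + 1) * (x * v) := by push_cast; ring
          _ ≤ 2 * (q * 2⁻¹ ^ k) * (x * v) := by
              gcongr
              · exact ha k
              · exact pow_succ_le_of_le_half hq2 k
          _ = _ := by ring
    _ = _ := by
        rw [ENNReal.tsum_mul_left, ENNReal.tsum_geometric_two]; ring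


/-! ### Uniqueness of Fourier coefficients -/

section Uniqueness

open Filter Topology MeasureTheory

lemma norm_integral_exp_le (θ : ℝ) (T : ℝ) (hT : 0 ≤ T) :
    ‖∫ t in (0 : ℝ)..T, Complex.exp (Complex.I * θ * t)‖ ≤ T := by
  have h := intervalIntegral.norm_integral_le_of_norm_le_const (a := 0) (b := T) (C := 1)
    (f := fun t : ℝ => Complex.exp (Complex.I * θ * t)) (fun t _ => by
      rw [Complex.norm_exp]; simp)
  simpa [abs_of_nonneg hT] using h

lemma norm_integral_exp_le_div {θ : ℝ} (hθ : θ ≠ 0) (T : ℝ) :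
    ‖∫ t in (0 : ℝ)..T, Complex.exp (Complex.I * θ * t)‖ ≤ 2 / |θ| := by
  have hc : Complex.I * (θ : ℂ) ≠ 0 := mul_ne_zero Complex.I_ne_zero (by exact_mod_cast hθ)
  rw [integral_exp_mul_complex hc, norm_div]
  have h1 : ‖Complex.I * (θ : ℂ)‖ = |θ| := by simp
  rw [h1]
  gcongr
  refine (norm_sub_le _ _).trans ?_
  rw [Complex.norm_exp, Complex.norm_exp]
  simp
  norm_num

lemma tendsto_mean_exp (θ : ℝ) :
    Tendsto (fun T : ℝ => ((T : ℂ)⁻¹ * ∫ t in (0 : ℝ)..T, Complex.exp (Complex.I * θ * t))) atTop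
      (𝓝 (if θ = 0 then 1 else 0)) := by
  split_ifs with h
  · refine tendsto_const_nhds.congr' ?_
    filter_upwards [eventually_gt_atTop 0] with T hT
    have : (T : ℂ) ≠ 0 := by exact_mod_cast hT.ne'
    simp [h, this]
  · refine squeeze_zero_norm' (a := fun T => 2 / |θ| * T⁻¹) ?_ ?_
    · filter_upwards [eventually_gt_atTop 0] with T hT
      rw [norm_mul, norm_inv, Complex.norm_real, Real.norm_of_nonneg hT.le, mul_comm]
      gcongr
      exact norm_integral_exp_le_div h T
    · simpa using tendsto_inv_atTop_zero.const_mul (2 / |θ|)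

/-- An absolutely convergent almost periodic series that vanishes identically has zero
coefficients. -/
lemma eq_zero_of_tsum_exp_eq_zero {ι E : Type*} [Countable ι] [NormedAddCommGroup E]
    [NormedSpace ℂ E] [CompleteSpace E] {g : ι → E} (hg : Summable fun l => ‖g l‖) {θ : ι → ℝ}
    (hθ : Function.Injective θ)
    (h : ∀ t : ℝ, ∑' l, Complex.exp (Complex.I * θ l * t) • g l = 0) (a : ι) : g a = 0 := by
  classical
  have hnorm : ∀ (x t : ℝ), ‖Complex.exp (Complex.I * x * t)‖ = 1 := fun x t => by
    rw [Complex.norm_exp]; simp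
  -- Multiplication by `e^{-iθ_a t}` moves the frequency of index `a` to zero; the series is then
  -- integrated termwise over `[0, T]`.
  have h1 : ∀ T : ℝ, HasSum (fun l => (∫ t in (0 : ℝ)..T,
      Complex.exp (Complex.I * (θ l - θ a : ℝ) * t)) • g l) 0 := by
    intro T
    have h2 := intervalIntegral.hasSum_integral_of_dominated_convergence (a := 0) (b := T)
      (μ := volume) (F := fun l t => Complex.exp (Complex.I * (θ l - θ a : ℝ) * t) • g l)
      (f := fun _ => 0) (fun l _ => ‖g l‖) (fun l => ?_) (fun l => ?_) ?_ ?_ ?_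
    · simpa only [intervalIntegral.integral_smul_const, intervalIntegral.integral_zero] using h2
    · exact (Continuous.aestronglyMeasurable (by fun_prop))
    · exact Eventually.of_forall fun t _ => by rw [norm_smul, hnorm, one_mul]
    · exact Eventually.of_forall fun t _ => hg
    · exact intervalIntegrable_const
    · refine Eventually.of_forall fun t _ => ?_
      have h3 : Summable fun l => Complex.exp (Complex.I * θ l * t) • g l :=
        Summable.of_norm (by simpa only [norm_smul, hnorm, one_mul] using hg)
      have h4 := h3.hasSum.const_smul (Complex.exp (-(Complex.I * θ a * t)))
      rw [h t, smul_zero] at h4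
      convert h4 using 2 with l
      rw [smul_smul, ← Complex.exp_add]
      congr 2
      push_cast
      ring
  -- Bohr means: in the limit only the frequency zero survives, and by injectivity of `θ` it belongs
  -- to the index `a` alone.
  have h2 : Tendsto (fun T : ℝ => ∑' l, ((T : ℂ)⁻¹ * ∫ t in (0 : ℝ)..T,
      Complex.exp (Complex.I * (θ l - θ a : ℝ) * t)) • g l) atTop
      (𝓝 (∑' l, (if θ l - θ a = 0 then (1 : ℂ) else 0) • g l)) := by
    refine tendsto_tsum_of_dominated_convergence hg
      (fun l => (tendsto_mean_exp (θ l - θ a)).smul_const (g l)) ?_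
    filter_upwards [eventually_gt_atTop 0] with T hT l
    rw [norm_smul, norm_mul, norm_inv, Complex.norm_real, Real.norm_of_nonneg hT.le]
    refine mul_le_of_le_one_left (norm_nonneg _) ?_
    rw [inv_mul_le_iff₀ hT, mul_one]
    exact norm_integral_exp_le _ T hT.le
  have h3 : ∀ T : ℝ, ∑' l, ((T : ℂ)⁻¹ * ∫ t in (0 : ℝ)..T,
      Complex.exp (Complex.I * (θ l - θ a : ℝ) * t)) • g l = 0 := fun T => by
    have := (h1 T).const_smul (T : ℂ)⁻¹
    simp only [smul_smul, smul_zero] at this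
    exact this.tsum_eq
  simp only [h3] at h2
  have h4 := tendsto_nhds_unique h2 tendsto_const_nhds
  rw [tsum_eq_single a] at h4
  · simpa using h4
  · intro l hl
    rw [if_neg (sub_ne_zero.2 fun h => hl (hθ h)), zero_smul]

end Uniqueness

/-! ### Skew self-adjoint families -/

lemma freqDot_ne_zero {γ : ℝ} (hγ : 0 < γ) {ω : Freq} (hω : ω ∈ diophSet γ) {l : Idx}
    (hl : l ≠ 0) : freqDot ω l ≠ 0 := by
  have h := hω.2 l hl
  have h1 : 0 < l.prod fun j z => (1 + |(z : ℝ)| ^ 2 * ((j : ℕ) : ℝ) ^ 2)⁻¹ :=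
    Finset.prod_pos fun j _ => by positivity
  exact abs_pos.1 (lt_trans (mul_pos hγ h1) h)

/-- The Diophantine inequality is used only through this qualitative consequence; the quantitative
divisors come from the Melnikov sets. -/
lemma freqDot_injective {γ : ℝ} (hγ : 0 < γ) {ω : Freq} (hω : ω ∈ diophSet γ) :
    Function.Injective (freqDot ω) := by
  intro l l' h
  by_contra hne
  refine freqDot_ne_zero hγ hω (sub_ne_zero.2 hne) ?_
  rw [sub_eq_add_neg, freqDot_add, freqDot_neg, h, add_neg_cancel]

variable {R S : TimeOp}

lemma norm_expDot_real (l : Idx) (φ : ℕ+ → ℝ) : ‖expDot l fun j => (φ j : ℂ)‖ = 1 := by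
  rw [expDot, Complex.norm_exp]
  simp [Finsupp.sum]

lemma expDot_neg_real (l : Idx) (φ : ℕ+ → ℝ) :
    expDot (-l) (fun j => (φ j : ℂ)) = star (expDot l fun j => (φ j : ℂ)) := by
  rw [expDot, expDot, Complex.star_def, ← Complex.exp_conj, Finsupp.sum_neg_index (by simp)]
  simp [Finsupp.sum]

lemma EvSum.real (h : EvSum 0 R) (φ : ℕ+ → ℝ) : EvSum (fun j => (φ j : ℂ)) R := by
  simpa only [EvSum, norm_smul, norm_expDot_real, expDot_angle_zero, norm_one] using h

lemma adjoint_evalAt (h : EvSum 0 R) (φ : ℕ+ → ℝ) :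
    HasSum (fun l => expDot l (fun j => (φ j : ℂ)) • ContinuousLinearMap.adjoint (R (-l)))
      (ContinuousLinearMap.adjoint (evalAt R fun j => (φ j : ℂ))) := by
  have h1 := (h.real φ).hasSum.map (ContinuousLinearMap.adjoint (𝕜 := ℂ) (E := L2) (F := L2))
    (LinearIsometryEquiv.continuous _)
  rw [← (Equiv.neg Idx).hasSum_iff] at h1
  refine h1.congr_fun fun l => ?_
  simp only [Function.comp_apply, Equiv.neg_apply]
  rw [map_smulₛₗ, expDot_neg_real]
  simp

lemma skewAdj_of_coeff (h : EvSum 0 R)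
    (hR : ∀ l, ContinuousLinearMap.adjoint (R (-l)) = -R l) : SkewAdj R := by
  intro φ
  have h1 := adjoint_evalAt h φ
  simp only [hR, smul_neg] at h1
  exact h1.unique (h.real φ).hasSum.neg

/-- The average of a skew self-adjoint family along `t ↦ t ω` vanishes coefficientwise. -/
lemma tsum_exp_adjoint_add_eq_zero (ω : Freq) (h : EvSum 0 R) (hR : SkewAdj R) (t : ℝ) :
    ∑' l, Complex.exp (Complex.I * freqDot ω l * t) •
      (ContinuousLinearMap.adjoint (R (-l)) + R l) = 0 := by
  have h3 := (adjoint_evalAt h fun j => t * ω j).add (h.real fun j => t * ω j).hasSum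
  rw [hR fun j => t * ω j, neg_add_cancel] at h3
  have h4 : ∀ l : Idx, expDot l (fun j => ((t * ω j : ℝ) : ℂ)) =
      Complex.exp (Complex.I * freqDot ω l * t) := fun l => by
    rw [expDot, freqDot, Finsupp.sum, Finsupp.sum, mul_assoc]
    push_cast
    rw [Finset.sum_mul]
    congr 2
    exact Finset.sum_congr rfl fun j _ => by ring
  refine (h3.congr_fun fun l => ?_).tsum_eq
  rw [h4, smul_add]

lemma summable_norm_adjoint_add (h : EvSum 0 R) :
    Summable fun l => ‖ContinuousLinearMap.adjoint (R (-l)) + R l‖ := by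
  have hn : Summable fun l => ‖R l‖ := by
    simpa only [EvSum, expDot_angle_zero, one_smul] using h
  have h4 : Summable fun l => ‖R (-l)‖ := (Equiv.neg Idx).summable_iff.2 hn
  refine Summable.of_nonneg_of_le (fun _ => norm_nonneg _) (fun l => ?_) (h4.add hn)
  refine (norm_add_le _ _).trans_eq ?_
  rw [LinearIsometryEquiv.norm_map]

/-- Skew self-adjointness is given angle by angle, whereas the homological equation is solved
coefficient by coefficient. Along the line `t ↦ t ω` the frequencies `ω·ℓ` are distinct, so the
coefficients can be recovered from the values. -/
lemma SkewAdj.coeff {γ : ℝ} (hγ : 0 < γ) {ω : Freq} (hω : ω ∈ diophSet γ) (h : EvSum 0 R)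
    (hR : SkewAdj R) (l : Idx) : ContinuousLinearMap.adjoint (R (-l)) = -R l := by
  have h1 : ContinuousLinearMap.adjoint (R (-l)) + R l = 0 := eq_zero_of_tsum_exp_eq_zero
    (g := fun l => ContinuousLinearMap.adjoint (R (-l)) + R l) (summable_norm_adjoint_add h)
    (freqDot_injective hγ hω) (tsum_exp_adjoint_add_eq_zero ω h hR) l
  exact eq_neg_of_add_eq_zero_left h1

lemma SkewAdj.add (hR : SkewAdj R) (hS : SkewAdj S) (h : EvSum 0 R) (h' : EvSum 0 S) :
    SkewAdj (R + S) := by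
  intro φ
  rw [evalAt_add (h.real φ) (h'.real φ), map_add, hR, hS, neg_add]

lemma SkewAdj.sub (hR : SkewAdj R) (hS : SkewAdj S) (h : EvSum 0 R) (h' : EvSum 0 S) :
    SkewAdj (R - S) := by
  intro φ
  rw [evalAt_sub (h.real φ) (h'.real φ), map_sub, hR, hS, neg_sub]
  abel

lemma adjoint_iterate_rightAd {F X : Op} (hF : ContinuousLinearMap.adjoint F = -F)
    (hX : ContinuousLinearMap.adjoint X = -X) (k : ℕ) :
    ContinuousLinearMap.adjoint ((rightAd F)^[k] X) = -(rightAd F)^[k] X := by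
  induction k with
  | zero => exact hX
  | succ k ih =>
    rw [Function.iterate_succ_apply', rightAd]
    rw [← ContinuousLinearMap.star_eq_adjoint] at hF ih ⊢
    rw [star_sub, star_mul, star_mul, hF, ih]
    simp only [neg_mul_neg, neg_sub]

lemma skewAdj_adSum {η σ m : ℝ} (hσ : 0 < σ) (hm : m ≤ 0) {F X : TimeOp} (hF : SkewAdj F)
    (hX : SkewAdj X) (eF : EvSum 0 F) (eX : EvSum 0 X) (a : ℕ → ℝ)
    (hs : ∑' k, decayNorm η σ m ((a k : ℂ) • timeAd F X (k + 1)) ≠ ∞) :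
    SkewAdj (adSum (fun k => a k) F X) := by
  intro φ
  have h := hasSum_evalAt_timeSum hσ hm hs (real_mem_thickTorus hσ.le φ)
  simp only [evalAt_smul, evalAt_timeAd (eF.real φ) (eX.real φ)] at h
  have h1 := h.map (ContinuousLinearMap.adjoint (𝕜 := ℂ) (E := L2) (F := L2))
    (LinearIsometryEquiv.continuous _)
  refine h1.unique ?_
  refine h.neg.congr_fun fun k => ?_
  simp only [Function.comp_apply]
  rw [map_smulₛₗ, adjoint_iterate_rightAd (hF φ) (hX φ)]
  simp

/-! ### Self-adjointness of the vector fields -/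

lemma mem_blockDiagGraph {D : Blocks} {u w : L2} : (u, w) ∈ blockDiagGraph D ↔
    ∀ (j : ℕ) (k : blockIdx j), coef w k = ∑ k', D j k k' * coef u k' := Iff.rfl

lemma mem_graph_vectorField {D : Blocks} {P : Op} {u v : L2} :
    (u, v) ∈ (vectorField D P).graph ↔
      ∃ w, (u, w) ∈ blockDiagGraph D ∧ v = Complex.I • w + P u := by
  rw [← graph_blockDiagOp]
  simp only [LinearPMap.mem_graph_iff]
  constructor
  · rintro ⟨y, rfl, rfl⟩
    refine ⟨blockDiagOp D ⟨y, y.2⟩, ⟨⟨y, y.2⟩, rfl, rfl⟩, ?_⟩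
    rw [add_comm]; rfl
  · rintro ⟨w, ⟨y, rfl, rfl⟩, rfl⟩
    refine ⟨⟨y, y.2⟩, rfl, ?_⟩
    rw [add_comm]; rfl

lemma hasSum_inner_coef (u v : L2) :
    HasSum (fun k => star (coef u k) * coef v k) (inner ℂ u v) := by
  refine (HilbertBasis.hasSum_inner_mul_inner fourierBasis u v).congr_fun fun k => ?_
  simp only [coef, HilbertBasis.repr_apply_apply]
  rw [← inner_conj_symm u]
  rfl

lemma inner_blockDiag_symm {D : Blocks} (hD : ∀ j, (D j).IsHermitian) {a w y z : L2}
    (ha : (a, w) ∈ blockDiagGraph D) (hy : (y, z) ∈ blockDiagGraph D) :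
    inner ℂ w y = inner ℂ a z := by
  refine (HasSum.blocks (hasSum_inner_coef w y)).unique ?_
  convert HasSum.blocks (hasSum_inner_coef a z) using 2 with j
  calc ∑ k : blockIdx j, star (coef w k) * coef y k
      = ∑ k : blockIdx j, ∑ k' : blockIdx j, star (coef a k') * (D j k' k * coef y k) := by
        refine Finset.sum_congr rfl fun k _ => ?_
        rw [mem_blockDiagGraph.1 ha j k, star_sum, Finset.sum_mul]
        refine Finset.sum_congr rfl fun k' _ => ?_
        rw [star_mul, (hD j).apply]
        ring
    _ = _ := by
        rw [Finset.sum_comm]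
        refine Finset.sum_congr rfl fun k' _ => ?_
        rw [mem_blockDiagGraph.1 hy j k', Finset.mul_sum]

lemma exp_mem_blockDiagGraph (D : Blocks) (j : ℕ) (κ : blockIdx j) :
    ((fourierLp 2 (κ : ℤ) : L2), ∑ k : blockIdx j, D j k κ • (fourierLp 2 (k : ℤ) : L2)) ∈
      blockDiagGraph D := by
  rw [mem_blockDiagGraph]
  intro i k
  have h1 : coef (∑ k : blockIdx j, D j k κ • (fourierLp 2 (k : ℤ) : L2)) k =
      ∑ k' : blockIdx j, D j k' κ * (if (k : ℤ) = k' then 1 else 0) := by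
    rw [← coefL_apply, map_sum]
    refine Finset.sum_congr rfl fun k' _ => ?_
    rw [coefL_apply, coef_smul, coef_fourierLp]
  rw [h1]
  simp only [coef_fourierLp, mul_ite, mul_one, mul_zero]
  by_cases hij : i = j
  · subst hij
    simp only [Subtype.coe_inj]
    simp
  · have hne : ∀ (x : blockIdx i) (y : blockIdx j), (x : ℤ) ≠ y := fun x y h => hij (by
      rw [← mem_blockIdx.1 x.2, ← mem_blockIdx.1 y.2, h])
    simp [hne]

lemma dense_domain_vectorField (D : Blocks) (P : Op) :
    Dense ((vectorField D P).domain : Set L2) := by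
  have h := (fourierBasis : HilbertBasis ℤ ℂ L2).dense_span
  have h1 : Submodule.span ℂ (Set.range (fourierBasis : HilbertBasis ℤ ℂ L2)) ≤
      (vectorField D P).domain := by
    rw [Submodule.span_le]
    rintro _ ⟨k, rfl⟩
    rw [coe_fourierBasis]
    exact LinearPMap.mem_domain_of_mem_graph (mem_graph_vectorField.2
      ⟨_, exp_mem_blockDiagGraph D k.natAbs ⟨k, mem_blockIdx.2 rfl⟩, rfl⟩)
  rw [← Submodule.dense_iff_topologicalClosure_eq_top] at h
  exact h.mono h1

lemma mem_neg_graph {L : L2 →ₗ.[ℂ] L2} {u v : L2} : (u, v) ∈ (-L).graph ↔ (u, -v) ∈ L.graph := by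
  rw [LinearPMap.neg_graph]
  constructor
  · rintro ⟨⟨a, b⟩, hab, h⟩
    simp only [LinearMap.prodMap_apply, LinearMap.id_coe, id_eq, LinearMap.neg_apply,
      Prod.mk.injEq] at h
    obtain ⟨rfl, rfl⟩ := h
    rwa [neg_neg]
  · intro h
    exact ⟨(u, -v), h, by simp⟩

/-- Testing the adjoint relation against exponentials, all of which lie in the domain, yields
exactly the equations defining the maximal domain of `D`. The other inclusion is symmetry, block by
block. -/
lemma adjoint_vectorField {D : Blocks} (hD : ∀ j, (D j).IsHermitian) {P : Op}
    (hP : ContinuousLinearMap.adjoint P = -P) :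
    (vectorField D P).adjoint = -vectorField D P := by
  have hPi : ∀ a y : L2, inner ℂ (P a) y = -inner ℂ a (P y) := fun a y => by
    rw [← ContinuousLinearMap.adjoint_inner_right, hP, neg_apply, inner_neg_right]
  refine LinearPMap.eq_of_eq_graph ?_
  rw [LinearPMap.adjoint_graph_eq_graph_adjoint (dense_domain_vectorField D P)]
  ext ⟨y, z⟩
  rw [Submodule.mem_adjoint_iff, mem_neg_graph, mem_graph_vectorField]
  constructor
  · intro h
    refine ⟨Complex.I • (z + P y), ?_, ?_⟩
    · rw [mem_blockDiagGraph]
      intro j κ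
      have h1 := h _ _ (mem_graph_vectorField.2 ⟨_, exp_mem_blockDiagGraph D j κ, rfl⟩)
      simp only at h1
      have hc : ∀ v : L2, ∀ k : ℤ, inner ℂ (fourierLp 2 k : L2) v = coef v k := fun v k => by
        rw [coef, HilbertBasis.repr_apply_apply, coe_fourierBasis]
      rw [inner_add_left, inner_smul_left, sum_inner, hPi, hc, hc] at h1
      simp only [inner_smul_left, hc, Complex.conj_I] at h1
      have h2 : ∑ k : blockIdx j, (starRingEnd ℂ) (D j k κ) * coef y k =
          ∑ k : blockIdx j, D j κ k * coef y k := by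
        refine Finset.sum_congr rfl fun k _ => ?_
        rw [← (hD j).apply κ k]; rfl
      rw [h2] at h1
      rw [coef_smul, coef_add]
      linear_combination (-Complex.I) * h1 - (∑ k : blockIdx j, D j κ k * coef y k) * Complex.I_sq
    · rw [smul_smul, Complex.I_mul_I, neg_one_smul]; abel
  · rintro ⟨w, hw, hz⟩ a b hab
    obtain ⟨wa, hwa, rfl⟩ := mem_graph_vectorField.1 hab
    simp only
    have hz' : z = -(Complex.I • w + P y) := by rw [← hz, neg_neg]
    rw [hz', inner_add_left, inner_smul_left, hPi, inner_neg_right, inner_add_right,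
      inner_smul_right, inner_blockDiag_symm hD hwa hw, Complex.conj_I]
    ring


/-! ### Commutators with a block diagonal operator -/

/-- `[i D, A] = B` on the domain of `D = diag_j D(j)`, which `A` preserves. -/
def HasComm (D : Blocks) (A B : Op) : Prop :=
  ∀ u w : L2, (u, w) ∈ blockDiagGraph D → (A u, A w - Complex.I • B u) ∈ blockDiagGraph D

variable {D : Blocks}

/-- Each defining equation involves finitely many coefficients, which are continuous. Closedness is
what lets `HasComm` pass to infinite sums. -/
lemma isClosed_blockDiagGraph (D : Blocks) : IsClosed (blockDiagGraph D : Set (L2 × L2)) := by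
  have h : (blockDiagGraph D : Set (L2 × L2)) = ⋂ (j : ℕ) (k : blockIdx j),
      {p | coefL k p.2 = ∑ k', D j k k' * coefL k' p.1} := by
    ext p
    simp only [Set.mem_iInter, Set.mem_ofPred_eq, coefL_apply]
    rfl
  rw [h]
  refine isClosed_iInter fun j => isClosed_iInter fun k => isClosed_eq (by fun_prop) (by fun_prop)

lemma HasComm.zero : HasComm D 0 0 := by
  intro u w _
  convert (blockDiagGraph D).zero_mem using 1
  simp

lemma HasComm.one : HasComm D 1 0 := by
  intro u w h
  simpa using h

lemma HasComm.add {A A' B B' : Op} (h : HasComm D A B) (h' : HasComm D A' B') :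
    HasComm D (A + A') (B + B') := by
  intro u w hu
  have := (blockDiagGraph D).add_mem (h u w hu) (h' u w hu)
  convert this using 1
  ext1
  · simp
  · simp only [add_apply, smul_add, Prod.mk_add_mk]
    abel

lemma HasComm.smul {A B : Op} (c : ℂ) (h : HasComm D A B) : HasComm D (c • A) (c • B) := by
  intro u w hu
  have := (blockDiagGraph D).smul_mem c (h u w hu)
  convert this using 1
  ext1
  · simp
  · simp only [smul_apply, Prod.smul_mk, smul_sub, smul_comm c]

lemma HasComm.neg {A B : Op} (h : HasComm D A B) : HasComm D (-A) (-B) := by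
  simpa using h.smul (-1)

lemma HasComm.mul {A A' B B' : Op} (h : HasComm D A B) (h' : HasComm D A' B') :
    HasComm D (A * A') (B * A' + A * B') := by
  intro u w hu
  convert h _ _ (h' u w hu) using 1
  ext1
  · rfl
  · simp only [mul_apply_eq_comp, add_apply, map_sub, map_smul,
      smul_add]
    abel

lemma HasComm.sum {ι : Type*} (s : Finset ι) {A B : ι → Op} (h : ∀ a, HasComm D (A a) (B a)) :
    HasComm D (∑ a ∈ s, A a) (∑ a ∈ s, B a) := by
  classical
  induction s using Finset.induction_on with
  | empty => simpa using HasComm.zero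
  | insert a s ha ih =>
    rw [Finset.sum_insert ha, Finset.sum_insert ha]
    exact (h a).add ih

lemma HasComm.hasSum {ι : Type*} {A B : ι → Op} {A' B' : Op} (h : ∀ a, HasComm D (A a) (B a))
    (hA : HasSum A A') (hB : HasSum B B') : HasComm D A' B' := by
  intro u w hu
  have hev : ∀ v : L2, Continuous fun T : Op => T v := fun v => by fun_prop
  have h1 : Filter.Tendsto (fun s : Finset ι => ((∑ a ∈ s, A a) u,
      (∑ a ∈ s, A a) w - Complex.I • (∑ a ∈ s, B a) u)) Filter.atTop
      (nhds (A' u, A' w - Complex.I • B' u)) := by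
    refine Filter.Tendsto.prodMk_nhds (((hev u).tendsto _).comp hA) (Filter.Tendsto.sub
      (((hev w).tendsto _).comp hA) ((((hev u).tendsto _).comp hB).const_smul _))
  exact (isClosed_blockDiagGraph D).mem_of_tendsto h1
    (Filter.Eventually.of_forall fun s => HasComm.sum s h u w hu)

lemma HasComm.pow {F X : Op} (h : HasComm D F X) (k : ℕ) :
    HasComm D (F ^ k) (powDeriv F X k) := by
  induction k with
  | zero => simpa [powDeriv] using HasComm.one
  | succ k ih => rw [pow_succ, powDeriv]; exact ih.mul h

lemma HasComm.exp {F X E : Op} (h : HasComm D F X)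
    (hE : HasSum (fun k => (k.factorial : ℂ)⁻¹ • powDeriv F X k) E) :
    HasComm D (NormedSpace.exp F) E :=
  HasComm.hasSum (fun k => (h.pow k).smul _) (NormedSpace.exp_series_hasSum_exp' (𝕂 := ℂ) F) hE

/-! ### Conjugation of the unbounded vector field by an exponential -/

lemma powDeriv_add (F X Y : Op) (k : ℕ) :
    powDeriv F (X + Y) k = powDeriv F X k + powDeriv F Y k := by
  induction k with
  | zero => simp [powDeriv]
  | succ k ih => simp only [powDeriv, ih, add_mul, mul_add]; abel

lemma mem_graph_conjOp {Φ dΦ : Op} {L : L2 →ₗ.[ℂ] L2} {u v : L2} :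
    (u, v) ∈ (conjOp Φ dΦ L).graph ↔
      ∃ y, (Φ u, y) ∈ L.graph ∧ v = Ring.inverse Φ y - Ring.inverse Φ (dΦ u) := by
  simp only [LinearPMap.mem_graph_iff]
  constructor
  · rintro ⟨y, rfl, rfl⟩
    exact ⟨_, ⟨⟨Φ y, y.2⟩, rfl, rfl⟩, rfl⟩
  · rintro ⟨y, ⟨z, hz, rfl⟩, rfl⟩
    have hz' : Φ u ∈ L.domain := hz ▸ z.2
    refine ⟨⟨u, hz'⟩, rfl, ?_⟩
    have : z = ⟨Φ u, hz'⟩ := Subtype.ext hz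
    rw [this]
    rfl

/-- Conjugation of `i D + P` by `exp F`, where `[i D, F] = dF + G` is bounded. -/
lemma vectorField_eq_conjOp {D' : Blocks} {F P P' Z dF G dΦ : Op}
    (hF : HasComm D F (dF + G))
    (hdΦ : HasSum (fun k => (k.factorial : ℂ)⁻¹ • powDeriv F dF k) dΦ)
    (hD' : ∀ u w, (u, w) ∈ blockDiagGraph D' ↔ (u, w + Complex.I • Z u) ∈ blockDiagGraph D)
    (hP' : P' + Z = (∑' k : ℕ, (k.factorial : ℂ)⁻¹ • (rightAd F)^[k] P) +
      ∑' k : ℕ, ((k + 1).factorial : ℂ)⁻¹ • (rightAd F)^[k] G) :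
    vectorField D' P' = conjOp (NormedSpace.exp F) dΦ (vectorField D P) := by
  let _ : NormedAlgebra ℚ Op := NormedAlgebra.restrictScalars ℚ ℂ Op
  set SP := ∑' k : ℕ, (k.factorial : ℂ)⁻¹ • (rightAd F)^[k] P
  set TG := ∑' k : ℕ, ((k + 1).factorial : ℂ)⁻¹ • (rightAd F)^[k] G
  set Φ : Op := NormedSpace.exp F with hΦ
  have hinv : Ring.inverse Φ = NormedSpace.exp (-F) := Ring.inverse_exp F
  have hunit : IsUnit Φ := NormedSpace.isUnit_exp F
  have hl : ∀ v, Ring.inverse Φ (Φ v) = v := fun v => by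
    rw [← mul_apply_eq_comp, Ring.inverse_mul_cancel _ hunit]; rfl
  have hSP : ∀ u, P (Φ u) = Φ (SP u) := fun u => by
    have := exp_mul_tsum_ad F P
    rw [← mul_apply_eq_comp, ← mul_apply_eq_comp, ← this]
  -- `[i D, ·]` is a derivation, so `[i D, Φ]` is the differential of `exp` at `F` applied to `dF +
  -- G`. The `dF` part is `dΦ`, which cancels against the time derivative, and the `G` part is `Φ
  -- TG`.
  have hE : HasComm D Φ (dΦ + Φ * TG) := by
    refine hF.exp ?_
    refine (hdΦ.add (hasSum_powDeriv F G)).congr_fun fun k => ?_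
    rw [powDeriv_add, smul_add]
  -- `Φ⁻¹` preserves the domain of `D` as well, hence `Φ u ∈ dom D` forces `u ∈ dom D`: the
  -- conjugated operator has no larger domain.
  have hE' : ∃ E', HasComm D (NormedSpace.exp (-F)) E' :=
    ⟨_, hF.neg.exp (hasSum_powDeriv _ _)⟩
  have key : ∀ u w₀, (u, w₀) ∈ blockDiagGraph D → ∀ w, (Φ u, w) ∈ blockDiagGraph D →
      Ring.inverse Φ (Complex.I • w + P (Φ u)) - Ring.inverse Φ (dΦ u) =
        Complex.I • (w₀ - Complex.I • Z u) + P' u := by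
    intro u w₀ h0 w hw
    have h1 := hE u w₀ h0
    have h2 : w = Φ w₀ - Complex.I • (dΦ + Φ * TG) u := by
      rw [← graph_blockDiagOp] at h1 hw
      exact LinearPMap.mem_graph_snd_inj _ hw h1 rfl
    have h3 : Complex.I • w + P (Φ u) - dΦ u = Φ (Complex.I • w₀ + TG u + SP u) := by
      rw [h2, hSP, smul_sub, smul_smul, Complex.I_mul_I, neg_one_smul]
      simp only [add_apply, mul_apply_eq_comp, map_add, map_smul]
      abel
    rw [← map_sub, h3, hl, smul_sub, smul_smul, Complex.I_mul_I, neg_one_smul]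
    have h4 : P' u + Z u = SP u + TG u := by
      rw [← add_apply, hP']; rfl
    rw [sub_neg_eq_add, add_assoc, add_assoc, add_comm (Z u), h4, add_comm (SP u)]
  refine LinearPMap.eq_of_eq_graph ?_
  ext ⟨u, v⟩
  rw [mem_graph_vectorField, mem_graph_conjOp]
  constructor
  · rintro ⟨w', hw', rfl⟩
    rw [hD'] at hw'
    have h1 := hE u _ hw'
    refine ⟨_, mem_graph_vectorField.2 ⟨_, h1, rfl⟩, ?_⟩
    rw [key u _ hw' _ h1, add_sub_cancel_right]
  · rintro ⟨y, hy, rfl⟩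
    obtain ⟨w, hw, rfl⟩ := mem_graph_vectorField.1 hy
    obtain ⟨E', hE'⟩ := hE'
    have h1 := hE' _ _ hw
    rw [← hinv, hl] at h1
    refine ⟨_, (hD' u _).2 ?_, key u _ h1 w hw⟩
    rw [sub_add_cancel]
    exact h1

/-- A block diagonal perturbation of the diagonal does not change its domain. -/
lemma mem_blockDiagGraph_perturb {D' : Blocks} {Z : Op} (hZ : ∀ j j', j ≠ j' → blockOf Z j j' = 0)
    (hD' : ∀ j, D' j = D j - Complex.I • blockOf Z j j) (u w : L2) :
    (u, w) ∈ blockDiagGraph D' ↔ (u, w + Complex.I • Z u) ∈ blockDiagGraph D := by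
  rw [mem_blockDiagGraph, mem_blockDiagGraph]
  refine forall_congr' fun j => forall_congr' fun k => ?_
  have h1 : coef (Z u) k = ∑ κ : blockIdx j, blockOf Z j j k κ * coef u κ := by
    refine (hasSum_block_apply Z u k).unique (hasSum_single j fun i hi => ?_)
    rw [hZ j i hi.symm]
    simp
  rw [coef_add, coef_smul, h1, hD']
  simp only [Matrix.sub_apply, Matrix.smul_apply, sub_mul, Finset.sum_sub_distrib, smul_eq_mul,
    mul_assoc, ← Finset.mul_sum]
  exact eq_sub_iff_add_eq

/-- The commutator with `diag_j D(j)` can be read off from the blocks. -/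
lemma hasComm_of_blocks {F B : Op} (h : ∀ j i, D j * blockOf F j i =
    blockOf F j i * D i - Complex.I • blockOf B j i) : HasComm D F B := by
  intro u w hu
  rw [mem_blockDiagGraph]
  intro j k
  have h1 := (hasSum_block_apply F w k).sub ((hasSum_block_apply B u k).mul_left Complex.I)
  have h2 : HasSum (fun i : ℕ => ∑ k', D j k k' * ∑ κ : blockIdx i, blockOf F j i k' κ * coef u κ)
      (∑ k', D j k k' * coef (F u) k') :=
    hasSum_sum fun k' _ => (hasSum_block_apply F u k').mul_left _
  rw [coef_sub, coef_smul]
  refine h1.unique (h2.congr_fun fun i => ?_)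
  have h3 : (D j * blockOf F j i).mulVec (fun κ => coef u κ) k =
      (blockOf F j i * D i - Complex.I • blockOf B j i).mulVec (fun κ => coef u κ) k := by rw [h]
  rw [← Matrix.mulVec_mulVec, Matrix.sub_mulVec, ← Matrix.mulVec_mulVec, Matrix.smul_mulVec] at h3
  have h4 : (D i).mulVec (fun κ => coef u κ) = fun κ : blockIdx i => coef w κ :=
    funext fun κ => (mem_blockDiagGraph.1 hu i κ).symm
  rw [h4] at h3
  exact h3.symm


/-! ### Operators with prescribed blocks -/

open Classical in
/-- The bounded operator with the given blocks (zero if there is none). -/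
def opOfBlocks (M : ∀ j j', Block j j') : Op :=
  if h : ∃ R : Op, ∀ j j', blockOf R j j' = M j j' then h.choose else 0

lemma blockOf_opOfBlocks {σ B : ℝ} (hσ : 0 < σ) {M : ∀ j j', Block j j'}
    (hM : ∀ j j' : ℕ, hsNorm (M j j') ≤ B * Real.exp (-σ * |(j : ℝ) - j'|)) (j j' : ℕ) :
    blockOf (opOfBlocks M) j j' = M j j' := by
  obtain ⟨R, hR, -⟩ := exists_op_of_blocks hσ M hM
  have h : ∃ R : Op, ∀ j j', blockOf R j j' = M j j' := ⟨R, hR⟩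
  rw [opOfBlocks, dif_pos h]
  exact h.choose_spec j j'

/-- The block diagonal part of an operator. -/
def diagPart (R : Op) : Op := opOfBlocks fun j j' => if j = j' then blockOf R j j' else 0

section diagPart

variable {σ m : ℝ} {R S : Op}

lemma blockOf_diagPart (hσ : 0 < σ) (hR : bNorm σ 0 R ≠ ∞) (j j' : ℕ) :
    blockOf (diagPart R) j j' = if j = j' then blockOf R j j' else 0 := by
  refine blockOf_opOfBlocks hσ (B := (bNorm σ 0 R).toReal) (fun j j' => ?_) j j'
  split_ifs with h
  · exact hsNorm_le_of_bNorm hR j j'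
  · rw [hsNorm_zero]; positivity

lemma bNorm_diagPart_le (hσ : 0 < σ) (hR : bNorm σ 0 R ≠ ∞) :
    bNorm σ m (diagPart R) ≤ bNorm σ m R := by
  rw [← one_mul (bNorm σ m R)]
  refine bNorm_le_of_bTerm_le fun j j' => ?_
  rw [one_mul, blockOf_diagPart hσ hR]
  refine bTerm_mono ?_
  split_ifs
  · exact le_rfl
  · rw [hsNorm_zero]; exact hsNorm_nonneg _

lemma bNorm_diagPart_sub_le (hσ : 0 < σ) {σ' : ℝ} (hR : bNorm σ 0 R ≠ ∞) (hS : bNorm σ 0 S ≠ ∞) :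
    bNorm σ' m (diagPart R - diagPart S) ≤ bNorm σ' m (R - S) := by
  rw [← one_mul (bNorm σ' m (R - S))]
  refine bNorm_le_of_bTerm_le fun j j' => ?_
  rw [one_mul, blockOf_sub, blockOf_diagPart hσ hR, blockOf_diagPart hσ hS, blockOf_sub]
  refine bTerm_mono ?_
  split_ifs
  · exact le_rfl
  · rw [sub_zero, hsNorm_zero]; exact hsNorm_nonneg _

lemma adjoint_diagPart (hσ : 0 < σ) (hR : bNorm σ 0 R ≠ ∞)
    (h : ContinuousLinearMap.adjoint R = -R) :
    ContinuousLinearMap.adjoint (diagPart R) = -diagPart R := by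
  refine blockOf_ext fun j j' => ?_
  rw [blockOf_adjoint, blockOf_neg, blockOf_diagPart hσ hR, blockOf_diagPart hσ hR]
  by_cases hj : j = j'
  · subst hj
    rw [if_pos rfl, ← blockOf_adjoint, h, blockOf_neg]
  · rw [if_neg hj, if_neg (Ne.symm hj)]; simp

end diagPart

/-! ### The small divisors -/

lemma smallDiv_neg (l : Idx) : smallDiv (-l) = smallDiv l := by
  rw [smallDiv, Finsupp.prod_neg_index (by simp)]
  simp [smallDiv]

lemma one_le_smallDiv (l : Idx) : 1 ≤ smallDiv l := by
  refine Finset.prod_induction _ (fun x : ℝ => 1 ≤ x)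
    (fun a b ha hb => one_le_mul_of_one_le_of_one_le ha hb) le_rfl fun j _ => ?_
  have : 0 ≤ |(l j : ℝ)| ^ 4 * ((j : ℕ) : ℝ) ^ 4 := by positivity
  linarith

/-- The non-resonance conditions defining the Melnikov sets, at a fixed frequency. -/
def NonRes (η N γ : ℝ) (ω : Freq) (D : Blocks) : Prop :=
  (∀ (l : Idx) (j j' : ℕ), l.wt η ≤ N → j ≠ j' →
    InvNormLE (melnikovOp ω D l j j') (smallDiv l / γ)) ∧
  (∀ (l : Idx) (j : ℕ), l.wt η ≤ N → l ≠ 0 →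
    InvNormLE (melnikovOp ω D l j j) (smallDiv l * jap j ^ 2 / γ))

/-! ### The homological equation -/

section Homological

variable {η N γ : ℝ} {ω : Freq} {D : Blocks}

/-- Both Melnikov conditions are merged into the weaker diagonal bound, as `⟨j'⟩ ≥ 1`. The index is
`-ℓ` because `-ω·∂F` contributes `-ω·ℓ`. -/
lemma NonRes.invNormLE (hγ : 0 < γ) (h : NonRes η N γ ω D) {l : Idx} (hl : l.wt η ≤ N) {j j' : ℕ}
    (hne : ¬(l = 0 ∧ j = j')) :
    InvNormLE (melnikovOp ω D (-l) j j') (smallDiv l * jap j' ^ 2 / γ) := by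
  by_cases hj : j = j'
  · subst hj
    have hl0 : l ≠ 0 := fun h0 => hne ⟨h0, rfl⟩
    rw [← smallDiv_neg]
    exact h.2 (-l) j (by rwa [Idx.wt_neg]) (neg_ne_zero.2 hl0)
  · obtain ⟨S, h1, h2, h3⟩ := h.1 (-l) j j' (by rwa [Idx.wt_neg]) hj
    refine ⟨S, h1, h2, fun X => (h3 X).trans ?_⟩
    rw [smallDiv_neg]
    have e1 := one_le_smallDiv l
    have e2 := one_le_jap j'
    have e3 := hsNorm_nonneg X
    gcongr
    exact le_mul_of_one_le_right (by linarith) (one_le_pow₀ e2)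

lemma InvNormLE.hsNorm_le {j j' : ℕ} {T : Block j j' →ₗ[ℂ] Block j j'} {c : ℝ}
    (h : InvNormLE T c) (X : Block j j') : hsNorm X ≤ c * hsNorm (T X) := by
  obtain ⟨S, h1, -, h3⟩ := h
  have h4 := h3 (T X)
  rwa [← LinearMap.comp_apply, h1, LinearMap.id_apply] at h4

open Classical in
/-- The solution of `O(-ℓ, j, j') X = i Y` (zero if there is none). -/
def solveBlock (ω : Freq) (D : Blocks) (l : Idx) {j j' : ℕ} (Y : Block j j') : Block j j' :=
  if h : ∃ X, melnikovOp ω D (-l) j j' X = Complex.I • Y then h.choose else 0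

lemma melnikovOp_solveBlock {l : Idx} {j j' : ℕ} {c : ℝ}
    (h : InvNormLE (melnikovOp ω D (-l) j j') c) (Y : Block j j') :
    melnikovOp ω D (-l) j j' (solveBlock ω D l Y) = Complex.I • Y := by
  obtain ⟨S, -, h2, -⟩ := h
  have h : ∃ X, melnikovOp ω D (-l) j j' X = Complex.I • Y :=
    ⟨S (Complex.I • Y), by rw [← LinearMap.comp_apply, h2, LinearMap.id_apply]⟩
  rw [solveBlock, dif_pos h]
  exact h.choose_spec

/-- The blocks of the generator at the Fourier index `ℓ`. -/
def genBlock (ω : Freq) (D : Blocks) (P : TimeOp) (l : Idx) (j j' : ℕ) : Block j j' :=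
  if l = 0 ∧ j = j' then 0 else solveBlock ω D l (blockOf (P l) j j')

open Classical in
/-- The generator of the conjugation, solving the truncated homological equation. -/
def generator (η N : ℝ) (ω : Freq) (D : Blocks) (P : TimeOp) : TimeOp := fun l =>
  if l.wt η ≤ N then opOfBlocks (genBlock ω D P l) else 0

open Classical in
/-- Truncation to the Fourier indices of weight at most `N`. -/
def truncate (η N : ℝ) (P : TimeOp) : TimeOp := fun l => if l.wt η ≤ N then P l else 0

/-- The time independent block diagonal part. -/
def resonant (P : TimeOp) : TimeOp := fun l => if l = 0 then diagPart (P 0) else 0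

/-- The right hand side of the homological equation `[i D, F] - ω·∂F = G`. -/
def homRhs (η N : ℝ) (P : TimeOp) : TimeOp := resonant P - truncate η N P

lemma hsNorm_genBlock_le (hγ : 0 < γ) (h : NonRes η N γ ω D) (P : TimeOp) {l : Idx}
    (hl : l.wt η ≤ N) (j j' : ℕ) :
    hsNorm (genBlock ω D P l j j') ≤ smallDiv l * jap j' ^ 2 / γ * hsNorm (blockOf (P l) j j') := by
  have e1 := (one_le_smallDiv l).trans' zero_le_one
  have e3 := hsNorm_nonneg (blockOf (P l) j j')
  rw [genBlock]
  split_ifs with h0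
  · rw [hsNorm_zero]; positivity
  · have h1 := h.invNormLE hγ hl h0
    refine (h1.hsNorm_le _).trans_eq ?_
    rw [melnikovOp_solveBlock h1, hsNorm_smul, Complex.norm_I, one_mul]

variable {σ : ℝ} {P : TimeOp}

lemma bNorm_coeff_ne_top {m : ℝ} (hσ : 0 < σ) (hm : m ≤ 0) (hP : decayNorm η σ m P ≠ ∞) (l : Idx) :
    bNorm σ 0 (P l) ≠ ∞ :=
  ne_top_of_le_ne_top hP ((bNorm_mono le_rfl hm _).trans (bNorm_coeff_le_decayNorm hσ.le P l))

lemma bNorm_coeff_ne_top' {m : ℝ} (hσ : 0 < σ) (hP : decayNorm η σ m P ≠ ∞) (l : Idx) :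
    bNorm σ m (P l) ≠ ∞ :=
  ne_top_of_le_ne_top hP (bNorm_coeff_le_decayNorm hσ.le P l)

/-- The order `-2` of `P` absorbs the factor `⟨j'⟩²` of the divisor, so the solved blocks keep
exponential off-diagonal decay and do come from a bounded operator. -/
lemma blockOf_generator (hσ : 0 < σ) (hγ : 0 < γ) (h : NonRes η N γ ω D)
    (hP : decayNorm η σ (-2) P ≠ ∞) {l : Idx} (hl : l.wt η ≤ N) (j j' : ℕ) :
    blockOf (generator η N ω D P l) j j' = genBlock ω D P l j j' := by
  rw [generator, if_pos hl]
  have e1 := (one_le_smallDiv l).trans' zero_le_one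
  refine blockOf_opOfBlocks hσ (B := smallDiv l / γ * (bNorm σ (-2) (P l)).toReal)
    (fun j j' => (hsNorm_genBlock_le hγ h P hl j j').trans ?_) j j'
  have h1 := ENNReal.toReal_mono (bNorm_coeff_ne_top' hσ hP l) (bTerm_le_bNorm σ (-2) (P l) j j')
  have e2 := (jap_pos j').le
  have e3 := hsNorm_nonneg (blockOf (P l) j j')
  rw [bTerm, ENNReal.toReal_ofReal (by positivity), neg_neg, Real.rpow_two] at h1
  have h2 : jap j' ^ 2 * hsNorm (blockOf (P l) j j') ≤
      (bNorm σ (-2) (P l)).toReal * Real.exp (-σ * |(j : ℝ) - j'|) := by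
    rw [neg_mul, Real.exp_neg, ← div_eq_mul_inv, le_div_iff₀ (Real.exp_pos _)]
    linarith
  calc smallDiv l * jap j' ^ 2 / γ * hsNorm (blockOf (P l) j j')
      = smallDiv l / γ * (jap j' ^ 2 * hsNorm (blockOf (P l) j j')) := by ring
    _ ≤ smallDiv l / γ * ((bNorm σ (-2) (P l)).toReal * Real.exp (-σ * |(j : ℝ) - j'|)) := by gcongr
    _ = _ := by ring

lemma homological_blocks (hσ : 0 < σ) (hγ : 0 < γ) (hN : 0 ≤ N) (h : NonRes η N γ ω D)
    (hP : decayNorm η σ (-2) P ≠ ∞) (l : Idx) (j i : ℕ) :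
    D j * blockOf (generator η N ω D P l) j i = blockOf (generator η N ω D P l) j i * D i -
      Complex.I • blockOf (omegaDeriv ω (generator η N ω D P) l + homRhs η N P l) j i := by
  have hz := blockOf_diagPart hσ (bNorm_coeff_ne_top hσ (by norm_num) hP 0) j i
  by_cases hl : l.wt η ≤ N
  · have hF := blockOf_generator hσ hγ h hP hl j i
    rw [blockOf_add, omegaDeriv, blockOf_smul, homRhs, Pi.sub_apply, blockOf_sub, truncate,
      if_pos hl, hF, genBlock]
    split_ifs with h0
    · obtain ⟨rfl, rfl⟩ := h0
      rw [resonant, if_pos rfl, hz, if_pos rfl]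
      simp
    · have h1 := melnikovOp_solveBlock (h.invNormLE hγ hl h0) (blockOf (P l) j i)
      have h2 : blockOf (resonant P l) j i = 0 := by
        rw [resonant]
        split_ifs with h3
        · rw [hz, if_neg fun h4 => h0 ⟨h3, h4⟩]
        · exact blockOf_zero
      set X := solveBlock ω D l (blockOf (P l) j i)
      change ((freqDot ω (-l) : ℝ) : ℂ) • X + D j * X - X * D i = _ at h1
      rw [freqDot_neg, Complex.ofReal_neg, neg_smul] at h1
      rw [h2, zero_sub, smul_add, smul_smul, ← mul_assoc, Complex.I_mul_I, smul_neg, ← h1,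
        neg_one_mul, neg_smul]
      abel
  -- Beyond the cut-off every term vanishes, including the resonant one, since `0 ≤ N` keeps the
  -- index `0` below the cut-off.
  · have hl0 : l ≠ 0 := by
      rintro rfl
      exact hl (by rwa [Idx.wt_zero])
    have hF : generator η N ω D P l = 0 := by rw [generator, if_neg hl]
    rw [omegaDeriv, hF, homRhs, Pi.sub_apply, truncate, if_neg hl, resonant, if_neg hl0]
    simp [blockOf_zero]

/-- Taking adjoints in the equation at `-ℓ` shows that `Y* + X` lies in the kernel of the Melnikov
operator at `(-ℓ, j, i)`, which is injective. -/
lemma adjoint_generator (hσ : 0 < σ) (hγ : 0 < γ) (h : NonRes η N γ ω D)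
    (hD : ∀ j, (D j).IsHermitian) (hP : decayNorm η σ (-2) P ≠ ∞)
    (hsk : ∀ l, ContinuousLinearMap.adjoint (P (-l)) = -P l) (l : Idx) :
    ContinuousLinearMap.adjoint (generator η N ω D P (-l)) = -generator η N ω D P l := by
  by_cases hl : l.wt η ≤ N
  · refine blockOf_ext fun j i => ?_
    have hl' : (-l).wt η ≤ N := by rwa [Idx.wt_neg]
    rw [blockOf_adjoint, blockOf_neg, blockOf_generator hσ hγ h hP hl,
      blockOf_generator hσ hγ h hP hl', genBlock, genBlock]
    by_cases h0 : l = 0 ∧ j = i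
    · rw [if_pos ⟨by simp [h0.1], h0.2.symm⟩, if_pos h0]; simp
    · have h0' : ¬(-l = 0 ∧ i = j) := fun h1 => h0 ⟨neg_eq_zero.1 h1.1, h1.2.symm⟩
      rw [if_neg h0, if_neg h0']
      have e1 := melnikovOp_solveBlock (h.invNormLE hγ hl h0) (blockOf (P l) j i)
      have e2 := melnikovOp_solveBlock (h.invNormLE hγ hl' h0') (blockOf (P (-l)) i j)
      set X := solveBlock ω D l (blockOf (P l) j i)
      set Y := solveBlock ω D (-l) (blockOf (P (-l)) i j)
      change ((freqDot ω (-l) : ℝ) : ℂ) • X + D j * X - X * D i = _ at e1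
      change ((freqDot ω (- -l) : ℝ) : ℂ) • Y + D i * Y - Y * D j = _ at e2
      have e3 := congrArg Matrix.conjTranspose e2
      rw [Matrix.conjTranspose_sub, Matrix.conjTranspose_add, Matrix.conjTranspose_smul,
        Matrix.conjTranspose_smul, Matrix.conjTranspose_mul, Matrix.conjTranspose_mul,
        (hD i).eq, (hD j).eq, ← blockOf_adjoint, hsk, blockOf_neg, neg_neg] at e3
      have e4 : melnikovOp ω D (-l) j i (Y.conjTranspose + X) = 0 := by
        change ((freqDot ω (-l) : ℝ) : ℂ) • (Y.conjTranspose + X) + D j * (Y.conjTranspose + X) -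
          (Y.conjTranspose + X) * D i = 0
        have e5 : star ((freqDot ω l : ℝ) : ℂ) = ((freqDot ω l : ℝ) : ℂ) := Complex.conj_ofReal _
        have e6 : star Complex.I = -Complex.I := Complex.conj_I
        rw [e5, e6, smul_neg, neg_smul, neg_neg, ← e1] at e3
        rw [freqDot_neg, Complex.ofReal_neg, neg_smul] at e3 ⊢
        rw [smul_add, Matrix.mul_add, Matrix.add_mul]
        have e7 := sub_eq_zero.2 e3
        rw [← neg_eq_zero, ← e7]
        abel
      have e5 := (h.invNormLE hγ hl h0).hsNorm_le (Y.conjTranspose + X)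
      rw [e4, hsNorm_zero, mul_zero] at e5
      have e6 : Y.conjTranspose + X = 0 := by
        ext a b
        exact norm_le_zero_iff.1 ((norm_entry_le_hsNorm _ a b).trans e5)
      exact eq_neg_of_add_eq_zero_left e6
  · have hl' : ¬(-l).wt η ≤ N := by rwa [Idx.wt_neg]
    simp [generator, hl, hl']

lemma adjoint_truncate (hsk : ∀ l, ContinuousLinearMap.adjoint (P (-l)) = -P l) (l : Idx) :
    ContinuousLinearMap.adjoint (truncate η N P (-l)) = -truncate η N P l := by
  rw [truncate, truncate, Idx.wt_neg]
  split_ifs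
  · exact hsk l
  · simp

lemma adjoint_resonant {m : ℝ} (hσ : 0 < σ) (hm : m ≤ 0) (hP : decayNorm η σ m P ≠ ∞)
    (hsk : ∀ l, ContinuousLinearMap.adjoint (P (-l)) = -P l) (l : Idx) :
    ContinuousLinearMap.adjoint (resonant P (-l)) = -resonant P l := by
  rw [resonant, resonant]
  simp only [neg_eq_zero]
  split_ifs with h
  · refine adjoint_diagPart hσ (bNorm_coeff_ne_top hσ hm hP 0) ?_
    simpa using hsk 0
  · simp

end Homological


/-! ### Bounds for the ingredients of the step -/

section Bounds

variable {η N γ σ m : ℝ} {P P₁ P₂ : TimeOp}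

lemma decayNorm_truncate_le (P : TimeOp) :
    decayNorm η σ m (truncate η N P) ≤ decayNorm η σ m P := by
  refine ENNReal.tsum_le_tsum fun l => ?_
  gcongr
  rw [truncate]
  split_ifs
  · exact le_rfl
  · rw [bNorm_zero]; exact zero_le

lemma truncate_sub : truncate η N P₁ - truncate η N P₂ = truncate η N (P₁ - P₂) := by
  funext l
  simp only [truncate, Pi.sub_apply]
  split_ifs <;> simp

lemma decayNorm_sub_truncate_le {τ : ℝ} (hτ : τ ≤ σ) (P : TimeOp) :
    decayNorm η τ m (P - truncate η N P) ≤
      ENNReal.ofReal (Real.exp (-((σ - τ) * N))) * decayNorm η σ m P := by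
  rw [decayNorm, decayNorm, ← ENNReal.tsum_mul_left]
  refine ENNReal.tsum_le_tsum fun l => ?_
  rw [Pi.sub_apply, truncate]
  split_ifs with h
  · rw [sub_self, bNorm_zero, mul_zero]; exact zero_le
  · rw [sub_zero, ← mul_assoc, ← ENNReal.ofReal_mul (Real.exp_pos _).le, ← Real.exp_add]
    refine mul_le_mul' (ENNReal.ofReal_le_ofReal (Real.exp_le_exp.2 ?_)) (bNorm_mono hτ le_rfl _)
    nlinarith [not_le.1 h]

lemma decayNorm_resonant_le (hσ : 0 < σ) (hP : bNorm σ 0 (P 0) ≠ ∞) :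
    decayNorm η σ m (resonant P) ≤ decayNorm η σ m P :=
  (decayNorm_ite_zero _).trans_le
    ((bNorm_diagPart_le hσ hP).trans (bNorm_coeff_le_decayNorm hσ.le P 0))

lemma decayNorm_resonant_sub_le (hσ : 0 < σ) (hP₁ : bNorm σ 0 (P₁ 0) ≠ ∞)
    (hP₂ : bNorm σ 0 (P₂ 0) ≠ ∞) :
    decayNorm η σ m (resonant P₁ - resonant P₂) ≤ decayNorm η σ m (P₁ - P₂) := by
  have h : resonant P₁ - resonant P₂ =
      fun l => if l = 0 then diagPart (P₁ 0) - diagPart (P₂ 0) else 0 := by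
    funext l
    simp only [resonant, Pi.sub_apply]
    split_ifs <;> simp
  rw [h]
  exact (decayNorm_ite_zero _).trans_le ((bNorm_diagPart_sub_le hσ hP₁ hP₂).trans
    (bNorm_coeff_le_decayNorm hσ.le (P₁ - P₂) 0))

lemma decayNorm_homRhs_le (hσ : 0 < σ) (hP : bNorm σ 0 (P 0) ≠ ∞) :
    decayNorm η σ m (homRhs η N P) ≤ 2 * decayNorm η σ m P := by
  rw [two_mul]
  exact (decayNorm_sub_le _ _).trans
    (add_le_add (decayNorm_resonant_le hσ hP) (decayNorm_truncate_le P))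

lemma decayNorm_homRhs_sub_le (hσ : 0 < σ) (hP₁ : bNorm σ 0 (P₁ 0) ≠ ∞)
    (hP₂ : bNorm σ 0 (P₂ 0) ≠ ∞) :
    decayNorm η σ m (homRhs η N P₁ - homRhs η N P₂) ≤ 2 * decayNorm η σ m (P₁ - P₂) := by
  have h : homRhs η N P₁ - homRhs η N P₂ =
      (resonant P₁ - resonant P₂) - truncate η N (P₁ - P₂) := by
    rw [← truncate_sub, homRhs, homRhs]; abel
  rw [h, two_mul (decayNorm η σ m (P₁ - P₂))]
  exact (decayNorm_sub_le _ _).trans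
    (add_le_add (decayNorm_resonant_sub_le hσ hP₁ hP₂) (decayNorm_truncate_le _))

lemma bNorm_le_of_bTerm_le_add {σ' m' m'' : ℝ} {R S T : Op} {c d : ℝ≥0∞}
    (h : ∀ j j', bTerm σ m j j' (hsNorm (blockOf R j j')) ≤
      c * bTerm σ' m' j j' (hsNorm (blockOf S j j')) +
        d * bTerm σ' m'' j j' (hsNorm (blockOf T j j'))) :
    bNorm σ m R ≤ c * bNorm σ' m' S + d * bNorm σ' m'' T := by
  rw [bNorm_eq]
  refine iSup_le fun j' => (ENNReal.tsum_le_tsum fun j => h j j').trans ?_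
  rw [ENNReal.tsum_add, ENNReal.tsum_mul_left, ENNReal.tsum_mul_left, bNorm_eq σ' m', bNorm_eq σ' m'']
  gcongr
  · exact le_iSup (fun j' : ℕ => ∑' j : ℕ, bTerm σ' m' j j' (hsNorm (blockOf S j j'))) j'
  · exact le_iSup (fun j' : ℕ => ∑' j : ℕ, bTerm σ' m'' j j' (hsNorm (blockOf T j j'))) j'

variable {ω ω₁ ω₂ : Freq} {D D₁ D₂ : Blocks} {s A : ℝ}

lemma rpow_neg_mul_sq {x : ℝ} (hx : 0 < x) (m : ℝ) : x ^ (-(m + 2)) * x ^ 2 = x ^ (-m) := by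
  rw [← Real.rpow_two, ← Real.rpow_add hx]
  congr 1
  ring

/-- Multiplying a block by `c ⟨j'⟩²` raises the order by two. -/
lemma bTerm_mul_jap_sq_le (hs : s ≤ σ) {j j' : ℕ} {c x : ℝ} (hc : 0 ≤ c) (hx : 0 ≤ x) :
    bTerm s (m + 2) j j' (c * jap j' ^ 2 * x) ≤ ENNReal.ofReal c * bTerm σ m j j' x := by
  have hj := jap_pos j'
  rw [mul_assoc, bTerm_mul hc]
  gcongr
  refine ENNReal.ofReal_le_ofReal ?_
  calc Real.exp (s * |(j : ℝ) - j'|) * (jap j' ^ 2 * x) * jap j' ^ (-(m + 2))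
      = Real.exp (s * |(j : ℝ) - j'|) * x * (jap j' ^ (-(m + 2)) * jap j' ^ 2) := by ring
    _ ≤ _ := by
        rw [rpow_neg_mul_sq hj]
        gcongr

lemma ofReal_exp_mul_le {a b c : ℝ} {w : ℝ} (h : a ≤ A * Real.exp ((σ - s) * w)) (hc : 0 ≤ c)
    (hb : b = c * a) :
    ENNReal.ofReal (Real.exp (s * w)) * ENNReal.ofReal b ≤
      ENNReal.ofReal (c * A) * ENNReal.ofReal (Real.exp (σ * w)) := by
  rw [← ENNReal.ofReal_mul (Real.exp_pos _).le, ← ENNReal.ofReal_mul' (Real.exp_pos _).le, hb]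
  refine ENNReal.ofReal_le_ofReal ?_
  have e : Real.exp (σ * w) = Real.exp (s * w) * Real.exp ((σ - s) * w) := by
    rw [← Real.exp_add]; congr 1; ring
  calc Real.exp (s * w) * (c * a) ≤ Real.exp (s * w) * (c * (A * Real.exp ((σ - s) * w))) := by
        gcongr
    _ = _ := by rw [e]; ring

/-- Here `hA` is used only through `d(ℓ) ≤ A e^{(σ-s)|ℓ|_η}`. The same constant `A` must also serve
for the increments, where the square of the divisor and a factor `|ℓ|_η + 2` occur. -/
lemma decayNorm_generator_le (hσ : 0 < σ) (hs : s ≤ σ) (hγ : 0 < γ) (h : NonRes η N γ ω D)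
    (hA : ∀ l : Idx, 2 * smallDiv l ^ 2 * (l.wt η + 2) ≤ A * Real.exp ((σ - s) * l.wt η))
    (hP : decayNorm η σ (-2) P ≠ ∞) :
    decayNorm η s 0 (generator η N ω D P) ≤ ENNReal.ofReal (A / γ) * decayNorm η σ (-2) P := by
  rw [decayNorm, decayNorm, ← ENNReal.tsum_mul_left]
  refine ENNReal.tsum_le_tsum fun l => ?_
  by_cases hl : l.wt η ≤ N
  · have e1 := one_le_smallDiv l
    have e2 := Idx.wt_nonneg η l
    have h1 : bNorm s 0 (generator η N ω D P l) ≤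
        ENNReal.ofReal (smallDiv l / γ) * bNorm σ (-2) (P l) := by
      refine bNorm_le_of_bTerm_le fun j j' => ?_
      rw [blockOf_generator hσ hγ h hP hl]
      refine (bTerm_mono (hsNorm_genBlock_le hγ h P hl j j')).trans ?_
      have := bTerm_mul_jap_sq_le (m := -2) hs (j := j) (j' := j') (c := smallDiv l / γ)
        (by positivity) (hsNorm_nonneg (blockOf (P l) j j'))
      rw [neg_add_cancel] at this
      rwa [show smallDiv l * jap j' ^ 2 / γ * hsNorm (blockOf (P l) j j') =
        smallDiv l / γ * jap j' ^ 2 * hsNorm (blockOf (P l) j j') by ring]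
    refine (mul_le_mul' le_rfl h1).trans ?_
    rw [← mul_assoc, ← mul_assoc]
    refine mul_le_mul' ?_ le_rfl
    have h2 : smallDiv l ≤ A * Real.exp ((σ - s) * l.wt η) := by
      refine le_trans ?_ (hA l)
      nlinarith [mul_nonneg (sq_nonneg (smallDiv l)) e2]
    refine (ofReal_exp_mul_le h2 (b := smallDiv l / γ) (c := 1 / γ) (by positivity) (by ring)).trans_eq ?_
    congr 2
    ring
  · rw [generator, if_neg hl, bNorm_zero, mul_zero]; exact zero_le

lemma hsNorm_melnikovOp_sub_le (hη : 0 < η) (hD : ∀ j, hsNorm (D₁ j - D₂ j) ≤ ‖ω₁ - ω₂‖)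
    (l : Idx) {j j' : ℕ} (X : Block j j') :
    hsNorm (melnikovOp ω₁ D₁ (-l) j j' X - melnikovOp ω₂ D₂ (-l) j j' X) ≤
      (l.wt η + 2) * ‖ω₁ - ω₂‖ * hsNorm X := by
  have e : melnikovOp ω₁ D₁ (-l) j j' X - melnikovOp ω₂ D₂ (-l) j j' X =
      ((freqDot ω₁ (-l) - freqDot ω₂ (-l) : ℝ) : ℂ) • X + (D₁ j - D₂ j) * X -
        X * (D₁ j' - D₂ j') := by
    change ((freqDot ω₁ (-l) : ℝ) : ℂ) • X + D₁ j * X - X * D₁ j' -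
      (((freqDot ω₂ (-l) : ℝ) : ℂ) • X + D₂ j * X - X * D₂ j') = _
    rw [Complex.ofReal_sub, sub_smul, Matrix.sub_mul, Matrix.mul_sub]
    abel
  have hX := hsNorm_nonneg X
  rw [e]
  calc _ ≤ hsNorm (((freqDot ω₁ (-l) - freqDot ω₂ (-l) : ℝ) : ℂ) • X) +
        hsNorm ((D₁ j - D₂ j) * X) + hsNorm (X * (D₁ j' - D₂ j')) :=
        (hsNorm_sub_le _ _).trans (by gcongr; exact hsNorm_add_le _ _)
    _ ≤ (‖ω₁ - ω₂‖ * l.wt η) * hsNorm X + ‖ω₁ - ω₂‖ * hsNorm X + hsNorm X * ‖ω₁ - ω₂‖ := by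
        gcongr
        · rw [hsNorm_smul, Complex.norm_real, Real.norm_eq_abs]
          gcongr
          have := abs_freqDot_sub_le hη ω₁ ω₂ (-l)
          rwa [Idx.wt_neg] at this
        · exact (hsNorm_mul_le _ _).trans (by gcongr; exact hD j)
        · exact (hsNorm_mul_le _ _).trans (by gcongr; exact hD j')
    _ = _ := by ring

/-- Resolvent identity: `O₁ (X₁ - X₂) = i (P₁ - P₂) - (O₁ - O₂) X₂` on blocks. In the last term the
divisor acts twice, once through `X₂`, giving `d(ℓ)²` and `⟨j'⟩⁴`; applied to `P₂` of order `-2`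
this is an operator of order `2`. -/
lemma hsNorm_genBlock_sub_le (hη : 0 < η) (hγ : 0 < γ) (h₁ : NonRes η N γ ω₁ D₁)
    (h₂ : NonRes η N γ ω₂ D₂) (hD : ∀ j, hsNorm (D₁ j - D₂ j) ≤ ‖ω₁ - ω₂‖) {l : Idx}
    (hl : l.wt η ≤ N) (j j' : ℕ) :
    hsNorm (genBlock ω₁ D₁ P₁ l j j' - genBlock ω₂ D₂ P₂ l j j') ≤
      smallDiv l / γ * jap j' ^ 2 * hsNorm (blockOf (P₁ l - P₂ l) j j') +
      smallDiv l ^ 2 * (l.wt η + 2) * ‖ω₁ - ω₂‖ / γ ^ 2 * jap j' ^ 2 *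
        (jap j' ^ 2 * hsNorm (blockOf (P₂ l) j j')) := by
  have e1 := (one_le_smallDiv l).trans' zero_le_one
  have e2 := Idx.wt_nonneg η l
  have e3 := hsNorm_nonneg (blockOf (P₁ l - P₂ l) j j')
  have e4 := hsNorm_nonneg (blockOf (P₂ l) j j')
  by_cases h0 : l = 0 ∧ j = j'
  · rw [genBlock, genBlock, if_pos h0, if_pos h0, sub_zero, hsNorm_zero]
    positivity
  · have b2 := hsNorm_genBlock_le hγ h₂ P₂ hl j j'
    have i1 := h₁.invNormLE hγ hl h0
    have s1 := melnikovOp_solveBlock i1 (blockOf (P₁ l) j j')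
    have s2 := melnikovOp_solveBlock (h₂.invNormLE hγ hl h0) (blockOf (P₂ l) j j')
    rw [genBlock, if_neg h0] at b2
    rw [genBlock, genBlock, if_neg h0, if_neg h0]
    set X₁ := solveBlock ω₁ D₁ l (blockOf (P₁ l) j j')
    set X₂ := solveBlock ω₂ D₂ l (blockOf (P₂ l) j j')
    have e : melnikovOp ω₁ D₁ (-l) j j' (X₁ - X₂) = Complex.I • blockOf (P₁ l - P₂ l) j j' -
        (melnikovOp ω₁ D₁ (-l) j j' X₂ - melnikovOp ω₂ D₂ (-l) j j' X₂) := by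
      rw [map_sub, s1, s2, blockOf_sub, smul_sub]; abel
    have h3 := i1.hsNorm_le (X₁ - X₂)
    rw [e] at h3
    have h4 := hsNorm_melnikovOp_sub_le hη hD l X₂
    calc hsNorm (X₁ - X₂)
        ≤ smallDiv l * jap j' ^ 2 / γ * (hsNorm (blockOf (P₁ l - P₂ l) j j') +
            (l.wt η + 2) * ‖ω₁ - ω₂‖ *
              (smallDiv l * jap j' ^ 2 / γ * hsNorm (blockOf (P₂ l) j j'))) := by
          refine h3.trans (mul_le_mul_of_nonneg_left ((hsNorm_sub_le _ _).trans ?_) (by positivity))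
          rw [hsNorm_smul, Complex.norm_I, one_mul]
          gcongr
          exact h4.trans (by gcongr)
      _ = _ := by field_simp

lemma decayNorm_generator_sub_le (hη : 0 < η) (hσ : 0 < σ) (hs : s ≤ σ) (hγ : 0 < γ)
    (h₁ : NonRes η N γ ω₁ D₁) (h₂ : NonRes η N γ ω₂ D₂)
    (hD : ∀ j, hsNorm (D₁ j - D₂ j) ≤ ‖ω₁ - ω₂‖)
    (hA : ∀ l : Idx, 2 * smallDiv l ^ 2 * (l.wt η + 2) ≤ A * Real.exp ((σ - s) * l.wt η))
    (hP₁ : decayNorm η σ (-2) P₁ ≠ ∞) (hP₂ : decayNorm η σ (-2) P₂ ≠ ∞) {p : ℝ≥0∞}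
    (hp : decayNorm η σ (-2) P₂ ≤ p)
    (hp' : decayNorm η σ 0 (P₁ - P₂) ≤ p * ENNReal.ofReal (‖ω₁ - ω₂‖ / γ)) :
    decayNorm η s 2 (generator η N ω₁ D₁ P₁ - generator η N ω₂ D₂ P₂) ≤
      ENNReal.ofReal (A / γ) * p * ENNReal.ofReal (‖ω₁ - ω₂‖ / γ) := by
  have hA0 : 0 ≤ A := by
    have := hA 0
    have e1 := one_le_smallDiv 0
    rw [Idx.wt_zero, mul_zero, Real.exp_zero, mul_one] at this
    nlinarith
  have key : ∀ l : Idx, ENNReal.ofReal (Real.exp (s * l.wt η)) *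
      bNorm s 2 ((generator η N ω₁ D₁ P₁ - generator η N ω₂ D₂ P₂) l) ≤
      ENNReal.ofReal (1 / (2 * γ) * A) *
        (ENNReal.ofReal (Real.exp (σ * l.wt η)) * bNorm σ 0 ((P₁ - P₂) l)) +
      ENNReal.ofReal (‖ω₁ - ω₂‖ / (2 * γ ^ 2) * A) *
        (ENNReal.ofReal (Real.exp (σ * l.wt η)) * bNorm σ (-2) (P₂ l)) := by
    intro l
    by_cases hl : l.wt η ≤ N
    · have e1 := one_le_smallDiv l
      have e2 := Idx.wt_nonneg η l
      have h1 : bNorm s 2 ((generator η N ω₁ D₁ P₁ - generator η N ω₂ D₂ P₂) l) ≤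
          ENNReal.ofReal (smallDiv l / γ) * bNorm σ 0 ((P₁ - P₂) l) +
          ENNReal.ofReal (smallDiv l ^ 2 * (l.wt η + 2) * ‖ω₁ - ω₂‖ / γ ^ 2) *
            bNorm σ (-2) (P₂ l) := by
        refine bNorm_le_of_bTerm_le_add fun j j' => ?_
        rw [Pi.sub_apply, blockOf_sub, blockOf_generator hσ hγ h₁ hP₁ hl,
          blockOf_generator hσ hγ h₂ hP₂ hl]
        refine ((bTerm_mono (hsNorm_genBlock_sub_le hη hγ h₁ h₂ hD hl j j')).trans
          bTerm_add_le).trans (add_le_add ?_ ?_)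
        · have := bTerm_mul_jap_sq_le (m := 0) hs (j := j) (j' := j') (c := smallDiv l / γ)
            (by positivity) (hsNorm_nonneg (blockOf (P₁ l - P₂ l) j j'))
          rwa [zero_add] at this
        · have hj := jap_pos j'
          have a1 := bTerm_mul_jap_sq_le (m := 0) hs (j := j) (j' := j')
            (c := smallDiv l ^ 2 * (l.wt η + 2) * ‖ω₁ - ω₂‖ / γ ^ 2) (by positivity)
            (mul_nonneg (sq_nonneg (jap j')) (hsNorm_nonneg (blockOf (P₂ l) j j')))
          have a2 := bTerm_mul_jap_sq_le (m := -2) (le_refl σ) (j := j) (j' := j')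
            (c := 1) zero_le_one (hsNorm_nonneg (blockOf (P₂ l) j j'))
          rw [one_mul, neg_add_cancel, ENNReal.ofReal_one, one_mul] at a2
          rw [zero_add] at a1
          exact a1.trans (mul_le_mul' le_rfl a2)
      refine (mul_le_mul' le_rfl h1).trans ?_
      rw [mul_add, ← mul_assoc, ← mul_assoc, ← mul_assoc, ← mul_assoc]
      refine add_le_add (mul_le_mul' ?_ le_rfl) (mul_le_mul' ?_ le_rfl)
      · refine ofReal_exp_mul_le (a := 2 * smallDiv l) (b := smallDiv l / γ)
          (c := 1 / (2 * γ)) ?_ (by positivity) (by field_simp)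
        refine le_trans ?_ (hA l)
        nlinarith [mul_nonneg (sq_nonneg (smallDiv l)) e2]
      · exact ofReal_exp_mul_le (hA l)
          (b := smallDiv l ^ 2 * (l.wt η + 2) * ‖ω₁ - ω₂‖ / γ ^ 2)
          (c := ‖ω₁ - ω₂‖ / (2 * γ ^ 2)) (by positivity) (by field_simp)
    · rw [Pi.sub_apply, generator, generator, if_neg hl, if_neg hl, sub_zero, bNorm_zero, mul_zero]
      exact zero_le
  refine (ENNReal.tsum_le_tsum key).trans ?_
  rw [ENNReal.tsum_add, ENNReal.tsum_mul_left, ENNReal.tsum_mul_left]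
  change _ * decayNorm η σ 0 (P₁ - P₂) + _ * decayNorm η σ (-2) P₂ ≤ _
  calc _ ≤ ENNReal.ofReal (1 / (2 * γ) * A) * (p * ENNReal.ofReal (‖ω₁ - ω₂‖ / γ)) +
        ENNReal.ofReal (‖ω₁ - ω₂‖ / (2 * γ ^ 2) * A) * p := by gcongr
    _ = _ := by
        have e1 : ENNReal.ofReal (‖ω₁ - ω₂‖ / (2 * γ ^ 2) * A) =
            ENNReal.ofReal (1 / (2 * γ) * A) * ENNReal.ofReal (‖ω₁ - ω₂‖ / γ) := by
          rw [← ENNReal.ofReal_mul (by positivity)]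
          congr 1
          field_simp
        have e2 : ENNReal.ofReal (A / γ) = 2 * ENNReal.ofReal (1 / (2 * γ) * A) := by
          rw [← ENNReal.ofReal_ofNat, ← ENNReal.ofReal_mul (by norm_num)]
          congr 1
          field_simp
        rw [e1, e2]
        ring

end Bounds


/-! ### The step of the iteration -/

/-- The coefficients `1 / (k + i)!`. -/
def facCoeff (i k : ℕ) : ℝ := ((k + i).factorial : ℝ)⁻¹

lemma facCoeff_mul_le {i : ℕ} (hi : 1 ≤ i) (k : ℕ) : ‖((facCoeff i k : ℝ) : ℂ)‖ₑ * (k + 2) ≤ 2 := by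
  have h1 : k + 1 ≤ (k + i).factorial :=
    ((Nat.self_le_factorial (k + 1)).trans (Nat.factorial_le (by omega)))
  have h2 : ((k : ℝ) + 1) ≤ (k + i).factorial := by exact_mod_cast h1
  have h3 : facCoeff i k * (k + 2) ≤ 2 := by
    rw [facCoeff, inv_mul_le_iff₀ (by positivity)]
    linarith [(Nat.cast_nonneg k : (0 : ℝ) ≤ k)]
  have h4 : 0 ≤ facCoeff i k := by rw [facCoeff]; positivity
  rw [← ofReal_norm, Complex.norm_real, Real.norm_of_nonneg h4]
  have e : ((k : ℝ≥0∞) + 2) = ENNReal.ofReal (k + 2) := by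
    rw [ENNReal.ofReal_add (by positivity) (by norm_num)]; simp
  rw [e, ← ENNReal.ofReal_mul h4]
  exact (ENNReal.ofReal_le_ofReal h3).trans_eq (by simp)

/-- The new diagonal part `D(j) - i [P̂(0)]_j`. -/
def stepD (D : Blocks) (P : TimeOp) : Blocks := fun j => D j - Complex.I • blockOf (P 0) j j

/-- The new perturbation. -/
def stepP (η N : ℝ) (ω : Freq) (D : Blocks) (P : TimeOp) : TimeOp :=
  P - truncate η N P + adSum (fun k => (facCoeff 1 k : ℂ)) (generator η N ω D P) P +
    adSum (fun k => (facCoeff 2 k : ℂ)) (generator η N ω D P) (homRhs η N P)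

/-- The smallness conditions under which a step from width `τ + 4ρ` to width `τ` is performed. -/
structure StepParams (η γ N τ ρ A : ℝ) (p : ℝ≥0∞) : Prop where
  hη : 0 < η
  hγ : 0 < γ
  hN : 0 ≤ N
  hτ : 0 < τ
  hρ : 0 < ρ
  hA : ∀ l : Idx, 2 * smallDiv l ^ 2 * (l.wt η + 2) ≤ A * Real.exp (2 * ρ * l.wt η)
  hp : p ≠ ∞
  hq : ENNReal.ofReal (2 * shiftConst ρ) * (ENNReal.ofReal (A / γ) * p) ≤ 2⁻¹

section Step

variable {η γ N τ ρ A : ℝ} {p : ℝ≥0∞} {ω ω₁ ω₂ : Freq} {D D₁ D₂ : Blocks} {P P₁ P₂ : TimeOp}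
  {φ : ℕ+ → ℂ}

namespace StepParams

lemma divisor_le (s : StepParams η γ N τ ρ A p) (l : Idx) : 2 * smallDiv l ^ 2 * (l.wt η + 2) ≤
    A * Real.exp ((τ + 4 * ρ - (τ + ρ + ρ)) * l.wt η) := by
  have h := s.hA l
  rwa [show τ + 4 * ρ - (τ + ρ + ρ) = 2 * ρ by ring]

lemma width_pos (s : StepParams η γ N τ ρ A p) : 0 < τ + 4 * ρ := by linarith [s.hτ, s.hρ]

lemma zero_mem_thickTorus (s : StepParams η γ N τ ρ A p) : (0 : ℕ+ → ℂ) ∈ thickTorus η τ :=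
  fun j => by simpa using real_mem_thickTorus (η := η) s.hτ.le 0 j

lemma decayNorm_ne_top (s : StepParams η γ N τ ρ A p) (hP : decayNorm η (τ + 4 * ρ) (-2) P ≤ p) :
    decayNorm η (τ + 4 * ρ) (-2) P ≠ ∞ := ne_top_of_le_ne_top s.hp hP

lemma decayNorm_generator (s : StepParams η γ N τ ρ A p)
    (h : NonRes η N γ ω D) (hP : decayNorm η (τ + 4 * ρ) (-2) P ≤ p) :
    decayNorm η (τ + ρ + ρ) 0 (generator η N ω D P) ≤ ENNReal.ofReal (A / γ) * p :=
  (decayNorm_generator_le s.width_pos (by linarith [s.hρ]) s.hγ h s.divisor_le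
    (s.decayNorm_ne_top hP)).trans (by gcongr)

lemma memH_generator (s : StepParams η γ N τ ρ A p)
    (h : NonRes η N γ ω D) (hP : decayNorm η (τ + 4 * ρ) (-2) P ≤ p) :
    decayNorm η (τ + ρ + ρ) 0 (generator η N ω D P) ≠ ∞ :=
  ne_top_of_le_ne_top (ENNReal.mul_ne_top ENNReal.ofReal_ne_top s.hp) (s.decayNorm_generator h hP)

lemma decayNorm_homRhs (s : StepParams η γ N τ ρ A p) {τ' : ℝ} (h0 : 0 < τ') (h1 : τ' ≤ τ + 4 * ρ)
    (hP : decayNorm η (τ + 4 * ρ) (-2) P ≤ p) :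
    decayNorm η τ' (-2) (homRhs η N P) ≤ 2 * p := by
  have h2 : decayNorm η τ' (-2) P ≤ p := (decayNorm_mono h1 le_rfl P).trans hP
  exact (decayNorm_homRhs_le h0 (bNorm_coeff_ne_top (η := η) h0 (by norm_num : (-2 : ℝ) ≤ 0)
    (ne_top_of_le_ne_top s.hp h2) 0)).trans (by gcongr)

lemma evSum_generator (s : StepParams η γ N τ ρ A p)
    (h : NonRes η N γ ω D) (hP : decayNorm η (τ + 4 * ρ) (-2) P ≤ p)
    (hφ : φ ∈ thickTorus η τ) : EvSum φ (generator η N ω D P) :=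
  evSum_of_decayNorm (σ := τ + ρ + ρ) (by linarith [s.hρ, s.hτ]) le_rfl (s.memH_generator h hP)
    (thickTorus_mono (by linarith [s.hρ]) hφ)

lemma evSum_perturbation (s : StepParams η γ N τ ρ A p)
    (hP : decayNorm η (τ + 4 * ρ) (-2) P ≤ p) (hφ : φ ∈ thickTorus η τ) :
    EvSum φ P :=
  evSum_of_decayNorm s.width_pos (by norm_num : (-2 : ℝ) ≤ 0) (s.decayNorm_ne_top hP)
    (thickTorus_mono (by linarith [s.hρ]) hφ)

lemma evSum_truncate (s : StepParams η γ N τ ρ A p)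
    (hP : decayNorm η (τ + 4 * ρ) (-2) P ≤ p) (hφ : φ ∈ thickTorus η τ) :
    EvSum φ (truncate η N P) :=
  s.evSum_perturbation ((decayNorm_truncate_le P).trans hP) hφ

lemma evSum_homRhs (s : StepParams η γ N τ ρ A p)
    (hP : decayNorm η (τ + 4 * ρ) (-2) P ≤ p) (hφ : φ ∈ thickTorus η τ) :
    EvSum φ (homRhs η N P) :=
  (evSum_ite_zero _).sub (s.evSum_truncate hP hφ)

lemma tsum_adSum_le (s : StepParams η γ N τ ρ A p)
    (h : NonRes η N γ ω D) (hP : decayNorm η (τ + 4 * ρ) (-2) P ≤ p)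
    {i : ℕ} (hi : 1 ≤ i) (X : TimeOp) :
    ∑' k, decayNorm η τ (-2) ((facCoeff i k : ℂ) • timeAd (generator η N ω D P) X (k + 1)) ≤
      2 * (ENNReal.ofReal (2 * shiftConst ρ) * (ENNReal.ofReal (A / γ) * p)) *
        decayNorm η τ (-2) X := by
  refine tsum_decayNorm_adSum_le s.hτ.le s.hρ.le (one_le_shiftConst s.hρ) (jap_neg_two_le s.hρ) ?_
    s.hq (facCoeff_mul_le hi) X
  gcongr
  exact (decayNorm_mono (by linarith [s.hρ]) le_rfl _).trans (s.decayNorm_generator h hP)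

lemma tsum_adSum_ne_top (s : StepParams η γ N τ ρ A p)
    (h : NonRes η N γ ω D) (hP : decayNorm η (τ + 4 * ρ) (-2) P ≤ p)
    {i : ℕ} (hi : 1 ≤ i) {X : TimeOp} (hX : decayNorm η τ (-2) X ≠ ∞) :
    ∑' k, decayNorm η τ (-2) ((facCoeff i k : ℂ) • timeAd (generator η N ω D P) X (k + 1)) ≠ ∞ :=
  ne_top_of_le_ne_top (ENNReal.mul_ne_top (ENNReal.mul_ne_top (by simp)
    (ne_top_of_le_ne_top (by simp) s.hq)) hX) (s.tsum_adSum_le h hP hi X)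

/-- The Fourier tail gains `e^{-4ρN}` and the commutator series gain a factor `q` proportional to `p
/ γ`. The constant is `6 = 2 + 2·2`, as the right-hand side `G` has size `2p`. -/
lemma decayNorm_stepP_le (s : StepParams η γ N τ ρ A p)
    (h : NonRes η N γ ω D) (hP : decayNorm η (τ + 4 * ρ) (-2) P ≤ p) :
    decayNorm η τ (-2) (stepP η N ω D P) ≤ (ENNReal.ofReal (Real.exp (-(4 * ρ * N))) +
      6 * (ENNReal.ofReal (2 * shiftConst ρ) * (ENNReal.ofReal (A / γ) * p))) * p := by
  have hρ := s.hρ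
  have h1 := decayNorm_sub_truncate_le (η := η) (N := N) (m := -2)
    (show τ ≤ τ + 4 * ρ by linarith) P
  rw [show τ + 4 * ρ - τ = 4 * ρ by ring] at h1
  have h2 : decayNorm η τ (-2) P ≤ p :=
    (decayNorm_mono (by linarith) le_rfl P).trans hP
  have h3 := s.decayNorm_homRhs s.hτ (by linarith) hP
  set q := ENNReal.ofReal (2 * shiftConst ρ) * (ENNReal.ofReal (A / γ) * p)
  calc decayNorm η τ (-2) (stepP η N ω D P)
      ≤ ENNReal.ofReal (Real.exp (-(4 * ρ * N))) * p + 2 * q * p + 2 * q * (2 * p) := by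
        refine (decayNorm_add_le _ _).trans (add_le_add ((decayNorm_add_le _ _).trans
          (add_le_add (h1.trans (by gcongr)) ?_)) ?_)
        · exact ((decayNorm_timeSum_le _).trans (s.tsum_adSum_le h hP le_rfl P)).trans (by gcongr)
        · exact ((decayNorm_timeSum_le _).trans (s.tsum_adSum_le h hP one_le_two _)).trans
            (by gcongr)
    _ = _ := by ring

lemma decayNorm_generator_sub (s : StepParams η γ N τ ρ A p)
    (h₁ : NonRes η N γ ω₁ D₁) (h₂ : NonRes η N γ ω₂ D₂)
    (hD : ∀ j, hsNorm (D₁ j - D₂ j) ≤ ‖ω₁ - ω₂‖)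
    (hP₁ : decayNorm η (τ + 4 * ρ) (-2) P₁ ≤ p) (hP₂ : decayNorm η (τ + 4 * ρ) (-2) P₂ ≤ p)
    (hP : decayNorm η (τ + 4 * ρ) 0 (P₁ - P₂) ≤ p * ENNReal.ofReal (‖ω₁ - ω₂‖ / γ)) :
    decayNorm η (τ + ρ + ρ) 2 (generator η N ω₁ D₁ P₁ - generator η N ω₂ D₂ P₂) ≤
      ENNReal.ofReal (A / γ) * p * ENNReal.ofReal (‖ω₁ - ω₂‖ / γ) :=
  decayNorm_generator_sub_le s.hη s.width_pos (by linarith [s.hρ]) s.hγ h₁ h₂ hD s.divisor_le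
    (s.decayNorm_ne_top hP₁) (s.decayNorm_ne_top hP₂) hP₂ hP

/-- Every increment carries the same factor `‖ω₁ - ω₂‖ / γ`, so the recursion for increments has the
form of the one for sizes, with `12 = 4 + 4·2` in place of `6`. -/
lemma decayNorm_stepP_sub_le (s : StepParams η γ N τ ρ A p)
    (h₁ : NonRes η N γ ω₁ D₁) (h₂ : NonRes η N γ ω₂ D₂)
    (hD : ∀ j, hsNorm (D₁ j - D₂ j) ≤ ‖ω₁ - ω₂‖)
    (hP₁ : decayNorm η (τ + 4 * ρ) (-2) P₁ ≤ p) (hP₂ : decayNorm η (τ + 4 * ρ) (-2) P₂ ≤ p)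
    (hP : decayNorm η (τ + 4 * ρ) 0 (P₁ - P₂) ≤ p * ENNReal.ofReal (‖ω₁ - ω₂‖ / γ)) :
    decayNorm η τ 0 (stepP η N ω₁ D₁ P₁ - stepP η N ω₂ D₂ P₂) ≤
      (ENNReal.ofReal (Real.exp (-(4 * ρ * N))) +
        12 * (ENNReal.ofReal (2 * shiftConst ρ) * (ENNReal.ofReal (A / γ) * p))) *
        (p * ENNReal.ofReal (‖ω₁ - ω₂‖ / γ)) := by
  have hρ := s.hρ
  have hτ := s.hτ
  set v := ENNReal.ofReal (‖ω₁ - ω₂‖ / γ)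
  set F₁ := generator η N ω₁ D₁ P₁ with hF₁
  set F₂ := generator η N ω₂ D₂ P₂ with hF₂
  set q := ENNReal.ofReal (2 * shiftConst ρ) * (ENNReal.ofReal (A / γ) * p) with hq
  have h0 := s.zero_mem_thickTorus
  have f1 : ENNReal.ofReal (2 * shiftConst ρ) * decayNorm η (τ + ρ + ρ) 0 F₁ ≤ q := by
    exact mul_le_mul' le_rfl (s.decayNorm_generator h₁ hP₁)
  have f2 : ENNReal.ofReal (2 * shiftConst ρ) * decayNorm η (τ + ρ + ρ) 0 F₂ ≤ q := by
    exact mul_le_mul' le_rfl (s.decayNorm_generator h₂ hP₂)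
  have f3 : ENNReal.ofReal (2 * shiftConst ρ) * decayNorm η (τ + ρ + ρ) 2 (F₁ - F₂) ≤ q * v := by
    rw [hq, mul_assoc]
    gcongr
    exact s.decayNorm_generator_sub h₁ h₂ hD hP₁ hP₂ hP
  have e1 := s.evSum_generator h₁ hP₁ h0
  have e2 := s.evSum_generator h₂ hP₂ h0
  have d1 : decayNorm η τ 0 (P₁ - P₂) ≤ p * v := (decayNorm_mono (by linarith) le_rfl _).trans hP
  have mono : ∀ {P : TimeOp} {τ' : ℝ}, τ' ≤ τ + 4 * ρ → decayNorm η (τ + 4 * ρ) (-2) P ≤ p →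
      decayNorm η τ' (-2) P ≤ p := fun h hP => (decayNorm_mono h le_rfl _).trans hP
  have fin : ∀ {P : TimeOp}, decayNorm η (τ + 4 * ρ) (-2) P ≤ p → bNorm τ 0 (P 0) ≠ ∞ :=
    fun {P} hP => bNorm_coeff_ne_top (η := η) hτ (by norm_num : (-2 : ℝ) ≤ 0)
      (ne_top_of_le_ne_top s.hp (mono (by linarith) hP)) 0
  have a1 := decayNorm_adSum_sub_le hτ hρ s.hq s.hp f1 f2 f3 (mono (by linarith) hP₁)
    (mono (by linarith) hP₂) d1 e1 e2 (s.evSum_perturbation hP₁ h0) (s.evSum_perturbation hP₂ h0)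
    (facCoeff_mul_le le_rfl)
  have d2 : decayNorm η τ 0 (homRhs η N P₁ - homRhs η N P₂) ≤ 2 * p * v := by
    rw [mul_assoc]
    exact (decayNorm_homRhs_sub_le hτ (fin hP₁) (fin hP₂)).trans (by gcongr)
  have a2 := decayNorm_adSum_sub_le hτ hρ s.hq (ENNReal.mul_ne_top (by simp) s.hp) f1 f2 f3
    (s.decayNorm_homRhs (by linarith) (by linarith) hP₁)
    (s.decayNorm_homRhs (by linarith) (by linarith) hP₂) d2 e1 e2 (s.evSum_homRhs hP₁ h0)
    (s.evSum_homRhs hP₂ h0) (facCoeff_mul_le one_le_two)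
  have t1 := decayNorm_sub_truncate_le (η := η) (N := N) (m := 0)
    (show τ ≤ τ + 4 * ρ by linarith) (P₁ - P₂)
  rw [show τ + 4 * ρ - τ = 4 * ρ by ring] at t1
  have e : stepP η N ω₁ D₁ P₁ - stepP η N ω₂ D₂ P₂ =
      (P₁ - P₂ - truncate η N (P₁ - P₂)) +
      (adSum (fun k => (facCoeff 1 k : ℂ)) F₁ P₁ - adSum (fun k => (facCoeff 1 k : ℂ)) F₂ P₂) +
      (adSum (fun k => (facCoeff 2 k : ℂ)) F₁ (homRhs η N P₁) -
        adSum (fun k => (facCoeff 2 k : ℂ)) F₂ (homRhs η N P₂)) := by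
    rw [← truncate_sub, stepP, stepP]; abel
  rw [e]
  calc _ ≤ ENNReal.ofReal (Real.exp (-(4 * ρ * N))) * (p * v) + 4 * q * (p * v) +
        4 * q * (2 * p * v) := by
        refine (decayNorm_add_le _ _).trans (add_le_add ((decayNorm_add_le _ _).trans
          (add_le_add (t1.trans (by gcongr)) a1)) a2)
    _ = _ := by ring

end StepParams

/-! ### Skew self-adjointness is preserved -/

lemma isHermitian_stepD (hD : ∀ j, (D j).IsHermitian)
    (hP : ContinuousLinearMap.adjoint (P 0) = -P 0) (j : ℕ) : (stepD D P j).IsHermitian := by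
  have h : (blockOf (P 0) j j).conjTranspose = -blockOf (P 0) j j := by
    rw [← blockOf_adjoint, hP, blockOf_neg]
  have e : star Complex.I = -Complex.I := Complex.conj_I
  rw [Matrix.IsHermitian, stepD, Matrix.conjTranspose_sub, Matrix.conjTranspose_smul, (hD j).eq, h,
    e, neg_smul_neg]

namespace StepParams

lemma skewAdj_coeff (s : StepParams η γ N τ ρ A p)
    (hω : ω ∈ diophSet γ) (hP : decayNorm η (τ + 4 * ρ) (-2) P ≤ p)
    (hsk : SkewAdj P) (l : Idx) : ContinuousLinearMap.adjoint (P (-l)) = -P l :=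
  hsk.coeff s.hγ hω (s.evSum_perturbation hP s.zero_mem_thickTorus) l

lemma skewAdj_generator (s : StepParams η γ N τ ρ A p) (hω : ω ∈ diophSet γ) (h : NonRes η N γ ω D)
    (hD : ∀ j, (D j).IsHermitian) (hP : decayNorm η (τ + 4 * ρ) (-2) P ≤ p) (hsk : SkewAdj P) :
    SkewAdj (generator η N ω D P) :=
  skewAdj_of_coeff (s.evSum_generator h hP s.zero_mem_thickTorus)
    (adjoint_generator s.width_pos s.hγ h hD (s.decayNorm_ne_top hP) (s.skewAdj_coeff hω hP hsk))

lemma skewAdj_stepP (s : StepParams η γ N τ ρ A p) (hω : ω ∈ diophSet γ) (h : NonRes η N γ ω D)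
    (hD : ∀ j, (D j).IsHermitian) (hP : decayNorm η (τ + 4 * ρ) (-2) P ≤ p) (hsk : SkewAdj P) :
    SkewAdj (stepP η N ω D P) := by
  have h0 := s.zero_mem_thickTorus
  have hm : (-2 : ℝ) ≤ 0 := by norm_num
  have hc := s.skewAdj_coeff hω hP hsk
  have eP := s.evSum_perturbation hP h0
  have eF := s.evSum_generator h hP h0
  have eT := s.evSum_truncate hP h0
  have eG := s.evSum_homRhs hP h0
  have kF := s.skewAdj_generator hω h hD hP hsk
  have kT : SkewAdj (truncate η N P) := skewAdj_of_coeff eT (adjoint_truncate hc)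
  have kR : SkewAdj (resonant P) := skewAdj_of_coeff (evSum_ite_zero _)
    (adjoint_resonant s.width_pos hm (s.decayNorm_ne_top hP) hc)
  have kG : SkewAdj (homRhs η N P) := kR.sub kT (evSum_ite_zero _) eT
  have n1 := s.tsum_adSum_ne_top h hP le_rfl (X := P) (ne_top_of_le_ne_top s.hp
    ((decayNorm_mono (by linarith [s.hρ]) le_rfl P).trans hP))
  have n2 := s.tsum_adSum_ne_top h hP one_le_two (ne_top_of_le_ne_top
    (ENNReal.mul_ne_top (by simp) s.hp) (s.decayNorm_homRhs s.hτ (by linarith [s.hρ]) hP))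
  have e1 : EvSum 0 (adSum (fun k => (facCoeff 1 k : ℂ)) (generator η N ω D P) P) :=
    evSum_of_decayNorm s.hτ hm (ne_top_of_le_ne_top n1 (decayNorm_timeSum_le _)) h0
  have e2 : EvSum 0 (adSum (fun k => (facCoeff 2 k : ℂ)) (generator η N ω D P) (homRhs η N P)) :=
    evSum_of_decayNorm s.hτ hm (ne_top_of_le_ne_top n2 (decayNorm_timeSum_le _)) h0
  exact ((hsk.sub kT eP eT).add (skewAdj_adSum s.hτ hm kF hsk eF eP _ n1) (eP.sub eT) e1).add
    (skewAdj_adSum s.hτ hm kF kG eF eG _ n2) ((eP.sub eT).add e1) e2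

/-! ### The conjugation -/

lemma evalAt_adSum (s : StepParams η γ N τ ρ A p)
    (h : NonRes η N γ ω D) (hP : decayNorm η (τ + 4 * ρ) (-2) P ≤ p)
    {i : ℕ} (hi : 1 ≤ i) {X : TimeOp} (hX : decayNorm η τ (-2) X ≠ ∞) (hφ : φ ∈ thickTorus η τ) :
    EvSum φ (adSum (fun k => (facCoeff i k : ℂ)) (generator η N ω D P) X) ∧
    HasSum (fun k => ((k + i).factorial : ℂ)⁻¹ •
      (rightAd (evalAt (generator η N ω D P) φ))^[k + 1] (evalAt X φ))
      (evalAt (adSum (fun k => (facCoeff i k : ℂ)) (generator η N ω D P) X) φ) := by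
  have hm : (-2 : ℝ) ≤ 0 := by norm_num
  have n1 := s.tsum_adSum_ne_top h hP hi hX
  refine ⟨evSum_of_decayNorm s.hτ hm (ne_top_of_le_ne_top n1 (decayNorm_timeSum_le _)) hφ, ?_⟩
  refine (hasSum_evalAt_timeSum s.hτ hm n1 hφ).congr_fun fun k => ?_
  rw [evalAt_smul, evalAt_timeAd (s.evSum_generator h hP hφ) (evSum_of_decayNorm s.hτ hm hX hφ),
    facCoeff]
  simp

/-- The terms `k = 0` of the two series add up to `P + G`, that is, to the Fourier tail plus the
resonant part; the remaining terms are the two commutator sums in `stepP`. -/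
lemma evalAt_stepP_add (s : StepParams η γ N τ ρ A p)
    (h : NonRes η N γ ω D) (hP : decayNorm η (τ + 4 * ρ) (-2) P ≤ p)
    (hφ : φ ∈ thickTorus η τ) :
    evalAt (stepP η N ω D P) φ + diagPart (P 0) =
      (∑' k : ℕ, (k.factorial : ℂ)⁻¹ •
        (rightAd (evalAt (generator η N ω D P) φ))^[k] (evalAt P φ)) +
      ∑' k : ℕ, ((k + 1).factorial : ℂ)⁻¹ •
        (rightAd (evalAt (generator η N ω D P) φ))^[k] (evalAt (homRhs η N P) φ) := by
  have eP := s.evSum_perturbation hP hφ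
  have eT := s.evSum_truncate hP hφ
  obtain ⟨e1, h1⟩ := s.evalAt_adSum h hP le_rfl (X := P) (ne_top_of_le_ne_top s.hp
    ((decayNorm_mono (by linarith [s.hρ]) le_rfl P).trans hP)) hφ
  obtain ⟨e2, h2⟩ := s.evalAt_adSum h hP one_le_two (ne_top_of_le_ne_top
    (ENNReal.mul_ne_top (by simp) s.hp) (s.decayNorm_homRhs s.hτ (by linarith [s.hρ]) hP)) hφ
  rw [(summable_norm_adSeries (evalAt (generator η N ω D P) φ) (evalAt P φ)
      (fun k => (k.factorial : ℂ)⁻¹) fun k => (norm_inv_factorial k).le).of_norm.tsum_eq_zero_add,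
    (summable_norm_adSeries (evalAt (generator η N ω D P) φ) (evalAt (homRhs η N P) φ)
      (fun k => ((k + 1).factorial : ℂ)⁻¹) norm_inv_factorial_succ_le).of_norm.tsum_eq_zero_add]
  have t2 : ∑' k : ℕ, ((k + 1 + 1).factorial : ℂ)⁻¹ • (rightAd (evalAt (generator η N ω D P) φ))^[k + 1]
      (evalAt (homRhs η N P) φ) = _ := h2.tsum_eq
  rw [h1.tsum_eq, t2, stepP, evalAt_add ((eP.sub eT).add e1) e2, evalAt_add (eP.sub eT) e1,
    evalAt_sub eP eT]
  have hG : evalAt (homRhs η N P) φ = diagPart (P 0) - evalAt (truncate η N P) φ := by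
    rw [homRhs, evalAt_sub (R := resonant P) (evSum_ite_zero _) eT]
    congr 1
    exact evalAt_ite_zero _
  simp only [Function.iterate_zero, id, hG, Nat.factorial_zero, zero_add, Nat.factorial_one,
    Nat.cast_one, inv_one, one_smul]
  abel

lemma hasComm_generator (s : StepParams η γ N τ ρ A p)
    (h : NonRes η N γ ω D) (hP : decayNorm η (τ + 4 * ρ) (-2) P ≤ p)
    (hφ : φ ∈ thickTorus η τ) :
    HasComm D (evalAt (generator η N ω D P) φ) (evalAt (omegaDeriv ω (generator η N ω D P)) φ +
      evalAt (homRhs η N P) φ) := by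
  have hd : decayNorm η (τ + ρ) 0 (omegaDeriv ω (generator η N ω D P)) ≠ ∞ :=
    ne_top_of_le_ne_top (ENNReal.mul_ne_top ENNReal.ofReal_ne_top (s.memH_generator h hP))
      (decayNorm_omegaDeriv_le s.hη s.hρ ω _)
  have ed : EvSum φ (omegaDeriv ω (generator η N ω D P)) := evSum_of_decayNorm
    (by linarith [s.hτ, s.hρ]) le_rfl hd (thickTorus_mono (by linarith [s.hρ]) hφ)
  refine HasComm.hasSum (fun l => ?_) (s.evSum_generator h hP hφ).hasSum
    (ed.hasSum.add (s.evSum_homRhs hP hφ).hasSum)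
  rw [← smul_add]
  exact (hasComm_of_blocks (homological_blocks s.width_pos s.hγ s.hN h
    (s.decayNorm_ne_top hP) l)).smul _

lemma vectorField_stepP (s : StepParams η γ N τ ρ A p)
    (h : NonRes η N γ ω D) (hP : decayNorm η (τ + 4 * ρ) (-2) P ≤ p)
    (hφ : φ ∈ thickTorus η τ) :
    vectorField (stepD D P) (evalAt (stepP η N ω D P) φ) =
      pushForward ω (timeExp (generator η N ω D P)) (fun ψ => vectorField D (evalAt P ψ)) φ := by
  have hF := s.memH_generator h hP
  have hF' : decayNorm η (τ + ρ) 0 (generator η N ω D P) ≠ ∞ :=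
    ne_top_of_le_ne_top hF (decayNorm_mono (by linarith [s.hρ]) le_rfl _)
  have hb := blockOf_diagPart s.width_pos (bNorm_coeff_ne_top s.width_pos
    (by norm_num : (-2 : ℝ) ≤ 0) (s.decayNorm_ne_top hP) 0)
  rw [pushForward, evalAt_timeExp s.hτ
    (ne_top_of_le_ne_top hF' (decayNorm_mono (by linarith [s.hρ]) le_rfl _)) hφ]
  refine vectorField_eq_conjOp (s.hasComm_generator h hP hφ)
    (hasSum_omegaDeriv_timeExp s.hη s.hτ s.hρ ω hF' hφ) (Z := diagPart (P 0))
    (mem_blockDiagGraph_perturb (fun j j' hj => ?_) fun j => ?_) (s.evalAt_stepP_add h hP hφ)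
  · rw [hb, if_neg hj]
  · rw [hb, if_pos rfl, stepD]

end StepParams

end Step


/-! ### The widths -/

/-- A quarter of the width lost at the `n`-th step. -/
def widthLoss (σ₀ : ℝ) (n : ℕ) : ℝ := σ₀ / (16 * Real.pi) / (n + 1 : ℝ) ^ 2

section Widths

variable {σ₀ : ℝ}

lemma widthLoss_pos (hσ₀ : 0 < σ₀) (n : ℕ) : 0 < widthLoss σ₀ n := by
  have := Real.pi_pos
  rw [widthLoss]; positivity

lemma sigmaSeq_eq_succ_add (σ₀ : ℝ) (n : ℕ) :
    sigmaSeq σ₀ n = sigmaSeq σ₀ (n + 1) + 4 * widthLoss σ₀ n := by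
  have := Real.pi_pos
  rw [sigmaSeq, sigmaSeq, widthLoss, Finset.sum_Icc_succ_top (by omega)]
  push_cast
  field_simp
  ring

lemma sum_inv_sq_succ_le (n : ℕ) :
    ∑ j ∈ Finset.Icc 1 (n + 1), 1 / (j : ℝ) ^ 2 ≤ 2 - 1 / ((n : ℝ) + 1) := by
  induction n with
  | zero => norm_num
  | succ n ih =>
    rw [Finset.sum_Icc_succ_top (by omega)]
    push_cast
    have h : 1 / ((n : ℝ) + 1 + 1) ^ 2 ≤ 1 / (n + 1) - 1 / (n + 1 + 1) := by
      rw [div_sub_div _ _ (by positivity) (by positivity), div_le_div_iff₀ (by positivity)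
        (by positivity)]
      nlinarith [(Nat.cast_nonneg n : (0 : ℝ) ≤ n)]
    linarith

lemma sigmaSeq_pos (hσ₀ : 0 < σ₀) (n : ℕ) : 0 < sigmaSeq σ₀ n := by
  have hpi := Real.pi_gt_three
  have h1 : ∑ j ∈ Finset.Icc 1 n, 1 / (j : ℝ) ^ 2 ≤ 2 := by
    have h2 := sum_inv_sq_succ_le n
    rw [Finset.sum_Icc_succ_top (by omega)] at h2
    have h3 : 0 ≤ 1 / (((n + 1 : ℕ) : ℝ)) ^ 2 := by positivity
    have h4 : 0 ≤ 1 / ((n : ℝ) + 1) := by positivity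
    linarith
  refine mul_pos hσ₀ (sub_pos.2 ?_)
  rw [one_div_mul_eq_div, div_lt_one (by positivity)]
  linarith

/-- The truncation error is compatible with the superexponential convergence. -/
lemma exp_cutoff_le {χ N₀ : ℝ} (hσ₀ : 0 < σ₀) (hχ₁ : 1 < χ) (hχ₂ : χ < 2)
    (hN : 32 * Real.pi / σ₀ ≤ N₀) (n : ℕ) :
    Real.exp (-(4 * widthLoss σ₀ n * cutoff χ N₀ n)) ≤ Real.exp (-((χ - 1) * χ ^ n)) / 2 := by
  have hpi := Real.pi_pos
  have h1 : 1 ≤ χ ^ n := one_le_pow₀ hχ₁.le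
  have hj := one_le_jap n
  have hj2 : (n + 1 : ℝ) ≤ 2 * jap n := by
    have : (n : ℝ) ≤ jap n := le_max_right _ _
    linarith
  -- The lower bound `32π/σ₀` on `N₀` yields the factor `8`, and `⟨n⟩³ / (n+1)² ≥ 1/4`: the cubic
  -- growth in `N_n` beats the quadratic shrinking of the width. The exponent `2χ^n` leaves room for
  -- `(χ-1)χ^n + log 2`.
  have h2 : 2 * χ ^ n ≤ 4 * widthLoss σ₀ n * cutoff χ N₀ n := by
    have e : 4 * widthLoss σ₀ n * cutoff χ N₀ n =
        χ ^ n * (σ₀ * N₀ / (4 * Real.pi)) * (jap n ^ 3 / (n + 1 : ℝ) ^ 2) := by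
      rw [widthLoss, cutoff]; field_simp; norm_num
    have h3 : 8 ≤ σ₀ * N₀ / (4 * Real.pi) := by
      rw [le_div_iff₀ (by positivity)]
      rw [div_le_iff₀ hσ₀] at hN
      linarith
    have h4 : 1 / 4 ≤ jap n ^ 3 / (n + 1 : ℝ) ^ 2 := by
      rw [div_le_div_iff₀ (by norm_num) (by positivity)]
      have h5 : (n + 1 : ℝ) ^ 2 ≤ (2 * jap n) ^ 2 := by gcongr
      nlinarith [pow_pos (jap_pos n) 2]
    rw [e]
    calc 2 * χ ^ n = χ ^ n * 8 * (1 / 4) := by ring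
      _ ≤ _ := by gcongr
  have h3 : Real.exp (-((χ - 1) * χ ^ n)) / 2 =
      Real.exp (-((χ - 1) * χ ^ n) - Real.log 2) := by
    rw [Real.exp_sub, Real.exp_log (by norm_num)]
  rw [h3]
  refine Real.exp_le_exp.2 ?_
  have := Real.log_two_lt_d9
  nlinarith

end Widths

/-! ### The small divisors against the loss of width -/

section Divisors

variable {η a ρ T : ℝ} {m : ℕ}

/-- The left side is at most `(2y)^8`, and a logarithm is bounded by the small power `y^a / a`. -/
lemma one_add_pow_four_sq_le {y : ℝ} (hy : 1 ≤ y) (ha : 0 < a)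
    (ha1 : 2 * a ≤ 1) (hTρ : 16 / a ≤ ρ * T) :
    (1 + y ^ 4) ^ 2 ≤ Real.exp (ρ * T * y ^ a) := by
  have h1 : (1 + y ^ 4) ^ 2 ≤ (2 * y) ^ 8 := by
    have : 1 ≤ y ^ 4 := one_le_pow₀ hy
    calc (1 + y ^ 4) ^ 2 ≤ (y ^ 4 + y ^ 4) ^ 2 := by gcongr
      _ = 4 * y ^ 8 := by ring
      _ ≤ 256 * y ^ 8 := by gcongr; norm_num
      _ = _ := by ring
  have h2 : Real.log (2 * y) ≤ (2 * y) ^ a / a := Real.log_le_rpow_div (by linarith) ha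
  have h3 : (2 * y) ^ a ≤ 2 * y ^ a := by
    rw [Real.mul_rpow (by norm_num) (by linarith)]
    gcongr
    calc (2 : ℝ) ^ a ≤ 2 ^ (1 : ℝ) := Real.rpow_le_rpow_of_exponent_le (by norm_num) (by linarith)
      _ = 2 := Real.rpow_one 2
  refine h1.trans ?_
  rw [← Real.exp_log (show 0 < (2 * y) ^ 8 by positivity), Real.log_pow]
  refine Real.exp_le_exp.2 ?_
  have hy0 : 0 < y ^ a := Real.rpow_pos_of_pos (by linarith) a
  calc (8 : ℕ) * Real.log (2 * y) ≤ 8 * (2 * y ^ a / a) := by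
        push_cast
        gcongr
        exact h2.trans (by gcongr)
    _ = 16 / a * y ^ a := by ring
    _ ≤ ρ * T * y ^ a := by gcongr

/-- With `z = (x j)^a` one has `z² ≤ j^η x`, because `2a ≤ min(η, 1)`. If `j ≥ T^m` then `z ≥ T`, so
`T z ≤ z²` and nothing is lost; otherwise `T z ≤ z² + T²`, and there are at most `T^m` such `j`. -/
lemma exponent_le {x j : ℝ} (hx : 1 ≤ x) (hj : 1 ≤ j) (ha : 0 < a) (hρ : 0 < ρ)
    (ha1 : 2 * a ≤ 1) (ha2 : 2 * a ≤ η) (hT : 1 ≤ T) (hm : 1 ≤ a * m) :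
    ρ * T * (x * j) ^ a ≤ ρ * (j ^ η * x) + if j < T ^ m then ρ * T ^ 2 else 0 := by
  have h1 : ((x * j) ^ a) ^ 2 ≤ j ^ η * x := by
    rw [← Real.rpow_two, ← Real.rpow_mul (by positivity), Real.mul_rpow (by linarith) (by linarith),
      mul_comm]
    refine mul_le_mul (Real.rpow_le_rpow_of_exponent_le hj (by linarith)) ?_ (by positivity)
      (by positivity)
    · calc x ^ (a * 2) ≤ x ^ (1 : ℝ) := Real.rpow_le_rpow_of_exponent_le hx (by linarith)
        _ = x := Real.rpow_one x
  have hy0 : 0 < (x * j) ^ a := Real.rpow_pos_of_pos (by positivity) a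
  have h2 : ρ * ((x * j) ^ a) ^ 2 ≤ ρ * (j ^ η * x) := by gcongr
  split_ifs with hjT
  · nlinarith [sq_nonneg ((x * j) ^ a - T), mul_pos hρ hy0]
  · rw [add_zero]
    refine le_trans ?_ h2
    have h3 : T ≤ (x * j) ^ a := by
      calc T = T ^ (1 : ℝ) := (Real.rpow_one T).symm
        _ ≤ T ^ (m * a) := Real.rpow_le_rpow_of_exponent_le hT (by linarith)
        _ = (T ^ m) ^ a := by rw [Real.rpow_mul (by linarith), Real.rpow_natCast]
        _ ≤ (x * j) ^ a := by
            refine Real.rpow_le_rpow (by positivity) ?_ ha.le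
            nlinarith [not_lt.1 hjT]
    rw [mul_assoc, sq]
    gcongr

lemma sum_ite_lt_le (s : Finset ℕ+) {L b : ℝ} (hL : 0 ≤ L) (hb : 0 ≤ b) :
    ∑ j ∈ s, (if ((j : ℕ) : ℝ) < L then b else 0) ≤ L * b := by
  rw [← Finset.sum_filter, Finset.sum_const, nsmul_eq_mul]
  gcongr
  have h : (s.filter fun j : ℕ+ => ((j : ℕ) : ℝ) < L).card ≤ (Finset.Icc 1 ⌊L⌋₊).card := by
    refine Finset.card_le_card_of_injOn (fun j : ℕ+ => (j : ℕ)) (fun j hj => ?_)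
      PNat.coe_injective.injOn
    have h1 := (Finset.mem_filter.1 hj).2
    exact Finset.mem_coe.2 (Finset.mem_Icc.2 ⟨j.2, Nat.le_floor h1.le⟩)
  rw [Nat.card_Icc, Nat.add_sub_cancel] at h
  exact (Nat.cast_le.2 h).trans (Nat.floor_le hL)

lemma smallDiv_sq_le (ha : 0 < a) (hρ : 0 < ρ) (ha1 : 2 * a ≤ 1) (ha2 : 2 * a ≤ η) (hT : 1 ≤ T)
    (hTρ : 16 / a ≤ ρ * T) (hm : 1 ≤ a * m) (l : Idx) :
    smallDiv l ^ 2 ≤ Real.exp (ρ * l.wt η + T ^ m * (ρ * T ^ 2)) := by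
  rw [smallDiv, Finsupp.prod, ← Finset.prod_pow]
  calc _ ≤ ∏ j ∈ l.support, Real.exp (ρ * (((j : ℕ) : ℝ) ^ η * |(l j : ℝ)|) +
        if ((j : ℕ) : ℝ) < T ^ m then ρ * T ^ 2 else 0) := by
        refine Finset.prod_le_prod (fun j _ => by positivity) fun j hj => ?_
        have hx : 1 ≤ |(l j : ℝ)| := by
          have : l j ≠ 0 := Finsupp.mem_support_iff.1 hj
          exact_mod_cast Int.one_le_abs this
        have hj1 : (1 : ℝ) ≤ ((j : ℕ) : ℝ) := by exact_mod_cast j.2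
        rw [← mul_pow]
        exact (one_add_pow_four_sq_le (one_le_mul_of_one_le_of_one_le hx hj1) ha ha1 hTρ).trans
          (Real.exp_le_exp.2 (exponent_le hx hj1 ha hρ ha1 ha2 hT hm))
    _ ≤ _ := by
        rw [← Real.exp_sum, Finset.sum_add_distrib, ← Finset.mul_sum]
        refine Real.exp_le_exp.2 (add_le_add le_rfl (sum_ite_lt_le _ (by positivity)
          (by positivity)))

/-- One portion `ρ` of the width pays for the squared divisor, the other for the factor `|ℓ|_η + 2`.
-/
lemma divisor_bound (ha : 0 < a) (hρ : 0 < ρ) (ha1 : 2 * a ≤ 1) (ha2 : 2 * a ≤ η) (hT : 1 ≤ T)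
    (hTρ : 16 / a ≤ ρ * T) (hm : 1 ≤ a * m) (l : Idx) :
    2 * smallDiv l ^ 2 * (l.wt η + 2) ≤
      2 * (1 / ρ + 2) * Real.exp (T ^ m * (ρ * T ^ 2)) * Real.exp (2 * ρ * l.wt η) := by
  have hw := Idx.wt_nonneg η l
  have h1 := smallDiv_sq_le ha hρ ha1 ha2 hT hTρ hm l
  have h2 : l.wt η + 2 ≤ (1 / ρ + 2) * Real.exp (ρ * l.wt η) := by
    have h3 := Real.add_one_le_exp (ρ * l.wt η)
    have h4 : l.wt η = 1 / ρ * (ρ * l.wt η) := by field_simp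
    have h5 : 0 < 1 / ρ := by positivity
    have h6 := Real.one_le_exp (mul_nonneg hρ.le hw)
    nlinarith
  calc 2 * smallDiv l ^ 2 * (l.wt η + 2)
      ≤ 2 * Real.exp (ρ * l.wt η + T ^ m * (ρ * T ^ 2)) *
        ((1 / ρ + 2) * Real.exp (ρ * l.wt η)) := by gcongr
    _ = _ := by
        rw [Real.exp_add, show 2 * ρ * l.wt η = ρ * l.wt η + ρ * l.wt η by ring,
          Real.exp_add (ρ * l.wt η) (ρ * l.wt η)]
        ring

lemma exists_poly_le_pow {χ κ : ℝ} (hχ : 1 < χ) (hκ : 0 < κ) (Q : ℝ) (k : ℕ) :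
    ∃ B : ℝ, ∀ n : ℕ, Q * (n + 1 : ℝ) ^ k ≤ κ * χ ^ n + B := by
  have h := (tendsto_pow_const_div_const_pow_of_one_lt k hχ).comp (Filter.tendsto_add_atTop_nat 1)
  have h1 := (h.const_mul (Q * χ)).eventually_le_const (u := κ) (by simpa using hκ)
  have h2 : ∀ᶠ n : ℕ in Filter.atTop, Q * (n + 1 : ℝ) ^ k - κ * χ ^ n ≤ 0 := by
    filter_upwards [h1] with n hn
    have hp : 0 < χ ^ n := by positivity
    simp only [Function.comp_apply] at hn
    push_cast at hn
    rw [pow_succ] at hn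
    have e : Q * χ * ((n + 1 : ℝ) ^ k / (χ ^ n * χ)) = Q * (n + 1 : ℝ) ^ k / χ ^ n := by
      field_simp
    rw [e, div_le_iff₀ hp] at hn
    linarith
  obtain ⟨B, hB⟩ := (Filter.isBoundedUnder_of_eventually_le h2).bddAbove_range
  exact ⟨B, fun n => by linarith [hB ⟨n, rfl⟩]⟩

/-- The small divisors cost a factor that grows slower than any `e^{κ χ^n}`. -/
lemma exists_divisor_bound {σ₀ χ κ : ℝ} (hη : 0 < η) (hσ₀ : 0 < σ₀) (hχ : 1 < χ) (hκ : 0 < κ) :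
    ∃ (M : ℝ) (A : ℕ → ℝ), 0 < M ∧ (∀ n, 0 ≤ A n) ∧
      (∀ n (l : Idx), 2 * smallDiv l ^ 2 * (l.wt η + 2) ≤
        A n * Real.exp (2 * widthLoss σ₀ n * l.wt η)) ∧
      ∀ n, shiftConst (widthLoss σ₀ n) * A n ≤ M * Real.exp (κ * χ ^ n) := by
  have hpi := Real.pi_pos
  -- This exponent satisfies `2a ≤ 1` and `2a ≤ η`, as needed to compare `(|ℓ_j| j)^{2a}` with `j^η
  -- |ℓ_j|`.
  set a := min η 1 / 2 with ha
  have ha0 : 0 < a := by rw [ha]; have := lt_min hη one_pos; positivity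
  have ha1 : 2 * a ≤ 1 := by rw [ha]; linarith [min_le_right η 1]
  have ha2 : 2 * a ≤ η := by rw [ha]; linarith [min_le_left η 1]
  obtain ⟨m, hm⟩ := exists_nat_ge (1 / a)
  have hm : 1 ≤ a * m := by rw [div_le_iff₀ ha0] at hm; linarith
  set b := σ₀ / (16 * Real.pi) with hb
  have hb0 : 0 < b := by rw [hb]; positivity
  set t := max 1 (16 / (a * b)) with ht
  have ht1 : 1 ≤ t := le_max_left _ _
  have htb : 16 / a ≤ b * t := by
    have : 16 / (a * b) ≤ t := le_max_right _ _
    rw [div_le_iff₀ (by positivity)] at this ⊢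
    linarith
  -- With `ρ_n = b/(n+1)²` and `T_n = t (n+1)²`, the logarithm of the total cost is polynomial in `n
  -- + 1`. Its pieces have degree at most `6`, `2m + 2` and `0`, all dominated by degree `2m + 6`,
  -- and a polynomial is beaten by `κ χ^n`.
  obtain ⟨B, hB⟩ := exists_poly_le_pow hχ hκ
    (8 * (1 / b + 2) * (1 / b) ^ 2 + t ^ m * (b * t ^ 2) + b) (2 * m + 6)
  refine ⟨Real.exp B, fun n => 2 * (1 / widthLoss σ₀ n + 2) *
    Real.exp ((t * (n + 1 : ℝ) ^ 2) ^ m * (widthLoss σ₀ n * (t * (n + 1 : ℝ) ^ 2) ^ 2)),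
    Real.exp_pos _, fun n => ?_, fun n l => ?_, fun n => ?_⟩
  · have := widthLoss_pos hσ₀ n
    positivity
  · have hn : 1 ≤ (n + 1 : ℝ) ^ 2 := one_le_pow₀ (by linarith [(Nat.cast_nonneg n : (0 : ℝ) ≤ n)])
    refine divisor_bound ha0 (widthLoss_pos hσ₀ n) ha1 ha2
      (one_le_mul_of_one_le_of_one_le ht1 hn) ?_ hm l
    refine htb.trans_eq ?_
    change b * t = b / (n + 1 : ℝ) ^ 2 * (t * (n + 1 : ℝ) ^ 2)
    field_simp
  · have hw : widthLoss σ₀ n = b / (n + 1 : ℝ) ^ 2 := rfl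
    set y : ℝ := n + 1 with hy
    have hy1 : 1 ≤ y := by rw [hy]; linarith [(Nat.cast_nonneg n : (0 : ℝ) ≤ n)]
    have hy0 : 0 < y := by linarith
    rw [shiftConst, hw, ← Real.exp_add]
    set r := 1 / (b / y ^ 2) with hr
    have hr' : r = 1 / b * y ^ 2 := by rw [hr]; field_simp
    have h1 : 8 * (r + 2) * r ^ 2 ≤ 8 * (1 / b + 2) * (1 / b) ^ 2 * y ^ (2 * m + 6) := by
      rw [hr']
      calc 8 * (1 / b * y ^ 2 + 2) * (1 / b * y ^ 2) ^ 2
          ≤ 8 * (1 / b * y ^ 2 + 2 * y ^ 2) * (1 / b * y ^ 2) ^ 2 := by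
            gcongr; nlinarith [one_le_pow₀ hy1 (n := 2)]
        _ = 8 * (1 / b + 2) * (1 / b) ^ 2 * y ^ 6 := by ring
        _ ≤ _ := by gcongr; omega
    have h2 : (t * y ^ 2) ^ m * (b / y ^ 2 * (t * y ^ 2) ^ 2) ≤
        t ^ m * (b * t ^ 2) * y ^ (2 * m + 6) := by
      calc (t * y ^ 2) ^ m * (b / y ^ 2 * (t * y ^ 2) ^ 2)
          = t ^ m * (b * t ^ 2) * y ^ (2 * m + 2) := by
            rw [mul_pow, ← pow_mul, pow_add]; field_simp
        _ ≤ _ := by gcongr; omega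
    have h3 : b / y ^ 2 ≤ b * y ^ (2 * m + 6) := by
      calc b / y ^ 2 ≤ b := div_le_self hb0.le (one_le_pow₀ hy1)
        _ ≤ _ := le_mul_of_one_le_right hb0.le (one_le_pow₀ hy1)
    have h4 : 8 * (r + 2) * r ^ 2 ≤ Real.exp (8 * (r + 2) * r ^ 2) :=
      (Real.add_one_le_exp _).trans' (by linarith)
    calc 4 / (b / y ^ 2) ^ 2 * Real.exp (b / y ^ 2) * (2 * (r + 2) *
          Real.exp ((t * y ^ 2) ^ m * (b / y ^ 2 * (t * y ^ 2) ^ 2)))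
        = 8 * (r + 2) * r ^ 2 * Real.exp ((t * y ^ 2) ^ m * (b / y ^ 2 * (t * y ^ 2) ^ 2)) *
            Real.exp (b / y ^ 2) := by rw [hr]; ring
      _ ≤ Real.exp (8 * (r + 2) * r ^ 2) *
            Real.exp ((t * y ^ 2) ^ m * (b / y ^ 2 * (t * y ^ 2) ^ 2)) * Real.exp (b / y ^ 2) := by
          gcongr
      _ = Real.exp (8 * (r + 2) * r ^ 2 + (t * y ^ 2) ^ m * (b / y ^ 2 * (t * y ^ 2) ^ 2) +
            b / y ^ 2) := by rw [Real.exp_add, Real.exp_add]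
      _ ≤ _ := by
          refine Real.exp_le_exp.2 ?_
          linarith [hB n]

end Divisors

/-! ### The superexponentially decaying sequence -/

lemma summable_exp_neg_pow {χ : ℝ} (hχ : 1 < χ) : Summable fun n : ℕ => Real.exp (-χ ^ n) := by
  have h1 : Real.exp (-(χ - 1)) < 1 := 
    (Real.exp_lt_exp.2 (by linarith)).trans_eq Real.exp_zero
  refine Summable.of_nonneg_of_le (fun _ => (Real.exp_pos _).le) (fun n => ?_)
    (summable_geometric_of_lt_one (Real.exp_pos _).le h1)
  rw [← Real.exp_nat_mul]
  refine Real.exp_le_exp.2 ?_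
  have := one_add_mul_le_pow (show -2 ≤ χ - 1 by linarith) n
  rw [add_sub_cancel] at this
  linarith


/-! ### Lipschitz extensions -/

section Extension

variable {Ω : Set Freq} {a b : ℝ}

/-- A bounded Lipschitz function on a subset extends with the same bounds. -/
lemma exists_lipschitz_extension {f : Freq → ℝ} (ha : 0 ≤ a) (hb : 0 ≤ b)
    (hf : ∀ ω ∈ Ω, |f ω| ≤ a) (hl : ∀ ω₁ ∈ Ω, ∀ ω₂ ∈ Ω, |f ω₁ - f ω₂| ≤ b * ‖ω₁ - ω₂‖) :
    ∃ g : Freq → ℝ, (∀ ω ∈ Ω, g ω = f ω) ∧ (∀ ω, |g ω| ≤ a) ∧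
      ∀ ω₁ ω₂, |g ω₁ - g ω₂| ≤ b * ‖ω₁ - ω₂‖ := by
  have h1 : LipschitzOnWith b.toNNReal f Ω := LipschitzOnWith.of_dist_le_mul fun x hx y hy => by
    rw [Real.coe_toNNReal b hb, Real.dist_eq, dist_eq_norm]
    exact hl x hx y hy
  obtain ⟨g, hg, hfg⟩ := h1.extend_real
  -- Clamping to `[-a, a]` restores the sup bound without increasing the Lipschitz constant.
  have h2 := (hg.const_min a).const_max (-a)
  refine ⟨fun ω => max (-a) (min a (g ω)), fun ω hω => ?_, fun ω => ?_, fun ω₁ ω₂ => ?_⟩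
  · have h3 := abs_le.1 (hf ω hω)
    simp only
    rw [← hfg hω, min_eq_right h3.2, max_eq_right h3.1]
  · exact abs_le.2 ⟨le_max_left _ _, max_le (by linarith) (min_le_left _ _)⟩
  · have h3 := h2.dist_le_mul ω₁ ω₂
    rwa [Real.coe_toNNReal b hb, Real.dist_eq, dist_eq_norm] at h3

/-- A bounded Lipschitz function with Hermitian values extends to one with Hermitian values. -/
lemma exists_hermitian_extension {j : ℕ} {X : Freq → Block j j} (ha : 0 ≤ a) (hb : 0 ≤ b)
    (hX : ∀ ω ∈ Ω, (X ω).IsHermitian) (hs : ∀ ω ∈ Ω, hsNorm (X ω) ≤ a)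
    (hl : ∀ ω₁ ∈ Ω, ∀ ω₂ ∈ Ω, hsNorm (X ω₁ - X ω₂) ≤ b * ‖ω₁ - ω₂‖) :
    ∃ Y : Freq → Block j j, (∀ ω, (Y ω).IsHermitian) ∧ (∀ ω ∈ Ω, Y ω = X ω) ∧
      (∀ ω, hsNorm (Y ω) ≤ 4 * a) ∧ ∀ ω₁ ω₂, hsNorm (Y ω₁ - Y ω₂) ≤ 4 * b * ‖ω₁ - ω₂‖ := by
  have hre : ∀ k k' : blockIdx j, ∃ g : Freq → ℝ, (∀ ω ∈ Ω, g ω = (X ω k k').re) ∧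
      (∀ ω, |g ω| ≤ a) ∧ ∀ ω₁ ω₂, |g ω₁ - g ω₂| ≤ b * ‖ω₁ - ω₂‖ := fun k k' =>
    exists_lipschitz_extension ha hb
      (fun ω hω => (Complex.abs_re_le_norm _).trans ((norm_entry_le_hsNorm _ k k').trans (hs ω hω)))
      fun ω₁ h₁ ω₂ h₂ => by
        rw [← Complex.sub_re]
        exact (Complex.abs_re_le_norm _).trans ((norm_entry_le_hsNorm (X ω₁ - X ω₂) k k').trans
          (hl ω₁ h₁ ω₂ h₂))
  have him : ∀ k k' : blockIdx j, ∃ g : Freq → ℝ, (∀ ω ∈ Ω, g ω = (X ω k k').im) ∧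
      (∀ ω, |g ω| ≤ a) ∧ ∀ ω₁ ω₂, |g ω₁ - g ω₂| ≤ b * ‖ω₁ - ω₂‖ := fun k k' =>
    exists_lipschitz_extension ha hb
      (fun ω hω => (Complex.abs_im_le_norm _).trans ((norm_entry_le_hsNorm _ k k').trans (hs ω hω)))
      fun ω₁ h₁ ω₂ h₂ => by
        rw [← Complex.sub_im]
        exact (Complex.abs_im_le_norm _).trans ((norm_entry_le_hsNorm (X ω₁ - X ω₂) k k').trans
          (hl ω₁ h₁ ω₂ h₂))
  choose g hg hga hgl using hre
  choose h hh hha hhl using him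
  let H : Freq → Block j j := fun ω => Matrix.of fun k k' => (g k k' ω : ℂ) + h k k' ω * Complex.I
  have entry : ∀ {x y c : ℝ}, |x| ≤ c → |y| ≤ c → ‖(x : ℂ) + y * Complex.I‖ ≤ 2 * c := by
    intro x y c hx hy
    refine (norm_add_le _ _).trans ?_
    rw [norm_mul, Complex.norm_I, mul_one, Complex.norm_real, Complex.norm_real, Real.norm_eq_abs,
      Real.norm_eq_abs]
    linarith
  have hHX : ∀ ω ∈ Ω, H ω = X ω := fun ω hω => by
    ext k k'
    simp only [H, Matrix.of_apply, hg k k' ω hω, hh k k' ω hω, Complex.re_add_im]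
  -- One factor `2` comes from adding real and imaginary parts, the other from the Hilbert–Schmidt
  -- norm of a matrix of size at most `2 × 2`.
  have hHa : ∀ ω, hsNorm (H ω) ≤ 4 * a := fun ω => by
    refine (hsNorm_le_of_entry_le (H ω) (a := 2 * a) (by linarith) fun k k' =>
      entry (hga k k' ω) (hha k k' ω)).trans (by linarith)
  have hHl : ∀ ω₁ ω₂, hsNorm (H ω₁ - H ω₂) ≤ 4 * b * ‖ω₁ - ω₂‖ := fun ω₁ ω₂ => by
    refine (hsNorm_le_of_entry_le (H ω₁ - H ω₂) (a := 2 * (b * ‖ω₁ - ω₂‖)) (by positivity)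
      fun k k' => ?_).trans (by linarith)
    have e : (H ω₁ - H ω₂) k k' = ((g k k' ω₁ - g k k' ω₂ : ℝ) : ℂ) +
        ((h k k' ω₁ - h k k' ω₂ : ℝ) : ℂ) * Complex.I := by
      simp only [H, Matrix.sub_apply, Matrix.of_apply]
      push_cast
      ring
    rw [e]
    exact entry (hgl k k' ω₁ ω₂) (hhl k k' ω₁ ω₂)
  -- Passing to the Hermitian part does not increase the norm and leaves the values on `Ω`
  -- unchanged, so symmetrising the extension is free.
  have half : ∀ Z : Block j j, hsNorm ((2⁻¹ : ℂ) • (Z + Z.conjTranspose)) ≤ hsNorm Z := fun Z => by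
    rw [hsNorm_smul]
    have h1 := hsNorm_add_le Z Z.conjTranspose
    rw [hsNorm_conjTranspose] at h1
    have h2 : ‖(2⁻¹ : ℂ)‖ = 2⁻¹ := by simp
    rw [h2]
    linarith
  refine ⟨fun ω => (2⁻¹ : ℂ) • (H ω + (H ω).conjTranspose), fun ω => ?_, fun ω hω => ?_,
    fun ω => (half _).trans (hHa ω), fun ω₁ ω₂ => ?_⟩
  · have e : star (2⁻¹ : ℂ) = 2⁻¹ := by simp
    rw [Matrix.IsHermitian, Matrix.conjTranspose_smul, Matrix.conjTranspose_add,
      Matrix.conjTranspose_conjTranspose, add_comm, e]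
  · simp only
    rw [hHX ω hω, (hX ω hω).eq, ← two_smul ℂ (X ω), smul_smul, inv_mul_cancel₀ two_ne_zero,
      one_smul]
  · refine le_trans (le_of_eq ?_) ((half (H ω₁ - H ω₂)).trans (hHl ω₁ ω₂))
    rw [← smul_sub, Matrix.conjTranspose_sub]
    congr 2
    abel

end Extension

/-! ### Lipschitz norms and pointwise bounds -/

section Lip

variable {Ω : Set Freq} {γ : ℝ}

lemma supOn_le {f : Freq → ℝ≥0∞} {c : ℝ≥0∞} (h : ∀ ω ∈ Ω, f ω ≤ c) : supOn Ω f ≤ c :=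
  iSup₂_le h

lemma le_supOn {f : Freq → ℝ≥0∞} {ω : Freq} (hω : ω ∈ Ω) : f ω ≤ supOn Ω f :=
  le_iSup₂_of_le ω hω le_rfl

lemma lipOn_le {g : Freq → Freq → ℝ≥0∞} {c : ℝ≥0∞}
    (h : ∀ ω₁ ∈ Ω, ∀ ω₂ ∈ Ω, g ω₁ ω₂ ≤ c * ENNReal.ofReal ‖ω₁ - ω₂‖) : lipOn Ω g ≤ c :=
  iSup₂_le fun ω₁ h₁ => iSup₂_le fun ω₂ h₂ => iSup_le fun _ =>
    ENNReal.div_le_of_le_mul (h ω₁ h₁ ω₂ h₂)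

lemma le_lipOn {g : Freq → Freq → ℝ≥0∞} {ω₁ ω₂ : Freq} (h₁ : ω₁ ∈ Ω) (h₂ : ω₂ ∈ Ω)
    (hne : ω₁ ≠ ω₂) : g ω₁ ω₂ ≤ lipOn Ω g * ENNReal.ofReal ‖ω₁ - ω₂‖ := by
  have h : g ω₁ ω₂ / ENNReal.ofReal ‖ω₁ - ω₂‖ ≤ lipOn Ω g :=
    le_iSup₂_of_le ω₁ h₁ (le_iSup₂_of_le ω₂ h₂ (le_iSup_of_le hne le_rfl))
  have h0 : ENNReal.ofReal ‖ω₁ - ω₂‖ ≠ 0 := by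
    rw [Ne, ENNReal.ofReal_eq_zero, not_le, norm_pos_iff]
    exact sub_ne_zero.2 hne
  exact (ENNReal.div_le_iff h0 ENNReal.ofReal_ne_top).1 h

lemma ofReal_div_mul_norm (hγ : 0 < γ) (c : ℝ) (ω₁ ω₂ : Freq) :
    ENNReal.ofReal (c / γ) * ENNReal.ofReal ‖ω₁ - ω₂‖ =
      ENNReal.ofReal c * ENNReal.ofReal (‖ω₁ - ω₂‖ / γ) := by
  rw [← ENNReal.ofReal_mul' (norm_nonneg _), ← ENNReal.ofReal_mul' (by positivity)]
  congr 1
  ring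

/-- The factor `γ` of the weighted norm cancels the `1 / γ` of the increments, so a common pointwise
bound `c` costs only a factor `2`. -/
lemma sup_add_lip_le (hγ : 0 < γ) {f : Freq → ℝ≥0∞} {g : Freq → Freq → ℝ≥0∞} {c : ℝ} (hc : 0 ≤ c)
    (hf : ∀ ω ∈ Ω, f ω ≤ ENNReal.ofReal c)
    (hg : ∀ ω₁ ∈ Ω, ∀ ω₂ ∈ Ω, g ω₁ ω₂ ≤ ENNReal.ofReal c * ENNReal.ofReal (‖ω₁ - ω₂‖ / γ)) :
    supOn Ω f + ENNReal.ofReal γ * lipOn Ω g ≤ ENNReal.ofReal (2 * c) := by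
  have h1 : lipOn Ω g ≤ ENNReal.ofReal (c / γ) := lipOn_le fun ω₁ h₁ ω₂ h₂ =>
    (hg ω₁ h₁ ω₂ h₂).trans_eq (ofReal_div_mul_norm hγ c ω₁ ω₂).symm
  have h2 : ENNReal.ofReal γ * lipOn Ω g ≤ ENNReal.ofReal c := by
    refine (mul_le_mul' le_rfl h1).trans_eq ?_
    rw [← ENNReal.ofReal_mul hγ.le]
    congr 1
    field_simp
  rw [two_mul, ENNReal.ofReal_add hc hc]
  exact add_le_add (supOn_le hf) h2

lemma le_of_sup_add_lip_le (hγ : 0 < γ) {f : Freq → ℝ≥0∞} {g : Freq → Freq → ℝ≥0∞} {c : ℝ}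
    (h : supOn Ω f + ENNReal.ofReal γ * lipOn Ω g ≤ ENNReal.ofReal c) {ω₁ ω₂ : Freq}
    (h₁ : ω₁ ∈ Ω) (h₂ : ω₂ ∈ Ω) (hne : ω₁ ≠ ω₂) :
    g ω₁ ω₂ ≤ ENNReal.ofReal c * ENNReal.ofReal (‖ω₁ - ω₂‖ / γ) := by
  refine (le_lipOn h₁ h₂ hne).trans ?_
  rw [ENNReal.ofReal_div_of_pos hγ, ← mul_div_assoc]
  rw [ENNReal.le_div_iff_mul_le (.inl (by simpa using hγ)) (.inl ENNReal.ofReal_ne_top)]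
  calc lipOn Ω g * ENNReal.ofReal ‖ω₁ - ω₂‖ * ENNReal.ofReal γ
      = ENNReal.ofReal γ * lipOn Ω g * ENNReal.ofReal ‖ω₁ - ω₂‖ := by ring
    _ ≤ _ := by gcongr; exact le_add_self.trans h

lemma abs_sub_le_of_realLip (hγ : 0 < γ) {f : Freq → ℝ} {c : ℝ} (hc : 0 ≤ c)
    (h : realLip γ Ω f ≤ ENNReal.ofReal c) {ω₁ ω₂ : Freq} (h₁ : ω₁ ∈ Ω) (h₂ : ω₂ ∈ Ω) :
    |f ω₁ - f ω₂| ≤ c / γ * ‖ω₁ - ω₂‖ := by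
  by_cases hne : ω₁ = ω₂
  · subst hne; simp
  · have h3 := le_of_sup_add_lip_le hγ h h₁ h₂ hne
    rw [← ENNReal.ofReal_mul hc, ENNReal.ofReal_le_ofReal_iff (by positivity)] at h3
    linarith [show c * (‖ω₁ - ω₂‖ / γ) = c / γ * ‖ω₁ - ω₂‖ by ring]

lemma decayNorm_sub_le_of_opLip (hγ : 0 < γ) {η σ m : ℝ} {R : Freq → TimeOp} {c : ℝ}
    (h : opLip η γ Ω σ m R ≤ ENNReal.ofReal c) {ω₁ ω₂ : Freq} (h₁ : ω₁ ∈ Ω) (h₂ : ω₂ ∈ Ω) :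
    decayNorm η σ (m + 2) (R ω₁ - R ω₂) ≤
      ENNReal.ofReal c * ENNReal.ofReal (‖ω₁ - ω₂‖ / γ) := by
  by_cases hne : ω₁ = ω₂
  · subst hne
    rw [sub_self, decayNorm_zero]
    exact zero_le
  · exact le_of_sup_add_lip_le hγ h h₁ h₂ hne

lemma decayNorm_le_of_opLip {η σ m : ℝ} {R : Freq → TimeOp} {c : ℝ≥0∞}
    (h : opLip η γ Ω σ m R ≤ c) {ω : Freq} (hω : ω ∈ Ω) : decayNorm η σ m (R ω) ≤ c :=
  (le_supOn (f := fun ω => decayNorm η σ m (R ω)) hω).trans (le_self_add.trans h)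

lemma blockLipSemi_le {j j' : ℕ} {X : Freq → Block j j'} {c : ℝ} (hc : 0 ≤ c)
    (h : ∀ ω₁ ∈ Ω, ∀ ω₂ ∈ Ω, hsNorm (X ω₁ - X ω₂) ≤ c * ‖ω₁ - ω₂‖) :
    blockLipSemi Ω X ≤ ENNReal.ofReal c :=
  lipOn_le fun ω₁ h₁ ω₂ h₂ => by
    rw [← ENNReal.ofReal_mul hc]
    exact ENNReal.ofReal_le_ofReal (h ω₁ h₁ ω₂ h₂)

end Lip

/-! ### The diagonal blocks -/

lemma isHermitian_initialBlocks (l2 l1 l0 lm1 : ℝ) (j : ℕ) :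
    (initialBlocks l2 l1 l0 lm1 j).IsHermitian := by
  rw [Matrix.IsHermitian, initialBlocks, Matrix.diagonal_conjTranspose]
  congr 1
  funext k
  exact Complex.conj_ofReal _

/-- The unbounded terms in `k²` and `k` have coefficients independent of the frequency and cancel.
For `k = 0` the convention `0⁻¹ = 0` removes the last term. -/
lemma hsNorm_initialBlocks_sub_le (l2 l1 x x' y y' : ℝ) (j : ℕ) :
    hsNorm (initialBlocks l2 l1 x y j - initialBlocks l2 l1 x' y' j) ≤
      2 * (|x - x'| + |y - y'|) := by
  refine hsNorm_le_of_entry_le _ (by positivity) fun k k' => ?_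
  rw [initialBlocks, initialBlocks, Matrix.diagonal_sub, Matrix.diagonal_apply]
  split_ifs with h
  · rw [← Complex.ofReal_sub, Complex.norm_real, Real.norm_eq_abs]
    have hk : |(((k : ℤ) : ℝ))⁻¹| ≤ 1 := by
      rw [abs_inv]
      by_cases h0 : (k : ℤ) = 0
      · simp [h0]
      · exact inv_le_one_of_one_le₀ (by exact_mod_cast Int.one_le_abs h0)
    calc _ = |(x - x') - (y - y') * (((k : ℤ) : ℝ))⁻¹| := by congr 1; ring
      _ ≤ |x - x'| + |y - y'| * |(((k : ℤ) : ℝ))⁻¹| := by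
          rw [← abs_mul]; exact abs_sub _ _
      _ ≤ |x - x'| + |y - y'| * 1 := by gcongr
      _ = _ := by ring
  · rw [norm_zero]; positivity

lemma hsNorm_blockOf_diag_le {σ c : ℝ} (hc : 0 ≤ c) {R : Op}
    (h : bNorm σ (-2) R ≤ ENNReal.ofReal c) (j : ℕ) :
    hsNorm (blockOf R j j) ≤ (jap j ^ 2)⁻¹ * c := by
  have h1 := (bTerm_le_bNorm σ (-2) R j j).trans h
  rw [bTerm, ENNReal.ofReal_le_ofReal_iff hc, sub_self, abs_zero, mul_zero, Real.exp_zero, one_mul,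
    neg_neg, Real.rpow_two] at h1
  have h2 := jap_pos j
  rw [inv_mul_eq_div, le_div_iff₀ (by positivity)]
  exact h1

lemma hsNorm_blockOf_diag_le' {σ c : ℝ} (hc : 0 ≤ c) {R : Op}
    (h : bNorm σ 0 R ≤ ENNReal.ofReal c) (j : ℕ) : hsNorm (blockOf R j j) ≤ c := by
  have h1 := (bTerm_le_bNorm σ 0 R j j).trans h
  rwa [bTerm, ENNReal.ofReal_le_ofReal_iff hc, sub_self, abs_zero, mul_zero, Real.exp_zero, one_mul,
    neg_zero, Real.rpow_zero, mul_one] at h1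


/-! ### The iteration -/

/-- The diagonal parts and perturbations produced by iterating the step. -/
def kamSeq (η χ N₀ : ℝ) (D₀ : Freq → Blocks) (P₀ : Freq → TimeOp) : ℕ → Freq → Blocks × TimeOp
  | 0, ω => (D₀ ω, P₀ ω)
  | n + 1, ω =>
    (stepD (kamSeq η χ N₀ D₀ P₀ n ω).1 (kamSeq η χ N₀ D₀ P₀ n ω).2,
      stepP η (cutoff χ N₀ n) ω (kamSeq η χ N₀ D₀ P₀ n ω).1 (kamSeq η χ N₀ D₀ P₀ n ω).2)

/-- The diagonal part after `n` steps. -/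
def kamD (η χ N₀ : ℝ) (D₀ : Freq → Blocks) (P₀ : Freq → TimeOp) (n : ℕ) (ω : Freq) : Blocks :=
  (kamSeq η χ N₀ D₀ P₀ n ω).1

/-- The perturbation after `n` steps. -/
def kamP (η χ N₀ : ℝ) (D₀ : Freq → Blocks) (P₀ : Freq → TimeOp) (n : ℕ) (ω : Freq) : TimeOp :=
  (kamSeq η χ N₀ D₀ P₀ n ω).2

/-- The generator of the transformation leading to the `n`-th vector field, `n ≥ 1`. -/
def kamF (η χ N₀ : ℝ) (D₀ : Freq → Blocks) (P₀ : Freq → TimeOp) (n : ℕ) (ω : Freq) : TimeOp :=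
  generator η (cutoff χ N₀ (n - 1)) ω (kamD η χ N₀ D₀ P₀ (n - 1) ω) (kamP η χ N₀ D₀ P₀ (n - 1) ω)

/-- Initial data and parameters for which the iteration converges, the `n`-th perturbation having
size `p n`. -/
structure KamData (η σ₀ χ N₀ γ : ℝ) (D₀ : Freq → Blocks) (P₀ : Freq → TimeOp) (A p : ℕ → ℝ) :
    Prop where
  params : ∀ n, StepParams η γ (cutoff χ N₀ n) (sigmaSeq σ₀ (n + 1)) (widthLoss σ₀ n) (A n)
    (ENNReal.ofReal (p n))
  nonneg : ∀ n, 0 ≤ p n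
  step : ∀ n, (ENNReal.ofReal (Real.exp (-(4 * widthLoss σ₀ n * cutoff χ N₀ n))) +
    12 * (ENNReal.ofReal (2 * shiftConst (widthLoss σ₀ n)) *
      (ENNReal.ofReal (A n / γ) * ENNReal.ofReal (p n)))) * ENNReal.ofReal (p n) ≤
    ENNReal.ofReal (p (n + 1))
  sum_le : ∀ n, ∑ k ∈ Finset.range n, p k ≤ γ / 2
  hermitian : ∀ ω j, (D₀ ω j).IsHermitian
  lip : ∀ ω₁ ∈ diophSet γ, ∀ ω₂ ∈ diophSet γ, ∀ j, hsNorm (D₀ ω₁ j - D₀ ω₂ j) ≤ ‖ω₁ - ω₂‖ / 2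
  skew : ∀ ω ∈ diophSet γ, SkewAdj (P₀ ω)
  decay : ∀ ω ∈ diophSet γ, decayNorm η (sigmaSeq σ₀ 0) (-2) (P₀ ω) ≤ ENNReal.ofReal (p 0)
  decay_sub : ∀ ω₁ ∈ diophSet γ, ∀ ω₂ ∈ diophSet γ,
    decayNorm η (sigmaSeq σ₀ 0) 0 (P₀ ω₁ - P₀ ω₂) ≤
      ENNReal.ofReal (p 0) * ENNReal.ofReal (‖ω₁ - ω₂‖ / γ)

section Iteration

variable {η σ₀ χ N₀ γ : ℝ} {D₀ : Freq → Blocks} {P₀ : Freq → TimeOp} {A p : ℕ → ℝ}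
  {n : ℕ} {ω ω₁ ω₂ : Freq}

local notation "𝐃" => kamD η χ N₀ D₀ P₀
local notation "𝐏" => kamP η χ N₀ D₀ P₀
local notation "𝐅" => kamF η χ N₀ D₀ P₀
local notation "𝛀" => melnikovSet η χ N₀ γ (kamD η χ N₀ D₀ P₀)

lemma melnikovSet_anti {D : ℕ → Freq → Blocks} {k n : ℕ} (h : k ≤ n) :
    melnikovSet η χ N₀ γ D n ⊆ melnikovSet η χ N₀ γ D k := by
  induction n, h using Nat.le_induction with
  | base => exact subset_rfl
  | succ n _ ih => exact fun ω hω => ih hω.1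

lemma kamD_succ_sub (n : ℕ) (ω : Freq) (j : ℕ) :
    𝐃 (n + 1) ω j = 𝐃 n ω j - Complex.I • blockOf (𝐏 n ω 0) j j := rfl

namespace KamData

lemma gamma_pos (d : KamData η σ₀ χ N₀ γ D₀ P₀ A p) : 0 < γ := (d.params 0).hγ

lemma sigmaSeq_pos' (d : KamData η σ₀ χ N₀ γ D₀ P₀ A p) (n : ℕ) : 0 < sigmaSeq σ₀ n := by
  rw [sigmaSeq_eq_succ_add]
  exact (d.params n).width_pos

/-- The size of the diagonal correction. -/
lemma hsNorm_correction_le (d : KamData η σ₀ χ N₀ γ D₀ P₀ A p) {R : TimeOp}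
    (h : decayNorm η (sigmaSeq σ₀ n) (-2) R ≤ ENNReal.ofReal (p n)) (j : ℕ) :
    hsNorm (blockOf (R 0) j j) ≤ (jap j ^ 2)⁻¹ * p n :=
  hsNorm_blockOf_diag_le (d.nonneg n)
    ((bNorm_coeff_le_decayNorm (d.sigmaSeq_pos' n).le R 0).trans h) j

/-- The increments of the diagonal correction. -/
lemma hsNorm_correction_sub_le (d : KamData η σ₀ χ N₀ γ D₀ P₀ A p)
    {R S : TimeOp} (h : decayNorm η (sigmaSeq σ₀ n) 0 (R - S) ≤
    ENNReal.ofReal (p n) * ENNReal.ofReal (‖ω₁ - ω₂‖ / γ)) (j : ℕ) :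
    hsNorm (blockOf (R 0) j j - blockOf (S 0) j j) ≤ p n * (‖ω₁ - ω₂‖ / γ) := by
  have hγ := d.gamma_pos
  have hp := d.nonneg n
  rw [← blockOf_sub, ← Pi.sub_apply R S]
  rw [← ENNReal.ofReal_mul hp] at h
  exact hsNorm_blockOf_diag_le' (by positivity)
    ((bNorm_coeff_le_decayNorm (d.sigmaSeq_pos' n).le (R - S) 0).trans h) j

/-- Half of the Lipschitz constant `1` is allotted to `D₀`, the other half to the accumulated
corrections, whose sum is at most `γ / 2`. -/
lemma hsNorm_sub_le_of_increment (d : KamData η σ₀ χ N₀ γ D₀ P₀ A p)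
    {j : ℕ} {X₁ X₂ : Block j j} (h₁ : ω₁ ∈ diophSet γ)
    (h₂ : ω₂ ∈ diophSet γ) (h : hsNorm ((X₁ - D₀ ω₁ j) - (X₂ - D₀ ω₂ j)) ≤
      (∑ k ∈ Finset.range n, p k) * (‖ω₁ - ω₂‖ / γ)) : hsNorm (X₁ - X₂) ≤ ‖ω₁ - ω₂‖ := by
  have hγ := d.gamma_pos
  have e : X₁ - X₂ = ((X₁ - D₀ ω₁ j) - (X₂ - D₀ ω₂ j)) + (D₀ ω₁ j - D₀ ω₂ j) := by abel
  have h3 : (∑ k ∈ Finset.range n, p k) * (‖ω₁ - ω₂‖ / γ) ≤ γ / 2 * (‖ω₁ - ω₂‖ / γ) := by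
    gcongr
    exact d.sum_le n
  have h4 : γ / 2 * (‖ω₁ - ω₂‖ / γ) = ‖ω₁ - ω₂‖ / 2 := by field_simp
  rw [e]
  linarith [hsNorm_add_le ((X₁ - D₀ ω₁ j) - (X₂ - D₀ ω₂ j)) (D₀ ω₁ j - D₀ ω₂ j),
    d.lip ω₁ h₁ ω₂ h₂ j]

/-- The bounds carried along by the iteration. -/
lemma invariant (d : KamData η σ₀ χ N₀ γ D₀ P₀ A p) (n : ℕ) :
    (∀ ω ∈ 𝛀 n, (∀ j, (𝐃 n ω j).IsHermitian) ∧ SkewAdj (𝐏 n ω) ∧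
      decayNorm η (sigmaSeq σ₀ n) (-2) (𝐏 n ω) ≤ ENNReal.ofReal (p n) ∧
      ∀ j, hsNorm (𝐃 n ω j - D₀ ω j) ≤ ∑ k ∈ Finset.range n, p k) ∧
    ∀ ω₁ ∈ 𝛀 n, ∀ ω₂ ∈ 𝛀 n,
      decayNorm η (sigmaSeq σ₀ n) 0 (𝐏 n ω₁ - 𝐏 n ω₂) ≤
        ENNReal.ofReal (p n) * ENNReal.ofReal (‖ω₁ - ω₂‖ / γ) ∧
      ∀ j, hsNorm ((𝐃 n ω₁ j - D₀ ω₁ j) - (𝐃 n ω₂ j - D₀ ω₂ j)) ≤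
        (∑ k ∈ Finset.range n, p k) * (‖ω₁ - ω₂‖ / γ) := by
  induction n with
  | zero =>
    refine ⟨fun ω hω => ⟨d.hermitian ω, d.skew ω hω, d.decay ω hω, fun j => ?_⟩,
      fun ω₁ h₁ ω₂ h₂ => ⟨d.decay_sub ω₁ h₁ ω₂ h₂, fun j => ?_⟩⟩
    · rw [show 𝐃 0 ω j = D₀ ω j from rfl, sub_self, hsNorm_zero]; simp
    · rw [show 𝐃 0 ω₁ j = D₀ ω₁ j from rfl, show 𝐃 0 ω₂ j = D₀ ω₂ j from rfl, sub_self, sub_self,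
        sub_zero, hsNorm_zero]
      simp
  | succ n ih =>
    obtain ⟨ih1, ih2⟩ := ih
    have s := d.params n
    have hI : ‖Complex.I‖ = 1 := Complex.norm_I
    have e := sigmaSeq_eq_succ_add σ₀ n
    refine ⟨fun ω hω => ?_, fun ω₁ h₁ ω₂ h₂ => ?_⟩
    · obtain ⟨i1, i2, i3, i4⟩ := ih1 ω hω.1
      have i3' := i3
      rw [e] at i3'
      have hω0 : ω ∈ diophSet γ := melnikovSet_anti (Nat.zero_le (n + 1)) hω
      have hc := s.skewAdj_coeff hω0 i3' i2 0
      rw [neg_zero] at hc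
      refine ⟨isHermitian_stepD i1 hc, s.skewAdj_stepP hω0 hω.2 i1 i3' i2,
        ((s.decayNorm_stepP_le hω.2 i3').trans ?_).trans (d.step n), fun j => ?_⟩
      · gcongr
        norm_num
      · rw [kamD_succ_sub, Finset.sum_range_succ, sub_right_comm]
        refine (hsNorm_sub_le _ _).trans (add_le_add (i4 j) ?_)
        rw [hsNorm_smul, hI, one_mul]
        refine (d.hsNorm_correction_le i3 j).trans (mul_le_of_le_one_left (d.nonneg n) ?_)
        exact inv_le_one_of_one_le₀ (one_le_pow₀ (one_le_jap j))
    · obtain ⟨i1, i2⟩ := ih2 ω₁ h₁.1 ω₂ h₂.1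
      have m1 := (ih1 ω₁ h₁.1).2.2.1
      have m2 := (ih1 ω₂ h₂.1).2.2.1
      have i1' := i1
      rw [e] at m1 m2 i1'
      -- The Lipschitz bound on the diagonal at level `n`, part of the induction hypothesis, is what
      -- makes the two homological equations comparable.
      refine ⟨(s.decayNorm_stepP_sub_le h₁.2 h₂.2 (fun j => d.hsNorm_sub_le_of_increment
        (melnikovSet_anti (Nat.zero_le (n + 1)) h₁) (melnikovSet_anti (Nat.zero_le (n + 1)) h₂)
        (i2 j)) m1 m2 i1').trans ?_, fun j => ?_⟩
      · rw [← mul_assoc]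
        exact mul_le_mul' (d.step n) le_rfl
      · have e2 : (𝐃 (n + 1) ω₁ j - D₀ ω₁ j) - (𝐃 (n + 1) ω₂ j - D₀ ω₂ j) =
            ((𝐃 n ω₁ j - D₀ ω₁ j) - (𝐃 n ω₂ j - D₀ ω₂ j)) -
              Complex.I • (blockOf (𝐏 n ω₁ 0) j j - blockOf (𝐏 n ω₂ 0) j j) := by
          rw [kamD_succ_sub, kamD_succ_sub, smul_sub]; abel
        rw [e2, Finset.sum_range_succ, add_mul]
        refine (hsNorm_sub_le _ _).trans (add_le_add (i2 j) ?_)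
        rw [hsNorm_smul, hI, one_mul]
        exact d.hsNorm_correction_sub_le i1 j

lemma hsNorm_kamD_sub_le (d : KamData η σ₀ χ N₀ γ D₀ P₀ A p)
    (h₁ : ω₁ ∈ 𝛀 n) (h₂ : ω₂ ∈ 𝛀 n) (j : ℕ) :
    hsNorm (𝐃 n ω₁ j - 𝐃 n ω₂ j) ≤ ‖ω₁ - ω₂‖ :=
  d.hsNorm_sub_le_of_increment (melnikovSet_anti (Nat.zero_le n) h₁)
    (melnikovSet_anti (Nat.zero_le n) h₂) (((d.invariant n).2 ω₁ h₁ ω₂ h₂).2 j)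

lemma decayNorm_kamP_le (d : KamData η σ₀ χ N₀ γ D₀ P₀ A p) (hω : ω ∈ 𝛀 n) :
    decayNorm η (sigmaSeq σ₀ (n + 1) + 4 * widthLoss σ₀ n) (-2) (𝐏 n ω) ≤
      ENNReal.ofReal (p n) := by
  rw [← sigmaSeq_eq_succ_add]
  exact ((d.invariant n).1 ω hω).2.2.1

lemma blockLip_kamD_le (d : KamData η σ₀ χ N₀ γ D₀ P₀ A p)
    (n j : ℕ) : blockLip γ (𝛀 n) (fun ω => 𝐃 n ω j - 𝐃 0 ω j) ≤
    ENNReal.ofReal (2 * ∑ k ∈ Finset.range n, p k) := by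
  have hS : 0 ≤ ∑ k ∈ Finset.range n, p k := Finset.sum_nonneg fun k _ => d.nonneg k
  refine sup_add_lip_le d.gamma_pos hS
    (fun ω hω => ENNReal.ofReal_le_ofReal (((d.invariant n).1 ω hω).2.2.2 j))
    fun ω₁ h₁ ω₂ h₂ => ?_
  rw [← ENNReal.ofReal_mul hS]
  exact ENNReal.ofReal_le_ofReal (((d.invariant n).2 ω₁ h₁ ω₂ h₂).2 j)

lemma opLip_kamP_le (d : KamData η σ₀ χ N₀ γ D₀ P₀ A p)
    (n : ℕ) : opLip η γ (𝛀 n) (sigmaSeq σ₀ n) (-2) (𝐏 n) ≤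
    ENNReal.ofReal (2 * p n) := by
  refine sup_add_lip_le d.gamma_pos (d.nonneg n) (fun ω hω => ((d.invariant n).1 ω hω).2.2.1)
    fun ω₁ h₁ ω₂ h₂ => ?_
  rw [neg_add_cancel]
  exact ((d.invariant n).2 ω₁ h₁ ω₂ h₂).1

lemma opLip_kamF_le (d : KamData η σ₀ χ N₀ γ D₀ P₀ A p) (hA : 0 ≤ A n) : opLip η γ (𝛀 (n + 1))
    (sigmaSeq σ₀ (n + 1) + widthLoss σ₀ n + widthLoss σ₀ n) 0 (𝐅 (n + 1)) ≤
    ENNReal.ofReal (2 * (A n / γ * p n)) := by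
  have hγ := d.gamma_pos
  have hp := d.nonneg n
  refine sup_add_lip_le hγ (by positivity) (fun ω hω => ?_) fun ω₁ h₁ ω₂ h₂ => ?_
  · rw [ENNReal.ofReal_mul (by positivity)]
    exact (d.params n).decayNorm_generator hω.2 (d.decayNorm_kamP_le hω.1)
  · rw [zero_add, ENNReal.ofReal_mul (by positivity)]
    refine (d.params n).decayNorm_generator_sub h₁.2 h₂.2 (d.hsNorm_kamD_sub_le h₁.1 h₂.1)
      (d.decayNorm_kamP_le h₁.1) (d.decayNorm_kamP_le h₂.1) ?_
    rw [← sigmaSeq_eq_succ_add]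
    exact ((d.invariant n).2 ω₁ h₁.1 ω₂ h₂.1).1

lemma transformation (d : KamData η σ₀ χ N₀ γ D₀ P₀ A p) (hω : ω ∈ 𝛀 (n + 1)) :
    MemH η (sigmaSeq σ₀ (n + 1) + widthLoss σ₀ n + widthLoss σ₀ n) 0 (𝐅 (n + 1) ω) ∧
    SkewAdj (𝐅 (n + 1) ω) ∧
    MemH η (sigmaSeq σ₀ (n + 1) + widthLoss σ₀ n + widthLoss σ₀ n) 0 (timeExp (𝐅 (n + 1) ω)) ∧
    (∀ φ ∈ thickTorus η (sigmaSeq σ₀ (n + 1) + widthLoss σ₀ n + widthLoss σ₀ n),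
      evalAt (timeExp (𝐅 (n + 1) ω)) φ = NormedSpace.exp (evalAt (𝐅 (n + 1) ω) φ)) ∧
    ∀ φ ∈ thickTorus η (sigmaSeq σ₀ (n + 1)),
      vectorField (𝐃 (n + 1) ω) (evalAt (𝐏 (n + 1) ω) φ) =
        pushForward ω (timeExp (𝐅 (n + 1) ω))
          (fun ψ => vectorField (𝐃 n ω) (evalAt (𝐏 n ω) ψ)) φ := by
  have s := d.params n
  have hs : 0 < sigmaSeq σ₀ (n + 1) + widthLoss σ₀ n + widthLoss σ₀ n := by
    linarith [s.hτ, s.hρ]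
  have hP := d.decayNorm_kamP_le hω.1
  have hF := s.memH_generator hω.2 hP
  obtain ⟨i1, i2, -, -⟩ := (d.invariant n).1 ω hω.1
  exact ⟨hF.lt_top, s.skewAdj_generator (melnikovSet_anti (Nat.zero_le (n + 1)) hω) hω.2 i1 hP i2,
    memH_timeExp hs.le hF.lt_top, fun φ hφ => evalAt_timeExp hs hF hφ,
    fun φ hφ => s.vectorField_stepP hω.2 hP hφ⟩

/-- The diagonal corrections extend to all Diophantine frequencies. -/
lemma exists_extension (d : KamData η σ₀ χ N₀ γ D₀ P₀ A p)
    (n j : ℕ) : ∃ Y : Freq → Block j j, (∀ ω, (Y ω).IsHermitian) ∧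
    (∀ ω ∈ 𝛀 n, Y ω = 𝐃 (n + 1) ω j - 𝐃 n ω j) ∧
    (∀ ω, hsNorm (Y ω) ≤ 4 * ((jap j ^ 2)⁻¹ * p n)) ∧
    ∀ ω₁ ω₂, hsNorm (Y ω₁ - Y ω₂) ≤ 4 * (p n / γ) * ‖ω₁ - ω₂‖ := by
  have hγ := d.gamma_pos
  have hp := d.nonneg n
  have e : ∀ ω, 𝐃 (n + 1) ω j - 𝐃 n ω j = -(Complex.I • blockOf (𝐏 n ω 0) j j) := fun ω => by
    rw [kamD_succ_sub]; abel
  have hj := jap_pos j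
  refine exists_hermitian_extension (by positivity) (by positivity) (fun ω hω => ?_)
    (fun ω hω => ?_) fun ω₁ h₁ ω₂ h₂ => ?_
  · obtain ⟨i1, i2, -, -⟩ := (d.invariant n).1 ω hω
    have hc := (d.params n).skewAdj_coeff (melnikovSet_anti (Nat.zero_le n) hω)
      (d.decayNorm_kamP_le hω) i2 0
    rw [neg_zero] at hc
    exact (isHermitian_stepD i1 hc j).sub (i1 j)
  · rw [e, hsNorm_neg, hsNorm_smul, Complex.norm_I, one_mul]
    exact d.hsNorm_correction_le ((d.invariant n).1 ω hω).2.2.1 j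
  · rw [e, e, neg_sub_neg, ← smul_sub, hsNorm_smul, Complex.norm_I, one_mul, ← hsNorm_neg, neg_sub]
    refine (d.hsNorm_correction_sub_le ((d.invariant n).2 ω₁ h₁ ω₂ h₂).1 j).trans_eq ?_
    ring

/-- The corrections are extended one at a time and added to `D₀`, which is already defined
everywhere. Extending each `D_n` separately would not keep consecutive differences small off the
Melnikov sets. -/
lemma exists_extensions (d : KamData η σ₀ χ N₀ γ D₀ P₀ A p) : ∃ E : ℕ → Freq → Blocks,
    (∀ n j, (∀ ω ∈ diophSet γ, (E n ω j).IsHermitian) ∧ (∀ ω ∈ 𝛀 n, E n ω j = 𝐃 n ω j) ∧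
      blockLipSemi (diophSet γ) (fun ω => E n ω j) < ⊤) ∧
    ∀ n j, (∀ ω ∈ diophSet γ, hsNorm (E (n + 1) ω j - E n ω j) ≤ 4 * ((jap j ^ 2)⁻¹ * p n)) ∧
      blockLipSemi (diophSet γ) (fun ω => E (n + 1) ω j - E n ω j) ≤
        ENNReal.ofReal (4 * (p n / γ)) := by
  have hγ := d.gamma_pos
  choose Y hY1 hY2 hY3 hY4 using d.exists_extension
  refine ⟨fun n ω j => D₀ ω j + ∑ k ∈ Finset.range n, Y k j ω, fun n j => ⟨fun ω _ => ?_,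
    fun ω hω => ?_, ?_⟩, fun n j => ⟨fun ω _ => ?_, ?_⟩⟩
  · refine (d.hermitian ω j).add ?_
    rw [Matrix.IsHermitian, Matrix.conjTranspose_sum]
    exact Finset.sum_congr rfl fun k _ => (hY1 k j ω).eq
  · have h : ∀ k ∈ Finset.range n, Y k j ω = 𝐃 (k + 1) ω j - 𝐃 k ω j := fun k hk =>
      hY2 k j ω (melnikovSet_anti (Finset.mem_range.1 hk).le hω)
    beta_reduce
    rw [Finset.sum_congr rfl h, Finset.sum_range_sub (fun k => 𝐃 k ω j)]
    exact add_sub_cancel _ _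
  · refine (blockLipSemi_le (c := 1 / 2 + ∑ k ∈ Finset.range n, 4 * (p k / γ)) ?_
      fun ω₁ h₁ ω₂ h₂ => ?_).trans_lt ENNReal.ofReal_lt_top
    · have : 0 ≤ ∑ k ∈ Finset.range n, 4 * (p k / γ) := Finset.sum_nonneg fun k _ => by
        have := d.nonneg k
        positivity
      linarith
    · have e : D₀ ω₁ j + ∑ k ∈ Finset.range n, Y k j ω₁ -
          (D₀ ω₂ j + ∑ k ∈ Finset.range n, Y k j ω₂) =
          (D₀ ω₁ j - D₀ ω₂ j) + ∑ k ∈ Finset.range n, (Y k j ω₁ - Y k j ω₂) := by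
        rw [Finset.sum_sub_distrib]; abel
      rw [e, add_mul, Finset.sum_mul]
      refine (hsNorm_add_le _ _).trans (add_le_add ?_ ((hsNorm_sum_le _ _).trans
        (Finset.sum_le_sum fun k _ => hY4 k j ω₁ ω₂)))
      linarith [d.lip ω₁ h₁ ω₂ h₂ j]
  · simp only [Finset.sum_range_succ, ← add_assoc, add_sub_cancel_left]
    exact hY3 n j ω
  · have hp := d.nonneg n
    refine blockLipSemi_le (by positivity) fun ω₁ _ ω₂ _ => ?_
    simp only [Finset.sum_range_succ, ← add_assoc, add_sub_cancel_left]
    exact hY4 n j ω₁ ω₂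

end KamData

end Iteration


/-! ### Smallness -/

section Smallness

variable {η σ₀ χ K M N₀ γ ε : ℝ} {A : ℕ → ℝ}

/-- The size of the `n`-th perturbation. -/
def kamSize (K χ ε : ℝ) (n : ℕ) : ℝ := K * Real.exp 1 * ε * Real.exp (-χ ^ n)

lemma kamSize_pos (hK : 0 < K) (hε : 0 < ε) (n : ℕ) : 0 < kamSize K χ ε n := by
  have := Real.exp_pos 1
  rw [kamSize]; positivity

lemma kamSize_zero : kamSize K χ ε 0 = K * ε := by
  rw [kamSize, pow_zero, Real.exp_neg]
  have := Real.exp_pos 1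
  field_simp

lemma kamSize_succ (n : ℕ) :
    Real.exp (-((χ - 1) * χ ^ n)) * kamSize K χ ε n = kamSize K χ ε (n + 1) := by
  have h : Real.exp (-χ ^ (n + 1)) = Real.exp (-((χ - 1) * χ ^ n)) * Real.exp (-χ ^ n) := by
    rw [← Real.exp_add]; congr 1; ring
  rw [kamSize, kamSize, h]; ring

lemma sum_kamSize_le (hχ : 1 < χ) (hK : 0 < K) (hε : 0 < ε) (n : ℕ) :
    ∑ k ∈ Finset.range n, kamSize K χ ε k ≤
      K * Real.exp 1 * ε * ∑' k : ℕ, Real.exp (-χ ^ k) := by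
  have := Real.exp_pos 1
  simp only [kamSize]
  rw [← Finset.mul_sum]
  gcongr
  exact (summable_exp_neg_pow hχ).sum_le_tsum _ fun k _ => (Real.exp_pos _).le

/-- The divisors may grow like `e^{(2-χ)χ^n}`, because multiplied by `e^{-χ^n}` this is exactly the
gain `e^{-(χ-1)χ^n}` from one step to the next. Half of that gain is left for the Fourier tail. -/
lemma divisor_mul_kamSize_le (hK : 0 < K) (hM : 0 < M) (hγ : 0 < γ) (hε : 0 < ε)
    (hχ₁ : 1 < χ)
    (hA : ∀ n, shiftConst (widthLoss σ₀ n) * A n ≤ M * Real.exp (min (2 - χ) (1 / 2) * χ ^ n))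
    (hsm : 48 * M * K * Real.exp 1 * (ε * γ⁻¹) ≤ 1) (n : ℕ) :
    12 * (2 * shiftConst (widthLoss σ₀ n) * (A n / γ * kamSize K χ ε n)) ≤
      Real.exp (-((χ - 1) * χ ^ n)) / 2 := by
  have hp := kamSize_pos (χ := χ) hK hε n
  have hx : 0 < χ ^ n := by positivity
  have h1 : shiftConst (widthLoss σ₀ n) * A n ≤ M * Real.exp ((2 - χ) * χ ^ n) :=
    (hA n).trans (by gcongr; exact min_le_left _ _)
  have e : Real.exp ((2 - χ) * χ ^ n) * Real.exp (-χ ^ n) = Real.exp (-((χ - 1) * χ ^ n)) := by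
    rw [← Real.exp_add]; congr 1; ring
  calc 12 * (2 * shiftConst (widthLoss σ₀ n) * (A n / γ * kamSize K χ ε n))
      = 24 * (shiftConst (widthLoss σ₀ n) * A n) * (kamSize K χ ε n / γ) := by ring
    _ ≤ 24 * (M * Real.exp ((2 - χ) * χ ^ n)) * (kamSize K χ ε n / γ) := by gcongr
    _ = 48 * M * K * Real.exp 1 * (ε * γ⁻¹) *
          (Real.exp ((2 - χ) * χ ^ n) * Real.exp (-χ ^ n)) / 2 := by rw [kamSize]; ring
    _ ≤ 1 * (Real.exp ((2 - χ) * χ ^ n) * Real.exp (-χ ^ n)) / 2 := by gcongr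
    _ = _ := by rw [one_mul, e]

lemma ofReal_mul_ofReal_mul {a b c : ℝ} (ha : 0 ≤ a) (hb : 0 ≤ b) :
    ENNReal.ofReal a * (ENNReal.ofReal b * ENNReal.ofReal c) = ENNReal.ofReal (a * (b * c)) := by
  rw [← ENNReal.ofReal_mul hb, ← ENNReal.ofReal_mul ha]

lemma stepParams_of_small (hη : 0 < η) (hσ₀ : 0 < σ₀) (hχ₁ : 1 < χ) (hK : 0 < K)
    (hM : 0 < M) (hN₀ : 0 < N₀) (hγ : 0 < γ) (hε : 0 < ε) (hA0 : ∀ n, 0 ≤ A n)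
    (hA1 : ∀ n (l : Idx), 2 * smallDiv l ^ 2 * (l.wt η + 2) ≤
        A n * Real.exp (2 * widthLoss σ₀ n * l.wt η))
    (hA : ∀ n, shiftConst (widthLoss σ₀ n) * A n ≤ M * Real.exp (min (2 - χ) (1 / 2) * χ ^ n))
    (hsm : 48 * M * K * Real.exp 1 * (ε * γ⁻¹) ≤ 1) (n : ℕ) :
    StepParams η γ (cutoff χ N₀ n) (sigmaSeq σ₀ (n + 1)) (widthLoss σ₀ n) (A n)
      (ENNReal.ofReal (kamSize K χ ε n)) where
  hη := hη
  hγ := hγ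
  hN := by
    have := jap_pos n
    rw [cutoff]; positivity
  hτ := sigmaSeq_pos hσ₀ _
  hρ := widthLoss_pos hσ₀ n
  hA := hA1 n
  hp := ENNReal.ofReal_ne_top
  hq := by
    have h := divisor_mul_kamSize_le hK hM hγ hε hχ₁ hA hsm n
    have hc := one_le_shiftConst (widthLoss_pos hσ₀ n)
    have h0 := hA0 n
    have h1 : Real.exp (-((χ - 1) * χ ^ n)) ≤ 1 := by
      refine Real.exp_le_one_iff.2 ?_
      have : 0 ≤ (χ - 1) * χ ^ n := mul_nonneg (by linarith) (by positivity)
      linarith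
    rw [ofReal_mul_ofReal_mul (by linarith) (by positivity)]
    refine (ENNReal.ofReal_le_ofReal (q := 2⁻¹) (by linarith)).trans_eq ?_
    rw [ENNReal.ofReal_inv_of_pos two_pos, ENNReal.ofReal_ofNat]

lemma step_of_small (hσ₀ : 0 < σ₀) (hχ₁ : 1 < χ) (hχ₂ : χ < 2) (hK : 0 < K)
    (hM : 0 < M) (hN : 32 * Real.pi / σ₀ ≤ N₀) (hγ : 0 < γ) (hε : 0 < ε) (hA0 : ∀ n, 0 ≤ A n)
    (hA : ∀ n, shiftConst (widthLoss σ₀ n) * A n ≤ M * Real.exp (min (2 - χ) (1 / 2) * χ ^ n))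
    (hsm : 48 * M * K * Real.exp 1 * (ε * γ⁻¹) ≤ 1) (n : ℕ) :
    (ENNReal.ofReal (Real.exp (-(4 * widthLoss σ₀ n * cutoff χ N₀ n))) +
      12 * (ENNReal.ofReal (2 * shiftConst (widthLoss σ₀ n)) *
        (ENNReal.ofReal (A n / γ) * ENNReal.ofReal (kamSize K χ ε n)))) *
      ENNReal.ofReal (kamSize K χ ε n) ≤ ENNReal.ofReal (kamSize K χ ε (n + 1)) := by
  have h := divisor_mul_kamSize_le hK hM hγ hε hχ₁ hA hsm n
  have hc := one_le_shiftConst (widthLoss_pos hσ₀ n)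
  have h0 := hA0 n
  have hp := (kamSize_pos (χ := χ) hK hε n).le
  have hq : 0 ≤ 2 * shiftConst (widthLoss σ₀ n) * (A n / γ * kamSize K χ ε n) := by positivity
  rw [ofReal_mul_ofReal_mul (by linarith) (by positivity), ← ENNReal.ofReal_ofNat 12,
    ← ENNReal.ofReal_mul (by norm_num), ← ENNReal.ofReal_add (Real.exp_pos _).le (by linarith),
    ← ENNReal.ofReal_mul (by have := Real.exp_pos (-(4 * widthLoss σ₀ n * cutoff χ N₀ n)); linarith),
    ← kamSize_succ]
  refine ENNReal.ofReal_le_ofReal (mul_le_mul_of_nonneg_right ?_ hp)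
  linarith [exp_cutoff_le hσ₀ hχ₁ hχ₂ hN n]

end Smallness

end AlmostPeriodicKAM
end

/-! ### Choice of the constants and conclusion -/

open AlmostPeriodicKAM

theorem theorem5p1 (η σ₀ χ K : ℝ) (hη : 0 < η) (hσ₀ : 0 < σ₀) (hχ₁ : 1 < χ) (hχ₂ : χ < 2)
    (hK : 0 < K) :
    -- all constants depend only on `η, σ₀, χ` and on the constant `K` of the initial bounds
    ∃ Nbar δ Cstar C : ℝ, 0 < Nbar ∧ 0 < δ ∧ δ < 1 ∧ 0 < Cstar ∧ 0 < C ∧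
    ∀ N₀ γ ε : ℝ, Nbar ≤ N₀ → 0 < γ → γ < 1 → 0 < ε → ε * γ⁻¹ ≤ δ →
    ∀ (l2 l1 : ℝ) (l0 lm1 : Freq → ℝ) (P₀ : Freq → TimeOp),
      |l2 - 1| ≤ K * ε → |l1| ≤ K * ε →
      realLip γ (diophSet γ) l0 ≤ ENNReal.ofReal (K * ε) →
      realLip γ (diophSet γ) lm1 ≤ ENNReal.ofReal (K * ε) →
      opLip η γ (diophSet γ) σ₀ (-2) P₀ ≤ ENNReal.ofReal (K * ε) →
      (∀ ω ∈ diophSet γ, SkewAdj (P₀ ω)) →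
    ∃ (D : ℕ → Freq → Blocks) (P F Φ : ℕ → Freq → TimeOp) (Dext : ℕ → Freq → Blocks),
      (∀ ω, D 0 ω = initialBlocks l2 l1 (l0 ω) (lm1 ω)) ∧ P 0 = P₀ ∧
      -- the vector fields at step `n`
      (∀ n : ℕ,
        (∀ ω ∈ melnikovSet η χ N₀ γ D n,
          (∀ j : ℕ, (D n ω j).IsHermitian) ∧
          MemH η (sigmaSeq σ₀ n) (-2) (P n ω) ∧
          SkewAdj (P n ω) ∧
          (∀ φ : ℕ+ → ℝ,
            (vectorField (D n ω) (evalAt (P n ω) fun j => (φ j : ℂ))).adjoint =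
              -vectorField (D n ω) (evalAt (P n ω) fun j => (φ j : ℂ)))) ∧
        (∀ j : ℕ, blockLip γ (melnikovSet η χ N₀ γ D n) (fun ω => D n ω j - D 0 ω j) ≤
          ENNReal.ofReal (C * ε)) ∧
        opLip η γ (melnikovSet η χ N₀ γ D n) (sigmaSeq σ₀ n) (-2) (P n) ≤
          ENNReal.ofReal (Cstar * ε * Real.exp (-χ ^ n))) ∧
      -- the transformations from step `n` to step `n + 1`
      (∀ n : ℕ,
        (∀ ω ∈ melnikovSet η χ N₀ γ D (n + 1),
          MemH η ((sigmaSeq σ₀ n + sigmaSeq σ₀ (n + 1)) / 2) 0 (F (n + 1) ω) ∧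
          SkewAdj (F (n + 1) ω) ∧
          MemH η ((sigmaSeq σ₀ n + sigmaSeq σ₀ (n + 1)) / 2) 0 (Φ (n + 1) ω) ∧
          (∀ φ ∈ thickTorus η ((sigmaSeq σ₀ n + sigmaSeq σ₀ (n + 1)) / 2),
            evalAt (Φ (n + 1) ω) φ = NormedSpace.exp (evalAt (F (n + 1) ω) φ)) ∧
          (∀ φ ∈ thickTorus η (sigmaSeq σ₀ (n + 1)),
            vectorField (D (n + 1) ω) (evalAt (P (n + 1) ω) φ) =
              pushForward ω (Φ (n + 1) ω)
                (fun ψ => vectorField (D n ω) (evalAt (P n ω) ψ)) φ)) ∧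
        opLip η γ (melnikovSet η χ N₀ γ D (n + 1))
            ((sigmaSeq σ₀ n + sigmaSeq σ₀ (n + 1)) / 2) 0 (F (n + 1)) ≤
          ENNReal.ofReal (C * (ε * γ⁻¹) * Real.exp (-(χ ^ n / 2)))) ∧
      -- the Lipschitz extensions of the blocks
      (∀ (n j : ℕ),
        (∀ ω ∈ diophSet γ, (Dext n ω j).IsHermitian) ∧
        (∀ ω ∈ melnikovSet η χ N₀ γ D n, Dext n ω j = D n ω j) ∧
        blockLipSemi (diophSet γ) (fun ω => Dext n ω j) < ⊤) ∧
      (∀ (n j : ℕ),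
        (∀ ω ∈ diophSet γ, hsNorm (Dext (n + 1) ω j - Dext n ω j) ≤
          C * (jap j ^ 2)⁻¹ * ε * Real.exp (-χ ^ n)) ∧
        blockLipSemi (diophSet γ) (fun ω => Dext (n + 1) ω j - Dext n ω j) ≤
          ENNReal.ofReal (C * (ε * γ⁻¹) * Real.exp (-χ ^ n))) := by
  have hpi := Real.pi_pos
  have he := Real.exp_pos 1
  -- The bound `κ ≤ 2 - χ` closes the recursion, while `κ ≤ 1/2` leaves the decay `e^{-χ^n/2}` for
  -- the generators.
  obtain ⟨M, A, hM, hA0, hA1, hA⟩ := exists_divisor_bound hη hσ₀ hχ₁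
    (lt_min (sub_pos.2 hχ₂) one_half_pos)
  set S : ℝ := ∑' k : ℕ, Real.exp (-χ ^ k) with hS
  have hS0 : 0 ≤ S := tsum_nonneg fun k => (Real.exp_pos _).le
  -- The first three summands encode the smallness requirements: divisors against the gain of a
  -- step, sum of the corrections against `γ / 2`, and Lipschitz variation of `D₀`. The final `2`
  -- ensures `δ = 1 / B < 1`.
  set B : ℝ := 48 * M * K * Real.exp 1 + 2 * K * Real.exp 1 * S + 8 * K + 2 with hB
  have b1 : 0 < 48 * M * K * Real.exp 1 := by positivity
  have b2 : 0 ≤ 2 * K * Real.exp 1 * S := by positivity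
  have hB2 : 2 < B := by rw [hB]; linarith
  have hKe : 0 < K * Real.exp 1 := by positivity
  have c1 : 0 ≤ K * Real.exp 1 * S := by positivity
  have c2 : 0 ≤ M * K * Real.exp 1 := by positivity
  -- The summands serve, in order, the extensions (factor `4`), the total drift of the diagonal
  -- blocks, and the generators; the last two carry the factor `2` from adding the sup and Lipschitz
  -- parts.
  set C : ℝ := 4 * (K * Real.exp 1) + 2 * (K * Real.exp 1 * S) + 2 * (M * K * Real.exp 1) with hC
  refine ⟨32 * Real.pi / σ₀, 1 / B, 2 * K * Real.exp 1, C, by positivity, by positivity,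
    (div_lt_one (by linarith)).2 (by linarith), by positivity, by positivity, ?_⟩
  intro N₀ γ ε hN hγ _ hε hδ l2 l1 l0 lm1 P₀ _ _ hl0 hlm1 hP₀ hsk
  have hx : 0 < ε * γ⁻¹ := by positivity
  have hBx : B * (ε * γ⁻¹) ≤ 1 := by
    rw [le_div_iff₀ (by linarith)] at hδ
    linarith
  have small : ∀ b, b ≤ B → b * (ε * γ⁻¹) ≤ 1 := fun b hb =>
    (mul_le_mul_of_nonneg_right hb hx.le).trans hBx
  have sm1 := small (48 * M * K * Real.exp 1) (by rw [hB]; linarith)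
  have sm2 := small (2 * K * Real.exp 1 * S) (by rw [hB]; linarith)
  have sm3 := small (8 * K) (by rw [hB]; linarith)
  have hN0 : 0 < N₀ := lt_of_lt_of_le (by positivity) hN
  have hKε : 0 ≤ K * ε := by positivity
  have hσ : sigmaSeq σ₀ 0 = σ₀ := by simp [sigmaSeq]
  have d : KamData η σ₀ χ N₀ γ (fun ω => initialBlocks l2 l1 (l0 ω) (lm1 ω)) P₀ A
      (kamSize K χ ε) :=
    { params := stepParams_of_small hη hσ₀ hχ₁ hK hM hN0 hγ hε hA0 hA1 hA sm1
      nonneg := fun n => (kamSize_pos hK hε n).le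
      step := step_of_small hσ₀ hχ₁ hχ₂ hK hM hN hγ hε hA0 hA sm1
      sum_le := fun n => by
        refine (sum_kamSize_le hχ₁ hK hε n).trans ?_
        have e : K * Real.exp 1 * ε * S = γ / 2 * (2 * K * Real.exp 1 * S * (ε * γ⁻¹)) := by
          field_simp
        rw [← hS, e]
        exact mul_le_of_le_one_right (by positivity) sm2
      hermitian := fun ω j => isHermitian_initialBlocks _ _ _ _ j
      lip := fun ω₁ h₁ ω₂ h₂ j => by
        refine (hsNorm_initialBlocks_sub_le _ _ _ _ _ _ j).trans ?_
        have a1 := abs_sub_le_of_realLip hγ hKε hl0 h₁ h₂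
        have a2 := abs_sub_le_of_realLip hγ hKε hlm1 h₁ h₂
        have e : K * ε / γ * ‖ω₁ - ω₂‖ = 8 * K * (ε * γ⁻¹) * ‖ω₁ - ω₂‖ / 8 := by ring
        have a3 := mul_le_mul_of_nonneg_right sm3 (norm_nonneg (ω₁ - ω₂))
        linarith
      skew := hsk
      decay := fun ω hω => by
        rw [hσ, kamSize_zero]
        exact decayNorm_le_of_opLip hP₀ hω
      decay_sub := fun ω₁ h₁ ω₂ h₂ => by
        have h := decayNorm_sub_le_of_opLip hγ hP₀ h₁ h₂
        rw [neg_add_cancel] at h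
        rwa [hσ, kamSize_zero] }
  obtain ⟨E, hE1, hE2⟩ := d.exists_extensions
  -- The step from `σ_n` to `σ_{n+1}` loses `4ρ_n`; the generator spends `2ρ_n` on the divisors and
  -- so lives exactly on the midpoint width.
  have hmid : ∀ n, (sigmaSeq σ₀ n + sigmaSeq σ₀ (n + 1)) / 2 =
      sigmaSeq σ₀ (n + 1) + widthLoss σ₀ n + widthLoss σ₀ n := fun n => by
    rw [sigmaSeq_eq_succ_add σ₀ n]; ring
  set D₀ : Freq → Blocks := fun ω => initialBlocks l2 l1 (l0 ω) (lm1 ω)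
  refine ⟨kamD η χ N₀ D₀ P₀, kamP η χ N₀ D₀ P₀, kamF η χ N₀ D₀ P₀,
    fun n ω => timeExp (kamF η χ N₀ D₀ P₀ n ω), E, fun ω => rfl, rfl,
    fun n => ⟨fun ω hω => ?_, fun j => ?_, ?_⟩, fun n => ⟨fun ω hω => ?_, ?_⟩, hE1,
    fun n j => ⟨fun ω hω => ((hE2 n j).1 ω hω).trans ?_, (hE2 n j).2.trans ?_⟩⟩
  · obtain ⟨i1, i2, i3, -⟩ := (d.invariant n).1 ω hω
    exact ⟨i1, i3.trans_lt ENNReal.ofReal_lt_top, i2, fun φ => adjoint_vectorField i1 (i2 φ)⟩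
  · refine (d.blockLip_kamD_le n j).trans (ENNReal.ofReal_le_ofReal ?_)
    have h := sum_kamSize_le hχ₁ hK hε n
    rw [← hS] at h
    have h2 : 2 * (K * Real.exp 1 * S) * ε ≤ C * ε := by gcongr; rw [hC]; linarith
    linarith
  · refine (d.opLip_kamP_le n).trans_eq ?_
    rw [kamSize]
    congr 1
    ring
  · rw [hmid]
    exact d.transformation hω
  · rw [hmid]
    refine (d.opLip_kamF_le (hA0 n)).trans (ENNReal.ofReal_le_ofReal ?_)
    have hA2 : A n ≤ M * Real.exp (1 / 2 * χ ^ n) := by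
      refine (le_mul_of_one_le_left (hA0 n) (one_le_shiftConst (widthLoss_pos hσ₀ n))).trans
        ((hA n).trans ?_)
      gcongr
      exact min_le_right _ _
    have e : Real.exp (1 / 2 * χ ^ n) * Real.exp (-χ ^ n) = Real.exp (-(χ ^ n / 2)) := by
      rw [← Real.exp_add]; congr 1; ring
    have hp := kamSize_pos (χ := χ) hK hε n
    calc 2 * (A n / γ * kamSize K χ ε n)
        ≤ 2 * (M * Real.exp (1 / 2 * χ ^ n) / γ * kamSize K χ ε n) := by gcongr
      _ = 2 * (M * K * Real.exp 1) * (ε * γ⁻¹) *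
            (Real.exp (1 / 2 * χ ^ n) * Real.exp (-χ ^ n)) := by rw [kamSize]; ring
      _ ≤ C * (ε * γ⁻¹) * Real.exp (-(χ ^ n / 2)) := by
          rw [e]
          gcongr
          rw [hC]; linarith
  · have hj := jap_pos j
    calc 4 * ((jap j ^ 2)⁻¹ * kamSize K χ ε n)
        = 4 * (K * Real.exp 1) * (jap j ^ 2)⁻¹ * ε * Real.exp (-χ ^ n) := by rw [kamSize]; ring
      _ ≤ _ := by
          gcongr
          rw [hC]; linarith
  · refine ENNReal.ofReal_le_ofReal ?_
    calc 4 * (kamSize K χ ε n / γ)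
        = 4 * (K * Real.exp 1) * (ε * γ⁻¹) * Real.exp (-χ ^ n) := by rw [kamSize]; ring
      _ ≤ _ := by
          gcongr
          rw [hC]; linarith
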